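/- Let $k$ be a field and $a\in k^\times$. For $n\ge 0$ let $H_n=H_n(k,a)$ be the Iwahori–Hecke algebra: the $k$-algebra generated by $g_1,\dots,g_{n-1}$ with relations $g_ig_{i+1}g_i=g_{i+1}g_ig_{i+1}$, $g_ig_j=g_jg_i$ for $|i-j|\ge 2$, and $g_i^2=(a-a^{-1})g_i+1$. Let $H$ be the $k$-linear category with objects the natural numbers, $H(n,n)=H_n$ and $H(m,n)=0$ for $m\ne n$, and let $[H^{\mathrm{op}},\mathbf{Vec}]$ be the category of $k$-linear presheaves on $H$, that is, of sequences $(M_n)_{n\ge 0}$ of right $H_n$-modules, with the monoidal structure given by Day convolution along $H_m\otimes H_n\to H_{m+n}$, $g_i\otimes g_j\mapsto g_ig_{m+j}$: $$(M\otimes N)_p=\bigoplus_{m+n=p}(M_m\otimes_k N_n)\otimes_{H_m\otimes H_n}H_p .$$ (The idempotent completion $\mathcal H$ of $H$, the category of polynomial type 1 representations of $U_a(\mathfrak{gl}_\infty)$, sits inside it.) Let $X=H(-,1)$, let $T=\bigoplus_{n\ge 0}X^{\otimes n}$ be the tensor algebra, with $T_n=X^{\otimes n}=H(-,n)$ the regular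 right $H_n$-module in degree $n$, and let $S=\mathrm{QSym}$ be the algebra whose degree $n$ part is the one-dimensional $H_n$-module $k$ on which all $g_i$ act by $a$ (the partition with one row), with multiplication $k\otimes k\to k$. Let $\mathbf{HS}$ be the $k$-linear category whose objects are the partitions, with $\mathbf{HS}(\lambda,\mu)=k\{\mu\setminus\lambda\}$ if $\lambda\subseteq\mu$ and $\mu\setminus\lambda$ is a horizontal strip (no two boxes in the same column), and $\mathbf{HS}(\lambda,\mu)=0$ otherwise; the composite $(\nu\setminus\mu)(\mu\setminus\lambda)$ is $\nu\setminus\lambda$ if this is a horizontal strip, and zero otherwise. Call $a$ generic if no quantum integer $[n]=a^{n-1}+a^{n-3}+\dots+a^{1-n}$, $n\ge 1$, vanishes in $k$. **Theorem.** Suppose that $a$ is generic. 1. The maps $H_n\to k$, $g_i\mapsto a$, form a surjective homomorphism of algebras $T\to S$, whose kernel $I$ is in degree $n$ the sum of all simple subobjects of $X^{\otimes n}$ other than the one-row representation; so $S=T/I$. 2. $S$ is Morita equivalent to $\mathbf{HS}$: the category of right $S$-modules in $[H^{\mathrm{op}},\mathbf{Vec}]$ and the category of $k$-linear functors $\mathbf{HS}\to\mathbf{Vec}_k$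 are equivalent as $k$-linear categories. Moreover, the indeterminate $a$ of $k=\mathbb C(a)$ is generic, and so is $a=1$ in every field of characteristic zero. (For $k=\mathbb C$ and $a=1$, where $H_n$ is the group algebra of the symmetric group, this is the classical case of the algebra $\mathrm{Sym}$.) -/

import Mathlib

open CategoryTheory MulOpposite

universe u

namespace HeckeCat

/-! ### Iwahori–Hecke algebras -/

/-- The defining relations of the Iwahori–Hecke algebra `H_n` with parameter `a`. The generators are
indexed from `0`, so that the index `i` stands for `g_{i+1}`, with `i + 1 < n`. -/
inductive Rel (k : Type u) [Field k] (a : kˣ) (n : ℕ) :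
    FreeAlgebra k {i : ℕ // i + 1 < n} → FreeAlgebra k {i : ℕ // i + 1 < n} → Prop
  | braid (i j : {i : ℕ // i + 1 < n}) (h : j.1 = i.1 + 1) :
      Rel k a n (FreeAlgebra.ι k i * FreeAlgebra.ι k j * FreeAlgebra.ι k i)
        (FreeAlgebra.ι k j * FreeAlgebra.ι k i * FreeAlgebra.ι k j)
  | comm (i j : {i : ℕ // i + 1 < n}) (h : i.1 + 2 ≤ j.1) :
      Rel k a n (FreeAlgebra.ι k i * FreeAlgebra.ι k j) (FreeAlgebra.ι k j * FreeAlgebra.ι k i)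
  | quad (i : {i : ℕ // i + 1 < n}) :
      Rel k a n (FreeAlgebra.ι k i * FreeAlgebra.ι k i)
        (((a : k) - (↑a⁻¹ : k)) • FreeAlgebra.ι k i + 1)

/-- The Iwahori–Hecke algebra `H_n` over `k` with parameter `a`. -/
def Hecke (k : Type u) [Field k] (a : kˣ) (n : ℕ) : Type u := RingQuot (Rel k a n)

variable {k : Type u} [Field k] {a : kˣ}

noncomputable instance (n : ℕ) : Ring (Hecke k a n) := inferInstanceAs (Ring (RingQuot (Rel k a n)))

noncomputable instance (n : ℕ) : Algebra k (Hecke k a n) :=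
  inferInstanceAs (Algebra k (RingQuot (Rel k a n)))

namespace Hecke

/-- The generator `g_{i+1}` of `H_n`. -/
noncomputable def gen {n : ℕ} (i : {i : ℕ // i + 1 < n}) : Hecke k a n :=
  RingQuot.mkAlgHom k (Rel k a n) (FreeAlgebra.ι k i)

theorem gen_braid {n : ℕ} (i j : {i : ℕ // i + 1 < n}) (h : j.1 = i.1 + 1) :
    (gen i * gen j * gen i : Hecke k a n) = gen j * gen i * gen j := by
  have := RingQuot.mkAlgHom_rel k (Rel.braid (k := k) (a := a) i j h)
  simp only [map_mul] at this
  exact this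

theorem gen_comm {n : ℕ} (i j : {i : ℕ // i + 1 < n}) (h : i.1 + 2 ≤ j.1) :
    (gen i * gen j : Hecke k a n) = gen j * gen i := by
  have := RingQuot.mkAlgHom_rel k (Rel.comm (k := k) (a := a) i j h)
  simp only [map_mul] at this
  exact this

theorem gen_quad {n : ℕ} (i : {i : ℕ // i + 1 < n}) :
    (gen i * gen i : Hecke k a n) = ((a : k) - (↑a⁻¹ : k)) • gen i + 1 := by
  have := RingQuot.mkAlgHom_rel k (Rel.quad (k := k) (a := a) i)
  simp only [map_mul, map_add, map_smul, map_one] at this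
  exact this

/-- The universal property of `H_n`. -/
noncomputable def lift {n : ℕ} {B : Type u} [Ring B] [Algebra k B] (f : {i : ℕ // i + 1 < n} → B)
    (hb : ∀ i j, j.1 = i.1 + 1 → f i * f j * f i = f j * f i * f j)
    (hc : ∀ i j, i.1 + 2 ≤ j.1 → f i * f j = f j * f i)
    (hq : ∀ i, f i * f i = ((a : k) - (↑a⁻¹ : k)) • f i + 1) : Hecke k a n →ₐ[k] B :=
  RingQuot.liftAlgHom k ⟨FreeAlgebra.lift k f, by
    intro x y h
    induction h with
    | braid i j h => simpa using hb i j h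
    | comm i j h => simpa using hc i j h
    | quad i => simpa using hq i⟩

@[simp]
theorem lift_gen {n : ℕ} {B : Type u} [Ring B] [Algebra k B] (f : {i : ℕ // i + 1 < n} → B)
    (hb hc) (hq : ∀ i, f i * f i = ((a : k) - (↑a⁻¹ : k)) • f i + 1) (i : {i : ℕ // i + 1 < n}) :
    lift f hb hc hq (gen i) = f i := by
  unfold lift gen
  erw [RingQuot.liftAlgHom_mkAlgHom_apply]
  simp

theorem algHom_ext {n : ℕ} {B : Type u} [Ring B] [Algebra k B] {f g : Hecke k a n →ₐ[k] B}
    (h : ∀ i, f (gen i) = g (gen i)) : f = g := by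
  apply RingQuot.ringQuot_ext'
  apply FreeAlgebra.hom_ext
  funext i
  exact h i

theorem induction_on {n : ℕ} {P : Hecke k a n → Prop} (x : Hecke k a n)
    (algebraMap : ∀ c : k, P (algebraMap k _ c)) (gen : ∀ i, P (gen i))
    (mul : ∀ x y, P x → P y → P (x * y)) (add : ∀ x y, P x → P y → P (x + y)) : P x := by
  obtain ⟨x, rfl⟩ := RingQuot.mkAlgHom_surjective k (Rel k a n) x
  induction x using FreeAlgebra.induction with
  | grade0 c => rw [AlgHom.commutes]; exact algebraMap c
  | grade1 i => exact gen i
  | mul x y hx hy => rw [map_mul]; exact mul _ _ hx hy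
  | add x y hx hy => rw [map_add]; exact add _ _ hx hy

/-- The algebra map `H_m → H_p`, `g_i ↦ g_{d+i}`, for `d + m ≤ p`. -/
noncomputable def shift (d : ℕ) {m p : ℕ} (h : d + m ≤ p) : Hecke k a m →ₐ[k] Hecke k a p :=
  lift (fun i => gen ⟨d + i.1, by have := i.2; omega⟩)
    (fun i j hij => gen_braid _ _ (by simp [hij, add_assoc]))
    (fun i j hij => gen_comm _ _ (by simp only; omega))
    (fun i => gen_quad _)

@[simp]
theorem shift_gen (d : ℕ) {m p : ℕ} (h : d + m ≤ p) (i : {i : ℕ // i + 1 < m}) :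
    shift d h (gen i : Hecke k a m) = gen ⟨d + i.1, by have := i.2; omega⟩ := by
  simp [shift]

theorem shift_shift (d e f : ℕ) {m p q : ℕ} (h : d + m ≤ p) (h' : e + p ≤ q) (hf : e + d = f)
    (x : Hecke k a m) : shift e h' (shift d h x) = shift f (by omega) x := by
  have : (shift e h').comp (shift (k := k) (a := a) d h) = shift f (by omega) := by
    apply algHom_ext
    intro i
    simp [← hf, add_assoc]
  exact DFunLike.congr_fun this x

theorem shift_zero {m : ℕ} (h : 0 + m ≤ m) (x : Hecke k a m) : shift 0 h x = x := by
  have : shift 0 h = AlgHom.id k (Hecke k a m) := by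
    apply algHom_ext
    intro i
    simp
  exact DFunLike.congr_fun this x

/-- The images of `H_m` and `H_n` in `H_p` commute for `m + n ≤ p`. -/
theorem shift_comm {m n p : ℕ} (h : 0 + m ≤ p) (h' : m + n ≤ p)
    (x : Hecke k a m) (y : Hecke k a n) :
    shift 0 h x * shift m h' y = shift m h' y * shift 0 h x := by
  induction x using induction_on with
  | algebraMap c => rw [AlgHom.commutes]; exact Algebra.commutes _ _
  | mul x x' hx hx' => rw [map_mul, mul_assoc, hx', ← mul_assoc, hx, mul_assoc]
  | add x x' hx hx' => rw [map_add, add_mul, mul_add, hx, hx']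
  | gen i =>
    induction y using induction_on with
    | algebraMap c => rw [AlgHom.commutes]; exact (Algebra.commutes _ _).symm
    | mul y y' hy hy' => rw [map_mul, ← mul_assoc, hy, mul_assoc, hy', mul_assoc]
    | add y y' hy hy' => rw [map_add, add_mul, mul_add, hy, hy']
    | gen j =>
      rw [shift_gen, shift_gen]
      exact gen_comm _ _ (by have := i.2; simp only; omega)

variable (k a) in
/-- The character `g_i ↦ a` of `H_n`, the one-dimensional representation of the partition with one
row. -/
noncomputable def triv (n : ℕ) : Hecke k a n →ₐ[k] k :=
  lift (fun _ => (a : k)) (fun _ _ _ => rfl) (fun _ _ _ => rfl) (fun _ => by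
    have : (↑a⁻¹ : k) * (a : k) = 1 := a.inv_mul
    rw [smul_eq_mul, sub_mul, this]; ring)

@[simp]
theorem triv_gen {n : ℕ} (i : {i : ℕ // i + 1 < n}) : triv k a n (gen i) = (a : k) := by
  simp [triv]

@[simp]
theorem triv_shift (d : ℕ) {m p : ℕ} (h : d + m ≤ p) (x : Hecke k a m) :
    triv k a p (shift d h x) = triv k a m x := by
  have : (triv k a p).comp (shift d h) = triv k a m := by
    apply algHom_ext
    intro i
    simp
  exact DFunLike.congr_fun this x

end Hecke

/-! ### Linear presheaves on the Iwahori–Hecke category -/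

variable (k a) in
/-- A linear presheaf on the category `H` whose objects are the natural numbers, with
`H(n, n) = H_n` and `H(m, n) = 0` for `m ≠ n`: a sequence of right `H_n`-modules `V n`. -/
structure Rep where
  /-- the value at `n` -/
  V : ℕ → Type u
  [grp : ∀ n, AddCommGroup (V n)]
  [modk : ∀ n, Module k (V n)]
  [modH : ∀ n, Module (Hecke k a n)ᵐᵒᵖ (V n)]
  [tower : ∀ n, IsScalarTower k (Hecke k a n)ᵐᵒᵖ (V n)]

namespace Rep

attribute [instance] grp modk modH tower

instance smulComm (M : Rep k a) (n : ℕ) : SMulCommClass (Hecke k a n)ᵐᵒᵖ k (M.V n) :=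
  IsScalarTower.to_smulCommClass'

/-- Morphisms of presheaves. -/
def Hom (M N : Rep k a) : Type u := ∀ n, M.V n →ₗ[(Hecke k a n)ᵐᵒᵖ] N.V n

noncomputable instance (M N : Rep k a) : AddCommGroup (Hom M N) :=
  inferInstanceAs (AddCommGroup (∀ n, M.V n →ₗ[(Hecke k a n)ᵐᵒᵖ] N.V n))

noncomputable instance (M N : Rep k a) : Module k (Hom M N) :=
  inferInstanceAs (Module k (∀ n, M.V n →ₗ[(Hecke k a n)ᵐᵒᵖ] N.V n))

noncomputable instance : Category (Rep k a) where
  Hom := Hom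
  id M := fun _ => LinearMap.id
  comp f g := fun n => (g n).comp (f n)

/-- The component of a morphism at `n`. -/
def app {M N : Rep k a} (f : M ⟶ N) (n : ℕ) : M.V n →ₗ[(Hecke k a n)ᵐᵒᵖ] N.V n := f n

/-- Build a morphism from its components. -/
def ofApp {M N : Rep k a} (f : ∀ n, M.V n →ₗ[(Hecke k a n)ᵐᵒᵖ] N.V n) : M ⟶ N := f

@[simp]
theorem app_ofApp {M N : Rep k a} (f : ∀ n, M.V n →ₗ[(Hecke k a n)ᵐᵒᵖ] N.V n) (n : ℕ) :
    app (ofApp f) n = f n := rfl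

theorem hom_ext {M N : Rep k a} {f g : M ⟶ N} (h : ∀ n x, app f n x = app g n x) : f = g := by
  funext n
  exact LinearMap.ext (h n)

@[simp]
theorem id_app (M : Rep k a) (n : ℕ) (x : M.V n) : app (𝟙 M) n x = x := rfl

@[simp]
theorem comp_app {M N P : Rep k a} (f : M ⟶ N) (g : N ⟶ P) (n : ℕ) (x : M.V n) :
    app (f ≫ g) n x = app g n (app f n x) := rfl

noncomputable instance : Preadditive (Rep k a) where
  homGroup M N := inferInstanceAs (AddCommGroup (Hom M N))
  add_comp _ _ _ f f' g := hom_ext fun n x => map_add (app g n) (app f n x) (app f' n x)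
  comp_add _ _ _ _ _ _ := rfl

noncomputable instance : Linear k (Rep k a) where
  homModule M N := inferInstanceAs (Module k (Hom M N))
  smul_comp _ _ _ c f g := hom_ext fun n x => LinearMap.map_smul_of_tower (app g n) c (app f n x)
  comp_smul _ _ _ _ _ _ := rfl

@[simp]
theorem add_app {M N : Rep k a} (f g : M ⟶ N) (n : ℕ) (x : M.V n) :
    app (f + g) n x = app f n x + app g n x := rfl

@[simp]
theorem smul_app {M N : Rep k a} (c : k) (f : M ⟶ N) (n : ℕ) (x : M.V n) :
    app (c • f) n x = c • app f n x := rfl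

/-! ### Day convolution -/

/-- Generators of the Day convolution in degree `p`. -/
def Gen (M N : Rep k a) (p : ℕ) : Type u :=
  Σ mn : {mn : ℕ × ℕ // mn.1 + mn.2 = p}, M.V mn.1.1 × N.V mn.1.2

/-- The free right `H_p`-module on the generators in degree `p`. -/
abbrev Free (M N : Rep k a) (p : ℕ) : Type u := Gen M N p →₀ (Hecke k a p)ᵐᵒᵖ

/-- The generator `x ⊗ y`. -/
noncomputable def pre {M N : Rep k a} {m n p : ℕ} (h : m + n = p) (x : M.V m) (y : N.V n) :
    Free M N p :=
  Finsupp.single ⟨⟨(m, n), h⟩, (x, y)⟩ 1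

/-- The relations of the Day convolution: `x ⊗ y` is biadditive, and the actions of `H_m` and `H_n`
are identified with the action of `H_p` through the inclusion `H_m ⊗ H_n → H_p`,
`g_i ⊗ g_j ↦ g_i g_{m+j}`. -/
inductive DayRel (M N : Rep k a) (p : ℕ) : Free M N p → Prop
  | add_left {m n : ℕ} (h : m + n = p) (x x' : M.V m) (y : N.V n) :
      DayRel M N p (pre h (x + x') y - (pre h x y + pre h x' y))
  | add_right {m n : ℕ} (h : m + n = p) (x : M.V m) (y y' : N.V n) :
      DayRel M N p (pre h x (y + y') - (pre h x y + pre h x y'))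
  | act_left {m n : ℕ} (h : m + n = p) (r : Hecke k a m) (x : M.V m) (y : N.V n) :
      DayRel M N p (pre h (op r • x) y - op (Hecke.shift (p := p) 0 (by omega) r) • pre h x y)
  | act_right {m n : ℕ} (h : m + n = p) (r : Hecke k a n) (x : M.V m) (y : N.V n) :
      DayRel M N p (pre h x (op r • y) - op (Hecke.shift (p := p) m (by omega) r) • pre h x y)

/-- The Day convolution of two linear presheaves: in degree `p` it is the direct sum over
`m + n = p` of the modules `(M_m ⊗ N_n) ⊗_{H_m ⊗ H_n} H_p`, by generators and relations. -/
noncomputable def day (M N : Rep k a) : Rep k a where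
  V p := Free M N p ⧸ Submodule.span (Hecke k a p)ᵐᵒᵖ {z | DayRel M N p z}

/-- The class of `x ⊗ y` in the Day convolution. -/
noncomputable def tmul {M N : Rep k a} {m n p : ℕ} (h : m + n = p) (x : M.V m) (y : N.V n) :
    (day M N).V p :=
  Submodule.Quotient.mk (pre h x y)

section tmul

variable {M N : Rep k a} {m n p : ℕ} (h : m + n = p)

theorem tmul_of_rel {z w : Free M N p} (hz : DayRel M N p (z - w)) :
    (Submodule.Quotient.mk z : (day M N).V p) = Submodule.Quotient.mk w :=
  (Submodule.Quotient.eq _).2 (Submodule.subset_span hz)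

theorem add_tmul (x x' : M.V m) (y : N.V n) : tmul h (x + x') y = tmul h x y + tmul h x' y :=
  tmul_of_rel (.add_left h x x' y)

theorem tmul_add (x : M.V m) (y y' : N.V n) : tmul h x (y + y') = tmul h x y + tmul h x y' :=
  tmul_of_rel (.add_right h x y y')

theorem act_tmul (r : Hecke k a m) (x : M.V m) (y : N.V n) :
    tmul h (op r • x) y = op (Hecke.shift (p := p) 0 (by omega) r) • tmul h x y :=
  tmul_of_rel (.act_left h r x y)

theorem tmul_act (r : Hecke k a n) (x : M.V m) (y : N.V n) :
    tmul h x (op r • y) = op (Hecke.shift (p := p) m (by omega) r) • tmul h x y :=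
  tmul_of_rel (.act_right h r x y)

theorem zero_tmul (y : N.V n) : tmul h (0 : M.V m) y = 0 := by
  simpa using add_tmul h (0 : M.V m) 0 y

theorem tmul_zero (x : M.V m) : tmul h x (0 : N.V n) = 0 := by
  simpa using tmul_add h x (0 : N.V n) 0

theorem day_induction {P : (day M N).V p → Prop} (z : (day M N).V p)
    (tmul : ∀ {m n : ℕ} (h : m + n = p) (x : M.V m) (y : N.V n), P (tmul h x y))
    (smul : ∀ (r : (Hecke k a p)ᵐᵒᵖ) z, P z → P (r • z))
    (zero : P 0) (add : ∀ z w, P z → P w → P (z + w)) : P z := by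
  obtain ⟨z, rfl⟩ := Submodule.Quotient.mk_surjective _ z
  induction z using Finsupp.induction_linear with
  | zero => exact zero
  | add z w hz hw => exact add _ _ hz hw
  | single g r =>
    have := smul r _ (tmul g.1.2 g.2.1 g.2.2)
    have e : (Finsupp.single g r : Free M N p) = r • pre g.1.2 g.2.1 g.2.2 := by
      change _ = r • Finsupp.single g 1
      rw [Finsupp.smul_single, smul_eq_mul, mul_one]
    rw [e]
    exact this

end tmul

/-- Balanced maps out of a pair of presheaves, in degree `q`, into an `S`-module `W`, semilinear
with respect to `σ : H_q → S`. -/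
structure Balanced (M N : Rep k a) (q : ℕ) {S : Type u} [Ring S] (σ : (Hecke k a q)ᵐᵒᵖ →+* S)
    (W : Type u) [AddCommGroup W] [Module S W] where
  /-- the underlying map -/
  f : ∀ {m n : ℕ}, m + n = q → M.V m → N.V n → W
  add_left : ∀ {m n : ℕ} (h : m + n = q) (x x' : M.V m) (y : N.V n),
    f h (x + x') y = f h x y + f h x' y
  add_right : ∀ {m n : ℕ} (h : m + n = q) (x : M.V m) (y y' : N.V n),
    f h x (y + y') = f h x y + f h x y'
  act_left : ∀ {m n : ℕ} (h : m + n = q) (r : Hecke k a m) (x : M.V m) (y : N.V n),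
    f h (op r • x) y = σ (op (Hecke.shift (p := q) 0 (by omega) r)) • f h x y
  act_right : ∀ {m n : ℕ} (h : m + n = q) (r : Hecke k a n) (x : M.V m) (y : N.V n),
    f h x (op r • y) = σ (op (Hecke.shift (p := q) m (by omega) r)) • f h x y

section lift

variable {M N : Rep k a} {q : ℕ} {S : Type u} [Ring S] {σ : (Hecke k a q)ᵐᵒᵖ →+* S}
  {W : Type u} [AddCommGroup W] [Module S W]

/-- Auxiliary extension of a balanced map to the free module. -/
noncomputable def preLift (b : Balanced M N q σ W) : Free M N q →ₛₗ[σ] W where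
  toFun z := z.sum fun g r => σ r • b.f g.1.2 g.2.1 g.2.2
  map_add' z w := by
    refine Finsupp.sum_add_index' (fun g => ?_) (fun g r s => ?_)
    · rw [map_zero, zero_smul]
    · rw [map_add, add_smul]
  map_smul' r z := by
    rw [Finsupp.sum_smul_index (fun g => by rw [map_zero, zero_smul]), Finsupp.smul_sum]
    simp [mul_smul]

theorem preLift_pre (b : Balanced M N q σ W) {m n : ℕ} (h : m + n = q) (x : M.V m) (y : N.V n) :
    preLift b (pre h x y) = b.f h x y := by
  change (Finsupp.single (⟨⟨(m, n), h⟩, (x, y)⟩ : Gen M N q) (1 : (Hecke k a q)ᵐᵒᵖ)).sum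
    (fun g r => σ r • b.f g.1.2 g.2.1 g.2.2) = _
  rw [Finsupp.sum_single_index (by rw [map_zero, zero_smul]), map_one, one_smul]

/-- The universal property of the Day convolution, degreewise. -/
noncomputable def dayLift (b : Balanced M N q σ W) : (day M N).V q →ₛₗ[σ] W :=
  Submodule.liftQ _ (preLift b) (by
    rw [Submodule.span_le]
    rintro z (⟨h, x, x', y⟩ | ⟨h, x, y, y'⟩ | ⟨h, r, x, y⟩ | ⟨h, r, x, y⟩)
    · simp [preLift_pre, b.add_left]
    · simp [preLift_pre, b.add_right]
    · simp [preLift_pre, b.act_left, map_smulₛₗ]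
    · simp [preLift_pre, b.act_right, map_smulₛₗ])

@[simp]
theorem dayLift_tmul (b : Balanced M N q σ W) {m n : ℕ} (h : m + n = q) (x : M.V m) (y : N.V n) :
    dayLift b (tmul h x y) = b.f h x y :=
  preLift_pre b h x y

end lift

/-- Morphisms out of a Day convolution are determined on the classes `x ⊗ y`. -/
theorem day_ext {M N Q : Rep k a} {f g : day M N ⟶ Q}
    (h : ∀ {m n p : ℕ} (e : m + n = p) (x : M.V m) (y : N.V n),
      app f p (tmul e x y) = app g p (tmul e x y)) : f = g := by
  apply hom_ext
  intro p z
  induction z using day_induction with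
  | tmul e x y => exact h e x y
  | smul r z hz => rw [map_smul, map_smul, hz]
  | zero => rw [map_zero, map_zero]
  | add z w hz hw => rw [map_add, map_add, hz, hw]

/-- The morphism out of a Day convolution given by balanced maps in all degrees. -/
noncomputable def dayDesc {M N Q : Rep k a}
    (b : ∀ p, Balanced M N p (RingHom.id (Hecke k a p)ᵐᵒᵖ) (Q.V p)) : day M N ⟶ Q :=
  ofApp fun p => dayLift (b p)

@[simp]
theorem dayDesc_tmul {M N Q : Rep k a}
    (b : ∀ p, Balanced M N p (RingHom.id (Hecke k a p)ᵐᵒᵖ) (Q.V p)) {m n p : ℕ} (h : m + n = p)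
    (x : M.V m) (y : N.V n) : app (dayDesc b) p (tmul h x y) = (b p).f h x y :=
  dayLift_tmul (b p) h x y

/-! ### The monoidal structure -/

/-- Functoriality of the Day convolution. -/
noncomputable def dayMap {M M' N N' : Rep k a} (f : M ⟶ M') (g : N ⟶ N') : day M N ⟶ day M' N' :=
  dayDesc fun p =>
    { f := fun h x y => tmul h (app f _ x) (app g _ y)
      add_left := fun h x x' y => by rw [map_add, add_tmul]
      add_right := fun h x y y' => by rw [map_add, tmul_add]
      act_left := fun h r x y => by rw [map_smul, act_tmul]; rfl
      act_right := fun h r x y => by rw [map_smul, tmul_act]; rfl }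

@[simp]
theorem dayMap_tmul {M M' N N' : Rep k a} (f : M ⟶ M') (g : N ⟶ N') {m n p : ℕ} (h : m + n = p)
    (x : M.V m) (y : N.V n) :
    app (dayMap f g) p (tmul h x y) = tmul h (app f m x) (app g n y) :=
  dayDesc_tmul _ h x y

variable (k a) in
/-- The ring homomorphism `H_m → H_p` between the opposite rings. -/
noncomputable def shiftOp (d : ℕ) {m p : ℕ} (h : d + m ≤ p) :
    (Hecke k a m)ᵐᵒᵖ →+* (Hecke k a p)ᵐᵒᵖ :=
  (Hecke.shift d h).toRingHom.op

@[simp]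
theorem shiftOp_op (d : ℕ) {m p : ℕ} (h : d + m ≤ p) (r : Hecke k a m) :
    shiftOp k a d h (op r) = op (Hecke.shift d h r) := rfl

section associator

variable (M N P : Rep k a)

/-- The balanced map `x ⊗ y ↦ x ⊗ (y ⊗ z)` for fixed `z`. -/
noncomputable def assocAux {q r p : ℕ} (e : q + r = p) (z : P.V r) :
    Balanced M N q (shiftOp k a 0 (by omega : 0 + q ≤ p)) ((day M (day N P)).V p) where
  f {m n} h x y := tmul (by omega : m + (n + r) = p) x (tmul rfl y z)
  add_left h x x' y := add_tmul _ _ _ _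
  add_right h x y y' := by rw [add_tmul, tmul_add]
  act_left h s x y := by
    rw [act_tmul, shiftOp_op, Hecke.shift_shift 0 0 0 _ _ rfl]
  act_right {m n} h s x y := by
    rw [act_tmul, tmul_act, shiftOp_op, Hecke.shift_shift _ _ m _ _ (by omega),
      Hecke.shift_shift _ _ m _ _ (by omega)]

/-- The associator. -/
noncomputable def assocHom : day (day M N) P ⟶ day M (day N P) :=
  dayDesc fun p =>
    { f := fun e w z => dayLift (assocAux M N P e z) w
      add_left := fun e w w' z => map_add _ _ _
      add_right := fun e w z z' => by
        induction w using day_induction with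
        | tmul h x y => simp only [dayLift_tmul, assocAux, tmul_add]
        | smul r w hw => rw [map_smulₛₗ, map_smulₛₗ, map_smulₛₗ, hw, smul_add]
        | zero => simp only [map_zero, add_zero]
        | add w w' hw hw' => rw [map_add, map_add, map_add, hw, hw']; abel
      act_left := fun e s w z => by rw [map_smulₛₗ]; rfl
      act_right := fun {q r} e s w z => by
        induction w using day_induction with
        | tmul h x y =>
          simp only [dayLift_tmul, assocAux, RingHom.id_apply]
          rw [tmul_act, tmul_act, Hecke.shift_shift _ _ q _ _ h]
        | smul t w hw =>
          obtain ⟨t, rfl⟩ := op_surjective t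
          rw [map_smulₛₗ, map_smulₛₗ, hw, RingHom.id_apply, smul_smul, smul_smul, shiftOp_op,
            ← op_mul, ← op_mul, Hecke.shift_comm]
        | zero => simp only [map_zero, smul_zero]
        | add w w' hw hw' => rw [map_add, map_add, hw, hw', smul_add] }

variable {M N P} in
@[simp]
theorem assocHom_tmul {m n r q p : ℕ} (h : m + n = q) (e : q + r = p) (x : M.V m) (y : N.V n)
    (z : P.V r) : app (assocHom M N P) p (tmul e (tmul h x y) z) =
      tmul (by omega : m + (n + r) = p) x (tmul rfl y z) := by
  rw [assocHom, dayDesc_tmul]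
  exact dayLift_tmul _ _ _ _

/-- The balanced map `y ⊗ z ↦ (x ⊗ y) ⊗ z` for fixed `x`. -/
noncomputable def assocInvAux {m q p : ℕ} (e : m + q = p) (x : M.V m) :
    Balanced N P q (shiftOp k a m (by omega : m + q ≤ p)) ((day (day M N) P).V p) where
  f {n r} h y z := tmul (by omega : (m + n) + r = p) (tmul rfl x y) z
  add_left h y y' z := by rw [tmul_add, add_tmul]
  add_right h y z z' := tmul_add _ _ _ _
  act_left {n r} h s y z := by
    rw [tmul_act, act_tmul, shiftOp_op, Hecke.shift_shift _ _ m _ _ (by omega),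
      Hecke.shift_shift _ _ m _ _ (by omega)]
  act_right {n r} h s y z := by
    rw [tmul_act, shiftOp_op, Hecke.shift_shift _ _ (m + n) _ _ (by omega)]

/-- The inverse associator. -/
noncomputable def assocInv : day M (day N P) ⟶ day (day M N) P :=
  dayDesc fun p =>
    { f := fun e x w => dayLift (assocInvAux M N P e x) w
      add_right := fun e x w w' => map_add _ _ _
      add_left := fun e x x' w => by
        induction w using day_induction with
        | tmul h y z => simp only [dayLift_tmul, assocInvAux, add_tmul]
        | smul r w hw => rw [map_smulₛₗ, map_smulₛₗ, map_smulₛₗ, hw, smul_add]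
        | zero => simp only [map_zero, add_zero]
        | add w w' hw hw' => rw [map_add, map_add, map_add, hw, hw']; abel
      act_right := fun e s x w => by rw [map_smulₛₗ]; rfl
      act_left := fun {m q} e s x w => by
        induction w using day_induction with
        | tmul h y z =>
          simp only [dayLift_tmul, assocInvAux, RingHom.id_apply]
          rw [act_tmul, act_tmul, Hecke.shift_shift _ _ 0 _ _ rfl]
        | smul t w hw =>
          obtain ⟨t, rfl⟩ := op_surjective t
          rw [map_smulₛₗ, map_smulₛₗ, hw, RingHom.id_apply, smul_smul, smul_smul, shiftOp_op,
            ← op_mul, ← op_mul, Hecke.shift_comm]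
        | zero => simp only [map_zero, smul_zero]
        | add w w' hw hw' => rw [map_add, map_add, hw, hw', smul_add] }

variable {M N P} in
@[simp]
theorem assocInv_tmul {m n r q p : ℕ} (h : n + r = q) (e : m + q = p) (x : M.V m) (y : N.V n)
    (z : P.V r) : app (assocInv M N P) p (tmul e x (tmul h y z)) =
      tmul (by omega : (m + n) + r = p) (tmul rfl x y) z := by
  rw [assocInv, dayDesc_tmul]
  exact dayLift_tmul _ _ _ _

end associator

/-- Morphisms out of a triple Day convolution are determined on the classes `(x ⊗ y) ⊗ z`. -/
theorem day_ext₃ {M N P Q : Rep k a} {f g : day (day M N) P ⟶ Q}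
    (h : ∀ {m n q r p : ℕ} (e : m + n = q) (e' : q + r = p) (x : M.V m) (y : N.V n) (z : P.V r),
      app f p (tmul e' (tmul e x y) z) = app g p (tmul e' (tmul e x y) z)) : f = g := by
  apply day_ext
  intro q r p e' w z
  induction w using day_induction with
  | tmul e x y => exact h e e' x y z
  | smul t w hw =>
    obtain ⟨t, rfl⟩ := op_surjective t
    rw [act_tmul, map_smul, map_smul, hw]
  | zero =>
    rw [zero_tmul, map_zero, map_zero]
  | add w w' hw hw' => rw [add_tmul, map_add, map_add, hw, hw']

theorem day_ext₃' {M N P Q : Rep k a} {f g : day M (day N P) ⟶ Q}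
    (h : ∀ {m n q r p : ℕ} (e : n + r = q) (e' : m + q = p) (x : M.V m) (y : N.V n) (z : P.V r),
      app f p (tmul e' x (tmul e y z)) = app g p (tmul e' x (tmul e y z))) : f = g := by
  apply day_ext
  intro m q p e' x w
  induction w using day_induction with
  | tmul e y z => exact h e e' x y z
  | smul t w hw =>
    obtain ⟨t, rfl⟩ := op_surjective t
    rw [tmul_act, map_smul, map_smul, hw]
  | zero =>
    rw [tmul_zero, map_zero, map_zero]
  | add w w' hw hw' => rw [tmul_add, map_add, map_add, hw, hw']

theorem day_ext₄ {L M N P Q : Rep k a} {f g : day (day (day L M) N) P ⟶ Q}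
    (h : ∀ {l m n r s t p : ℕ} (e : l + m = s) (e' : s + n = t) (e'' : t + r = p)
      (w : L.V l) (x : M.V m) (y : N.V n) (z : P.V r),
      app f p (tmul e'' (tmul e' (tmul e w x) y) z) =
        app g p (tmul e'' (tmul e' (tmul e w x) y) z)) : f = g := by
  apply day_ext₃
  intro s n t r p e' e'' v y z
  induction v using day_induction with
  | tmul e w x => exact h e e' e'' w x y z
  | smul c v hv =>
    obtain ⟨c, rfl⟩ := op_surjective c
    rw [act_tmul, act_tmul, map_smul, map_smul, hv]
  | zero =>
    rw [zero_tmul, zero_tmul, map_zero, map_zero]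
  | add v v' hv hv' => rw [add_tmul, add_tmul, map_add, map_add, hv, hv']

variable (k a) in
/-- The right ideal of `H_n` that is everything for `n = 0` and zero for `n ≠ 0`. -/
def unitIdeal (n : ℕ) : Submodule (Hecke k a n)ᵐᵒᵖ (Hecke k a n) where
  carrier := {x | n ≠ 0 → x = 0}
  add_mem' hx hy hn := by rw [hx hn, hy hn, add_zero]
  zero_mem' _ := rfl
  smul_mem' r x hx hn := by rw [hx hn, smul_zero]

variable (k a) in
/-- The unit: the presheaf `H(-, 0)`. -/
noncomputable def unit : Rep k a where
  V n := unitIdeal k a n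

/-- The generator of the unit. -/
noncomputable def unitOne : (unit k a).V 0 := (⟨1, fun h => absurd rfl h⟩ : unitIdeal k a 0)

/-- The inclusion of `H(n, 0)` into `H_n`. -/
def unitVal {n : ℕ} (x : (unit k a).V n) : Hecke k a n := (show unitIdeal k a n from x).1

theorem unitVal_add {n : ℕ} (x y : (unit k a).V n) : unitVal (x + y) = unitVal x + unitVal y := rfl

theorem unitVal_act {n : ℕ} (r : Hecke k a n) (x : (unit k a).V n) :
    unitVal (op r • x) = unitVal x * r := rfl

theorem unitVal_one : unitVal (unitOne (k := k) (a := a)) = 1 := rfl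

theorem act_unitOne (x : (unit k a).V 0) : op (unitVal x) • unitOne = x :=
  Subtype.ext (one_mul (unitVal x))

theorem unit_eq_zero {n : ℕ} (h : n ≠ 0) (x : (unit k a).V n) : x = 0 :=
  Subtype.ext ((show unitIdeal k a n from x).2 h)

/-- Transport along an equality of degrees. -/
def cast (M : Rep k a) {n p : ℕ} (h : n = p) (x : M.V n) : M.V p := h ▸ x

theorem tmul_cast {M N : Rep k a} {m n n' p : ℕ} (h : m + n' = p) (h' : m + n = p) (e : n = n')
    (x : M.V m) (y : N.V n) : tmul h x (N.cast e y) = tmul h' x y := by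
  subst e
  rfl

theorem tmul_tmul_congr {L M N : Rep k a} {l m n q q' p : ℕ} (e : m + n = q) (e' : m + n = q')
    (h : l + q = p) (h' : l + q' = p) (x : L.V l) (y : M.V m) (z : N.V n) :
    tmul h x (tmul e y z) = tmul h' x (tmul e' y z) := by
  obtain rfl : q = q' := by omega
  rfl

/-- The left unitor. -/
noncomputable def leftUnitorHom (M : Rep k a) : day (unit k a) M ⟶ M :=
  dayDesc fun p =>
    { f := fun {m n} h x y =>
        if hm : m = 0 then
          op (Hecke.shift (p := p) 0 (by omega) (unitVal x)) • M.cast (by omega : n = p) y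
        else 0
      add_left := fun {m n} h x x' y => by
        split_ifs with hm
        · rw [unitVal_add, map_add, MulOpposite.op_add, add_smul]
        · rw [add_zero]
      add_right := fun {m n} h x y y' => by
        split_ifs with hm
        · obtain rfl : n = p := by omega
          exact smul_add _ _ _
        · rw [add_zero]
      act_left := fun {m n} h r x y => by
        split_ifs with hm
        · rw [unitVal_act, map_mul, MulOpposite.op_mul, mul_smul]; rfl
        · rw [smul_zero]
      act_right := fun {m n} h r x y => by
        split_ifs with hm
        · obtain rfl : n = p := by omega
          subst hm
          change _ • op r • y = _ • _ • y
          rw [smul_smul, RingHom.id_apply, smul_smul, ← op_mul, ← op_mul,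
            Hecke.shift_comm, Hecke.shift_zero]
        · rw [smul_zero] }

theorem leftUnitorHom_tmul (M : Rep k a) {n p : ℕ} (h : 0 + n = p) (x : (unit k a).V 0)
    (y : M.V n) : app (leftUnitorHom M) p (tmul h x y) =
      op (Hecke.shift (p := p) 0 (by omega) (unitVal x)) • M.cast (by omega : n = p) y := by
  rw [leftUnitorHom, dayDesc_tmul]
  simp only [↓reduceDIte]

/-- The inverse of the left unitor. -/
noncomputable def leftUnitorInv (M : Rep k a) : M ⟶ day (unit k a) M :=
  ofApp fun n =>
    { toFun := fun y => tmul (zero_add n) unitOne y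
      map_add' := fun y y' => tmul_add _ _ _ _
      map_smul' := fun r y => by
        obtain ⟨r, rfl⟩ := op_surjective r
        rw [tmul_act, Hecke.shift_zero]
        rfl }

/-- The right unitor. -/
noncomputable def rightUnitorHom (M : Rep k a) : day M (unit k a) ⟶ M :=
  dayDesc fun p =>
    { f := fun {m n} h x y =>
        if hn : n = 0 then
          op (Hecke.shift (p := p) m (by omega) (unitVal y)) • M.cast (by omega : m = p) x
        else 0
      add_right := fun {m n} h x y y' => by
        split_ifs with hm
        · rw [unitVal_add, map_add, MulOpposite.op_add, add_smul]
        · rw [add_zero]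
      add_left := fun {m n} h x x' y => by
        split_ifs with hm
        · obtain rfl : m = p := by omega
          exact smul_add _ _ _
        · rw [add_zero]
      act_right := fun {m n} h r x y => by
        split_ifs with hm
        · rw [unitVal_act, map_mul, MulOpposite.op_mul, mul_smul]; rfl
        · rw [smul_zero]
      act_left := fun {m n} h r x y => by
        split_ifs with hm
        · obtain rfl : m = p := by omega
          subst hm
          change _ • op r • x = _ • _ • x
          rw [smul_smul, RingHom.id_apply, smul_smul, ← op_mul, ← op_mul,
            ← Hecke.shift_comm, Hecke.shift_zero]
        · rw [smul_zero] }

theorem rightUnitorHom_tmul (M : Rep k a) {m p : ℕ} (h : m + 0 = p) (x : M.V m)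
    (y : (unit k a).V 0) : app (rightUnitorHom M) p (tmul h x y) =
      op (Hecke.shift (p := p) m (by omega) (unitVal y)) • M.cast (by omega : m = p) x := by
  rw [rightUnitorHom, dayDesc_tmul]
  simp only [↓reduceDIte]

/-- The inverse of the right unitor. -/
noncomputable def rightUnitorInv (M : Rep k a) : M ⟶ day M (unit k a) :=
  ofApp fun n =>
    { toFun := fun x => tmul (add_zero n) x unitOne
      map_add' := fun y y' => add_tmul _ _ _ _
      map_smul' := fun r y => by
        obtain ⟨r, rfl⟩ := op_surjective r
        rw [act_tmul, Hecke.shift_zero]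
        rfl }

/-- Day convolution makes the category of linear presheaves a monoidal category. -/
noncomputable instance : MonoidalCategory (Rep k a) where
  tensorObj := day
  whiskerLeft M _ _ g := dayMap (𝟙 M) g
  whiskerRight f N := dayMap f (𝟙 N)
  tensorHom f g := dayMap f g
  tensorUnit := unit k a
  associator M N P :=
    { hom := assocHom M N P
      inv := assocInv M N P
      hom_inv_id := by
        apply day_ext₃
        intro m n q r p e e' x y z
        subst e
        simp
      inv_hom_id := by
        apply day_ext₃'
        intro m n q r p e e' x y z
        subst e
        simp }
  leftUnitor M :=
    { hom := leftUnitorHom M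
      inv := leftUnitorInv M
      hom_inv_id := by
        apply day_ext
        intro m n p e x y
        by_cases hm : m = 0
        · subst hm
          obtain rfl : n = p := by omega
          rw [comp_app, leftUnitorHom_tmul, map_smul]
          change _ • tmul _ unitOne y = _
          rw [← act_tmul, act_unitOne]
          rfl
        · rw [unit_eq_zero hm x, zero_tmul, map_zero, map_zero]
      inv_hom_id := by
        apply hom_ext
        intro n x
        rw [comp_app]
        change app (leftUnitorHom M) n (tmul _ unitOne x) = _
        rw [leftUnitorHom_tmul, unitVal_one, map_one, MulOpposite.op_one, one_smul]
        rfl }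
  rightUnitor M :=
    { hom := rightUnitorHom M
      inv := rightUnitorInv M
      hom_inv_id := by
        apply day_ext
        intro m n p e x y
        by_cases hn : n = 0
        · subst hn
          obtain rfl : m = p := by omega
          rw [comp_app, rightUnitorHom_tmul, map_smul]
          change _ • tmul _ x unitOne = _
          rw [← tmul_act, act_unitOne]
          rfl
        · rw [unit_eq_zero hn y, tmul_zero, map_zero, map_zero]
      inv_hom_id := by
        apply hom_ext
        intro n x
        rw [comp_app]
        change app (rightUnitorHom M) n (tmul _ x unitOne) = _
        rw [rightUnitorHom_tmul, unitVal_one, map_one, MulOpposite.op_one, one_smul]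
        rfl }
  tensorHom_def f g := day_ext fun e x y => by simp
  id_tensorHom_id M N := day_ext fun e x y => by simp
  tensorHom_comp_tensorHom f f' g g' := day_ext fun e x y => by simp
  whiskerLeft_id M N := day_ext fun e x y => by simp
  id_whiskerRight M N := day_ext fun e x y => by simp
  associator_naturality f g h := by
    apply day_ext₃
    intro m n q r p e e' x y z
    simp
  leftUnitor_naturality {M N} f := by
    apply day_ext
    intro m n p e x y
    by_cases hm : m = 0
    · subst hm
      obtain rfl : n = p := by omega
      rw [comp_app, comp_app, dayMap_tmul, leftUnitorHom_tmul, leftUnitorHom_tmul, map_smul]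
      rfl
    · rw [unit_eq_zero hm x, zero_tmul, map_zero, map_zero]
  rightUnitor_naturality {M N} f := by
    apply day_ext
    intro m n p e x y
    by_cases hn : n = 0
    · subst hn
      obtain rfl : m = p := by omega
      rw [comp_app, comp_app, dayMap_tmul, rightUnitorHom_tmul, rightUnitorHom_tmul, map_smul]
      rfl
    · rw [unit_eq_zero hn y, tmul_zero, map_zero, map_zero]
  pentagon L M N P := by
    apply day_ext₄
    intro l m n r s t p e e' e'' w x y z
    subst e e'
    simp
    exact tmul_tmul_congr _ _ _ _ _ _ _
  triangle M N := by
    apply day_ext₃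
    intro m n q r p e e' x y z
    by_cases hn : n = 0
    · subst hn
      obtain rfl : m = q := by omega
      simp only [comp_app, assocHom_tmul, dayMap_tmul, id_app]
      rw [rightUnitorHom_tmul, leftUnitorHom_tmul]
      rw [act_tmul, tmul_act, tmul_cast _ (by omega : m + r = p), Hecke.shift_shift _ _ m _ _ rfl,
        Hecke.shift_shift _ _ m _ _ (by omega)]
      rfl
    · rw [unit_eq_zero hn y, tmul_zero, zero_tmul, map_zero, map_zero]

open MonoidalCategory
open scoped MonObj

@[simp]
theorem whiskerRight_tmul {M M' : Rep k a} (f : M ⟶ M') (N : Rep k a) {m n p : ℕ} (h : m + n = p)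
    (x : M.V m) (y : N.V n) :
    app (f ▷ N) p (tmul h x y : (day M N).V p) = (tmul h (app f m x) y : (day M' N).V p) :=
  dayMap_tmul f (𝟙 N) h x y

@[simp]
theorem whiskerLeft_tmul (M : Rep k a) {N N' : Rep k a} (g : N ⟶ N') {m n p : ℕ} (h : m + n = p)
    (x : M.V m) (y : N.V n) :
    app (M ◁ g) p (tmul h x y : (day M N).V p) = (tmul h x (app g n y) : (day M N').V p) :=
  dayMap_tmul (𝟙 M) g h x y

@[simp]
theorem tensorHom_tmul {M M' N N' : Rep k a} (f : M ⟶ M') (g : N ⟶ N') {m n p : ℕ} (h : m + n = p)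
    (x : M.V m) (y : N.V n) :
    app (f ⊗ₘ g) p (tmul h x y : (day M N).V p) = (tmul h (app f m x) (app g n y) : (day M' N').V p) :=
  dayMap_tmul f g h x y

/-! ### The tensor algebra and the quantum symmetric algebra -/

variable (k a) in
/-- The tensor algebra `T = ⨁ X^{⊗ n}` on `X = H(-, 1)`. As `X^{⊗ n} = H(-, n)`, it is the regular
right module `H_n` in degree `n`. -/
noncomputable def T : Rep k a where
  V n := Hecke k a n

/-- The multiplication `X^{⊗ m} ⊗ X^{⊗ n} → X^{⊗ (m+n)}` of the tensor algebra, induced by the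
inclusion `H_m ⊗ H_n → H_{m+n}`. -/
noncomputable def mulT : day (T k a) (T k a) ⟶ T k a :=
  dayDesc fun p =>
    { f := fun {m n} h (x : Hecke k a m) (y : Hecke k a n) =>
        (Hecke.shift 0 (by omega) x * Hecke.shift m (by omega) y : Hecke k a p)
      add_left := fun {m n} h (x x' : Hecke k a m) (y : Hecke k a n) => by
        change Hecke.shift 0 _ (x + x') * _ = _
        rw [map_add, add_mul]; rfl
      add_right := fun {m n} h (x : Hecke k a m) (y y' : Hecke k a n) => by
        change _ * Hecke.shift m _ (y + y') = _
        rw [map_add, mul_add]; rfl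
      act_left := fun {m n} h r (x : Hecke k a m) (y : Hecke k a n) => by
        have e : (Hecke.shift 0 (by omega) (x * r) * Hecke.shift m (by omega) y : Hecke k a p) =
            Hecke.shift 0 (by omega) x * Hecke.shift m (by omega) y * Hecke.shift 0 (by omega) r := by
          rw [map_mul, mul_assoc, mul_assoc, Hecke.shift_comm]
        exact e
      act_right := fun {m n} h r (x : Hecke k a m) (y : Hecke k a n) => by
        have e : (Hecke.shift 0 (by omega) x * Hecke.shift m (by omega) (y * r) : Hecke k a p) =
            Hecke.shift 0 (by omega) x * Hecke.shift m (by omega) y * Hecke.shift m (by omega) r := by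
          rw [map_mul, mul_assoc]
        exact e }

theorem mulT_tmul {m n p : ℕ} (h : m + n = p) (x : Hecke k a m) (y : Hecke k a n) :
    app mulT p (tmul (M := T k a) (N := T k a) h x y) =
      (Hecke.shift 0 (by omega) x * Hecke.shift m (by omega) y : Hecke k a p) :=
  dayDesc_tmul _ h _ _

/-- The unit of the tensor algebra, the inclusion of `X^{⊗ 0}`. -/
noncomputable def oneT : unit k a ⟶ T k a :=
  ofApp fun n => (unitIdeal k a n).subtype

noncomputable instance : MonObj (T k a) where
  one := oneT
  mul := mulT
  one_mul := by
    apply day_ext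
    intro m n p e x y
    by_cases hm : m = 0
    · subst hm
      obtain rfl : n = p := by omega
      rw [comp_app, whiskerRight_tmul]
      refine (mulT_tmul _ _ _).trans (Eq.trans ?_ (leftUnitorHom_tmul _ e x y).symm)
      have e' (u : Hecke k a 0) (v : Hecke k a n) : (Hecke.shift 0 (by omega) u *
          Hecke.shift 0 (by omega) v : Hecke k a n) = v * Hecke.shift 0 (by omega) u := by
        rw [Hecke.shift_comm, Hecke.shift_zero]
      exact e' (unitVal x) y
    · rw [unit_eq_zero hm x, zero_tmul, map_zero, map_zero]
  mul_one := by
    apply day_ext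
    intro m n p e x y
    by_cases hn : n = 0
    · subst hn
      obtain rfl : m = p := by omega
      rw [comp_app, whiskerLeft_tmul]
      refine (mulT_tmul _ _ _).trans (Eq.trans ?_ (rightUnitorHom_tmul _ e x y).symm)
      exact congrArg (· * Hecke.shift m (by omega) (unitVal y) : Hecke k a m → Hecke k a m)
        (Hecke.shift_zero (by omega) (show Hecke k a m from x))
    · rw [unit_eq_zero hn y, tmul_zero, map_zero, map_zero]
  mul_assoc := by
    apply day_ext₃
    intro m n q r p e e' x y z
    rw [comp_app, comp_app, comp_app, whiskerRight_tmul]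
    change app mulT p (tmul e' (app mulT q (tmul e x y)) z) = app mulT p (app (T k a ◁ mulT) p
      (app (assocHom _ _ _) p (tmul e' (tmul e x y) z)))
    have key (x : Hecke k a m) (y : Hecke k a n) (z : Hecke k a r) :
        (Hecke.shift 0 (by omega) (Hecke.shift 0 (by omega) x * Hecke.shift m (by omega) y :
          Hecke k a q) * Hecke.shift q (by omega) z : Hecke k a p) =
        Hecke.shift 0 (by omega) x * Hecke.shift m (by omega) (Hecke.shift 0 (by omega) y *
          Hecke.shift n (by omega) z : Hecke k a (n + r)) := by
      rw [map_mul, map_mul, Hecke.shift_shift _ _ 0 _ _ rfl,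
        Hecke.shift_shift _ _ m _ _ (by omega), Hecke.shift_shift _ _ m _ _ (by omega),
        Hecke.shift_shift _ _ q _ _ (by omega), mul_assoc]
    rw [assocHom_tmul, whiskerLeft_tmul]
    refine (mulT_tmul _ _ _).trans (Eq.trans ?_ (mulT_tmul _ _ _).symm)
    refine (congrArg (fun w : Hecke k a q => Hecke.shift 0 _ w * _) (mulT_tmul e x y)).trans ?_
    refine Eq.trans ?_
      (congrArg (fun w : Hecke k a (n + r) => _ * Hecke.shift m _ w) (mulT_tmul rfl y z)).symm
    exact key x y z

variable (k a) in
/-- The quantum symmetric algebra `S`: the one-dimensional representation of the partition with one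
row in each degree. -/
noncomputable def QSym : Rep k a where
  V _ := k
  modH n := Module.compHom k ((Hecke.triv k a n).toRingHom.fromOpposite fun _ _ => mul_comm _ _)
  tower n := by
    let _ := Module.compHom k
      ((Hecke.triv k a n).toRingHom.fromOpposite fun _ _ => mul_comm _ _)
    refine ⟨fun c r x => ?_⟩
    change Hecke.triv k a n (unop (c • r)) * x = c * (Hecke.triv k a n (unop r) * x)
    rw [unop_smul, map_smul, smul_eq_mul, mul_assoc]

theorem QSym_act {n : ℕ} (r : Hecke k a n) (x : k) :
    (op r • (show (QSym k a).V n from x)) = Hecke.triv k a n r * x := rfl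

/-- The multiplication `S_m ⊗ S_n → S_{m+n}`. -/
noncomputable def mulS : day (QSym k a) (QSym k a) ⟶ QSym k a :=
  dayDesc fun p =>
    { f := fun {m n} h (x : k) (y : k) => (x * y : k)
      add_left := fun {m n} h (x x' : k) (y : k) => add_mul x x' y
      add_right := fun {m n} h (x : k) (y y' : k) => mul_add x y y'
      act_left := fun {m n} h r (x : k) (y : k) => by
        have e : (Hecke.triv k a m r * x) * y =
            Hecke.triv k a p (Hecke.shift 0 (by omega) r) * (x * y) := by
          rw [Hecke.triv_shift, mul_assoc]
        exact e
      act_right := fun {m n} h r (x : k) (y : k) => by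
        have e : x * (Hecke.triv k a n r * y) =
            Hecke.triv k a p (Hecke.shift m (by omega) r) * (x * y) := by
          rw [Hecke.triv_shift, mul_left_comm]
        exact e }

theorem mulS_tmul {m n p : ℕ} (h : m + n = p) (x y : k) :
    app mulS p (tmul (M := QSym k a) (N := QSym k a) (m := m) (n := n) h x y) = (x * y : k) :=
  dayDesc_tmul _ h _ _

variable (k a) in
/-- The projection `T → S`: in degree `n` it is the character `g_i ↦ a` of `H_n`. -/
noncomputable def proj : T k a ⟶ QSym k a :=
  ofApp fun n =>
    { toFun := fun x : Hecke k a n => Hecke.triv k a n x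
      map_add' := fun x y : Hecke k a n => map_add (Hecke.triv k a n) x y
      map_smul' := fun r (x : Hecke k a n) => by
        change Hecke.triv k a n (x * unop r) = Hecke.triv k a n (unop r) * _
        rw [map_mul, mul_comm] }

theorem proj_app {n : ℕ} (x : Hecke k a n) : app (proj k a) n x = Hecke.triv k a n x := rfl

noncomputable instance : MonObj (QSym k a) where
  one := oneT ≫ proj k a
  mul := mulS
  one_mul := by
    apply day_ext
    intro m n p e x y
    by_cases hm : m = 0
    · subst hm
      obtain rfl : n = p := by omega
      rw [comp_app, whiskerRight_tmul]
      refine (mulS_tmul _ _ _).trans (Eq.trans ?_ (leftUnitorHom_tmul _ e x y).symm)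
      exact congrArg (fun c : k => c * (show k from y))
        (Hecke.triv_shift 0 (by omega : 0 + 0 ≤ n) (unitVal x)).symm
    · rw [unit_eq_zero hm x, zero_tmul, map_zero, map_zero]
  mul_one := by
    apply day_ext
    intro m n p e x y
    by_cases hn : n = 0
    · subst hn
      obtain rfl : m = p := by omega
      rw [comp_app, whiskerLeft_tmul]
      refine (mulS_tmul _ _ _).trans (Eq.trans ?_ (rightUnitorHom_tmul _ e x y).symm)
      refine Eq.trans ?_ (congrArg (fun c : k => c * (show k from x))
        (Hecke.triv_shift m (by omega : m + 0 ≤ m) (unitVal y)).symm)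
      exact mul_comm (show k from x) (Hecke.triv k a 0 (unitVal y))
    · rw [unit_eq_zero hn y, tmul_zero, map_zero, map_zero]
  mul_assoc := by
    apply day_ext₃
    intro m n q r p e e' x y z
    rw [comp_app, comp_app, comp_app, whiskerRight_tmul]
    change app mulS p (tmul e' (app mulS q (tmul e x y)) z) = app mulS p (app (QSym k a ◁ mulS) p
      (app (assocHom _ _ _) p (tmul e' (tmul e x y) z)))
    rw [assocHom_tmul, whiskerLeft_tmul]
    refine (mulS_tmul (k := k) _ _ _).trans (Eq.trans ?_ (mulS_tmul (k := k) _ _ _).symm)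
    refine (congrArg (fun w : k => w * (show k from z)) (mulS_tmul (k := k) (a := a) e x y)).trans ?_
    refine Eq.trans ?_ (congrArg (fun w : k => (show k from x) * w)
      (mulS_tmul (k := k) (a := a) rfl y z)).symm
    have key (x y z : k) : x * y * z = x * (y * z) := mul_assoc x y z
    exact key x y z

/-! ### Right modules -/

/-- A right module over a monoid object `A`. -/
structure RightMod (A : Rep k a) [MonObj A] where
  /-- the underlying object -/
  X : Rep k a
  /-- the action -/
  act : X ⊗ A ⟶ X
  act_one : X ◁ η[A] ≫ act = (ρ_ X).hom
  act_mul : X ◁ μ[A] ≫ act = (α_ X A A).inv ≫ act ▷ A ≫ act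

theorem add_whiskerRight {M N : Rep k a} (f g : M ⟶ N) (P : Rep k a) :
    (f + g) ▷ P = f ▷ P + g ▷ P :=
  day_ext fun e x y => by
    change _ = app (f ▷ P) _ (tmul e x y) + app (g ▷ P) _ (tmul e x y)
    rw [whiskerRight_tmul, whiskerRight_tmul, whiskerRight_tmul, add_app, add_tmul]

theorem smul_whiskerRight {M N : Rep k a} (c : k) (f : M ⟶ N) (P : Rep k a) :
    (c • f) ▷ P = c • f ▷ P :=
  day_ext fun e x y => by
    have h (n : ℕ) (x : N.V n) : c • x = op (algebraMap k (Hecke k a n) c) • x :=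
      (algebraMap_smul (Hecke k a n)ᵐᵒᵖ c x).symm
    rw [smul_app, whiskerRight_tmul, whiskerRight_tmul, smul_app, h, act_tmul, AlgHom.commutes]
    exact algebraMap_smul (Hecke k a _)ᵐᵒᵖ c _

namespace RightMod

variable {A : Rep k a} [MonObj A]

/-- Morphisms of right modules. -/
noncomputable def Hom (M N : RightMod A) : Submodule k (M.X ⟶ N.X) where
  carrier := {f | M.act ≫ f = f ▷ A ≫ N.act}
  add_mem' {f g} hf hg := by
    rw [Set.mem_ofPred_eq] at hf hg ⊢
    rw [Preadditive.comp_add, add_whiskerRight, Preadditive.add_comp, hf, hg]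
  zero_mem' := by
    have h : (0 : M.X ⟶ N.X) ▷ A = 0 := by
      have := smul_whiskerRight (0 : k) (0 : M.X ⟶ N.X) A
      rwa [zero_smul, zero_smul] at this
    rw [Set.mem_ofPred_eq, h, Limits.comp_zero, Limits.zero_comp]
  smul_mem' c f hf := by
    rw [Set.mem_ofPred_eq] at hf ⊢
    rw [Linear.comp_smul, smul_whiskerRight, Linear.smul_comp, hf]

noncomputable instance : Category (RightMod A) where
  Hom M N := Hom M N
  id M := ⟨𝟙 M.X, by
    change M.act ≫ 𝟙 _ = 𝟙 _ ▷ A ≫ M.act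
    rw [Category.comp_id, id_whiskerRight, Category.id_comp]⟩
  comp {M N P} f g := ⟨f.1 ≫ g.1, by
    have hf : M.act ≫ f.1 = f.1 ▷ A ≫ N.act := f.2
    have hg : N.act ≫ g.1 = g.1 ▷ A ≫ P.act := g.2
    change M.act ≫ f.1 ≫ g.1 = (f.1 ≫ g.1) ▷ A ≫ P.act
    rw [comp_whiskerRight, Category.assoc, ← hg, ← Category.assoc, hf, Category.assoc]⟩
  id_comp f := Subtype.ext (Category.id_comp f.1)
  comp_id f := Subtype.ext (Category.comp_id f.1)
  assoc f g h := Subtype.ext (Category.assoc f.1 g.1 h.1)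

noncomputable instance : Preadditive (RightMod A) where
  homGroup M N := inferInstanceAs (AddCommGroup (Hom M N))
  add_comp _ _ _ f f' g := Subtype.ext (Preadditive.add_comp _ _ _ f.1 f'.1 g.1)
  comp_add _ _ _ f g g' := Subtype.ext (Preadditive.comp_add _ _ _ f.1 g.1 g'.1)

noncomputable instance : Linear k (RightMod A) where
  homModule M N := inferInstanceAs (Module k (Hom M N))
  smul_comp _ _ _ c f g := Subtype.ext (Linear.smul_comp _ _ _ c f.1 g.1)
  comp_smul _ _ _ f c g := Subtype.ext (Linear.comp_smul _ _ _ f.1 c g.1)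

end RightMod
end Rep

/-! ### The horizontal strip category -/

/-- `μ ∖ λ` is a horizontal strip: `λ ⊆ μ`, and no two boxes of `μ ∖ λ` lie in the same column.
(The cell `(i, j)` lies in row `i` and column `j`.) -/
def IsHorizontalStrip (l m : YoungDiagram) : Prop :=
  l ≤ m ∧ ∀ i i' j : ℕ, (i, j) ∈ m → (i, j) ∉ l → (i', j) ∈ m → (i', j) ∉ l → i = i'

theorem IsHorizontalStrip.refl (l : YoungDiagram) : IsHorizontalStrip l l :=
  ⟨le_rfl, fun _ _ _ h h' => absurd h h'⟩

theorem IsHorizontalStrip.left {l m n : YoungDiagram} (h : IsHorizontalStrip l n) (hl : l ≤ m)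
    (hm : m ≤ n) : IsHorizontalStrip l m :=
  ⟨hl, fun i i' j h1 h2 h3 h4 => h.2 i i' j (hm h1) h2 (hm h3) h4⟩

theorem IsHorizontalStrip.right {l m n : YoungDiagram} (h : IsHorizontalStrip l n) (hl : l ≤ m)
    (hm : m ≤ n) : IsHorizontalStrip m n :=
  ⟨hm, fun i i' j h1 h2 h3 h4 => h.2 i i' j h1 (fun e => h2 (hl e)) h3 (fun e => h4 (hl e))⟩

/-- The objects of the horizontal strip category over `k`: partitions. -/
structure HS (k : Type u) where
  /-- the partition -/
  shape : YoungDiagram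

namespace HS

/-- `HS(λ, μ)` is the line `k · (μ ∖ λ)` if `μ ∖ λ` is a horizontal strip, and zero otherwise; the
scalar `c` stands for `c · (μ ∖ λ)`. -/
def Hom (l m : HS k) : Submodule k k where
  carrier := {c | ¬ IsHorizontalStrip l.shape m.shape → c = 0}
  add_mem' hx hy h := by rw [hx h, hy h, add_zero]
  zero_mem' _ := rfl
  smul_mem' r x hx h := by rw [hx h, smul_zero]

open Classical in
/-- The composition: `(ν ∖ μ) (μ ∖ λ)` is `ν ∖ λ` if this is a horizontal strip, and zero
otherwise. -/
noncomputable def comp {l m n : HS k} (f : Hom l m) (g : Hom m n) : Hom l n :=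
  ⟨if IsHorizontalStrip l.shape n.shape then g.1 * f.1 else 0, fun h => if_neg h⟩

theorem comp_val {l m n : HS k} (f : Hom l m) (g : Hom m n)
    (h : IsHorizontalStrip l.shape n.shape) : (comp f g).1 = g.1 * f.1 := if_pos h

noncomputable instance : Category (HS k) where
  Hom l m := Hom l m
  id l := ⟨1, fun h => absurd (IsHorizontalStrip.refl _) h⟩
  comp := comp
  id_comp {l m} f := by
    apply Subtype.ext
    by_cases h : IsHorizontalStrip l.shape m.shape
    · rw [comp_val _ _ h, mul_one]
    · rw [f.2 h]; exact if_neg h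
  comp_id {l m} f := by
    apply Subtype.ext
    by_cases h : IsHorizontalStrip l.shape m.shape
    · rw [comp_val _ _ h, one_mul]
    · rw [f.2 h]; exact if_neg h
  assoc {l m n p} f g h := by
    apply Subtype.ext
    by_cases hlp : IsHorizontalStrip l.shape p.shape
    · rw [comp_val _ _ hlp, comp_val _ _ hlp]
      by_cases hf : IsHorizontalStrip l.shape m.shape
      · by_cases hg : IsHorizontalStrip m.shape n.shape
        · by_cases hh : IsHorizontalStrip n.shape p.shape
          · rw [comp_val _ _ (hlp.left (hf.1.trans hg.1) hh.1),
              comp_val _ _ (hlp.right hf.1 (hg.1.trans hh.1)), mul_assoc]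
          · have e : (comp g h).1 = 0 := by simp [comp, h.2 hh]
            rw [e, h.2 hh, zero_mul, zero_mul]
        · have e : (comp g h).1 = 0 := by simp [comp, g.2 hg]
          have e' : (comp f g).1 = 0 := by simp [comp, g.2 hg]
          rw [e, e', zero_mul, mul_zero]
      · have e : (comp f g).1 = 0 := by simp [comp, f.2 hf]
        rw [e, f.2 hf, mul_zero, mul_zero]
    · exact (if_neg hlp).trans (if_neg hlp).symm

theorem add_comp' {l m n : HS k} (f f' : Hom l m) (g : Hom m n) :
    comp (f + f') g = comp f g + comp f' g := by
  apply Subtype.ext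
  by_cases h : IsHorizontalStrip l.shape n.shape
  · simp [comp, h, mul_add]
  · simp [comp, h]

theorem comp_add' {l m n : HS k} (f : Hom l m) (g g' : Hom m n) :
    comp f (g + g') = comp f g + comp f g' := by
  apply Subtype.ext
  by_cases h : IsHorizontalStrip l.shape n.shape
  · simp [comp, h, add_mul]
  · simp [comp, h]

theorem smul_comp' {l m n : HS k} (c : k) (f : Hom l m) (g : Hom m n) :
    comp (c • f) g = c • comp f g := by
  apply Subtype.ext
  by_cases h : IsHorizontalStrip l.shape n.shape
  · simp [comp, h, mul_left_comm]
  · simp [comp, h]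

theorem comp_smul' {l m n : HS k} (c : k) (f : Hom l m) (g : Hom m n) :
    comp f (c • g) = c • comp f g := by
  apply Subtype.ext
  by_cases h : IsHorizontalStrip l.shape n.shape
  · simp [comp, h, mul_assoc]
  · simp [comp, h]

noncomputable instance : Preadditive (HS k) where
  homGroup l m := inferInstanceAs (AddCommGroup (Hom l m))
  add_comp _ _ _ f f' g := add_comp' f f' g
  comp_add _ _ _ f g g' := comp_add' f g g'

noncomputable instance : Linear k (HS k) where
  homModule l m := inferInstanceAs (Module k (Hom l m))
  smul_comp _ _ _ c f g := smul_comp' c f g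
  comp_smul _ _ _ f c g := comp_smul' c f g

end HS

/-! ### Morita equivalence and generic parameters -/

/-- The category of representations of a `k`-linear category `D`: the `k`-linear functors from `D`
to `k`-vector spaces. -/
abbrev LinRep (k : Type u) [Field k] (D : Type) [Category.{u} D] [Preadditive D] [Linear k D] :=
  ObjectProperty.FullSubcategory fun F : D ⥤ ModuleCat.{u} k =>
    F.Additive ∧ F.Linear k

/-- A right ideal `N` of `H_n`, that is, a subobject of `X^{⊗ n}` in degree `n`, is simple and is not
the representation of the partition with one row, on which all `g_i` act by `a`. -/
def Rep.IsSimpleNotOneRow {n : ℕ} (N : Submodule (Hecke k a n)ᵐᵒᵖ ((Rep.T k a).V n)) : Prop :=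
  IsSimpleModule (Hecke k a n)ᵐᵒᵖ N ∧
    ¬ ∀ (i : {i : ℕ // i + 1 < n}) (x : (Rep.T k a).V n), x ∈ N →
      op (Hecke.gen i : Hecke k a n) • x = (a : k) • x

/-- The quantum integer `[n] = a^{n-1} + a^{n-3} + ⋯ + a^{1-n}`. -/
def qInt (a : kˣ) (n : ℕ) : k := ∑ i ∈ Finset.range n, (↑(a ^ ((n : ℤ) - 1 - 2 * i)) : k)

/-- The parameter `a` is generic: no quantum integer `[n]`, `n ≥ 1`, vanishes. -/
def IsGeneric (a : kˣ) : Prop := ∀ n : ℕ, 1 ≤ n → qInt a n ≠ 0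

end HeckeCat

/-! For generic `a` the algebra $H_n$ is a product of matrix algebras, and Young's seminormal form
makes this explicit. On the space with basis the standard tableaux of size $n$, the generator with
index $i$ sends $T$ to $cT+(a-c)\,sT$. Here $s$ exchanges the entries $i$ and $i+1$, $c=a^d/[d]$
with $d$ the difference of the contents of their boxes, and $sT$ counts as zero if it is not
standard. The defining relations reduce to identities between quantum integers (`genOp_quad`,
`genOp_comm`, `genOp_braid`). The Jucys–Murphy elements act diagonally with eigenvalues $a^c[c]$
(`rho_jm`), and contents separate tableaux. So the image of $H_n$ contains the diagonal matrix units
and, by cutting down generators, all matrix units between tableaux of equal shape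
(`matUnit_mem_range`). There are at least $n!$ of these, by an up-down argument in Young's lattice
(`factorial_le_card_pairs`), while $\dim H_n\le n!$ by coset representatives
(`finite_and_finrank_le`). Hence the representation is faithful (`rho_injective`), and $H_n$ itself
has a basis of matrix units $E_{S,T}$ (`tabUnit`). Part 1: $1=\sum_T E_{T,T}$ splits the regular
module into the simple right ideals $E_{T,T}H_n$. The one-row tableau is alone in its shape and
carries the character $g_i\mapsto a$; the other summands fill the kernel (`ker_proj`). Part 2: a
right $S$-module is a sequence of right $H_n$-modules $M_n$ with transitive $H_m$-linear maps
$M_m\to M_p$, on whose images the generators of index $i\ge m$ act by $a$ (`mulOne`,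
`RightMod.ofMulOne`). For $y$ in such an image, computing $y\,g\,E_{R,T}$ in two ways shows that
$yE_{R,T}$ does not change when late entries of $R$ are exchanged, and that it vanishes if two
consecutive late entries are vertically adjacent (`tabUnit_act_swap`, `tabUnit_act_column`). So
$yE_{R,T}$ depends only on the first $m$ boxes and the shape of $R$, and it is zero unless the added
boxes form a horizontal strip. The resulting maps `theta` compose as in $\mathbf{HS}$, and thus the
multiplicity spaces of $M$ form a representation of $\mathbf{HS}$ (`multRep`). Conversely, a
representation $F$ gives the module with $\prod_T F(\mathrm{shape}\,T)$ in degree $n$ (`tabMod`).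
This functor is fully faithful because morphisms commute with matrix units, and essentially
surjective because a module is recovered from its components (`toTabFam_bijective`). -/

namespace HeckeCat

/-! ### Standard tableaux -/

/-- The content of the box in row `b.1` and column `b.2`. -/
def content (b : ℕ × ℕ) : ℤ := (b.2 : ℤ) - b.1

/-- `T` lists the boxes of a standard tableau of size `n` in the order in which they are added;
beyond `n` its values are zero. -/
structure IsStd (n : ℕ) (T : ℕ → ℕ × ℕ) : Prop where
  inj : ∀ i j, i < n → j < n → T i = T j → i = j
  lower : ∀ i, i < n → ∀ b, b ≤ T i → ∃ j, j ≤ i ∧ T j = b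
  zero : ∀ i, n ≤ i → T i = 0

namespace IsStd

variable {n : ℕ} {T : ℕ → ℕ × ℕ}

theorem le_of_le (h : IsStd n T) {i j : ℕ} (hi : i < n) (hj : j < n) (hle : T i ≤ T j) :
    i ≤ j := by
  obtain ⟨l, hl, e⟩ := h.lower j hj _ hle
  rwa [← h.inj l i (by omega) hi e]

theorem lt_of_lt (h : IsStd n T) {j : ℕ} (hj : j < n) {b : ℕ × ℕ} (hb : b < T j) :
    ∃ i, i < j ∧ T i = b := by
  obtain ⟨i, hi, e⟩ := h.lower j hj b hb.le
  refine ⟨i, lt_of_le_of_ne hi ?_, e⟩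
  rintro rfl
  exact hb.ne e.symm

/-- Only the relative order of the two exchanged entries changes, so standardness can fail only if
the second box lies weakly below and to the right of the first. -/
theorem swap (h : IsStd n T) {i : ℕ} (hi : i + 1 < n) (hn : ¬ T i ≤ T (i + 1)) :
    IsStd n (T ∘ Equiv.swap i (i + 1)) where
  inj j l hj hl e := by
    have := h.inj _ _ ?_ ?_ e
    · exact (Equiv.swap i (i + 1)).injective this
    all_goals
      rw [Equiv.swap_apply_def]
      split_ifs <;> omega
  lower l hl b hb := by
    obtain ⟨j, hj, e⟩ := h.lower (Equiv.swap i (i + 1) l) (by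
      rw [Equiv.swap_apply_def]; split_ifs <;> omega) b hb
    refine ⟨Equiv.swap i (i + 1) j, ?_, by simp [e]⟩
    have key : l = i → j ≠ i := by
      rintro rfl rfl
      rw [Function.comp_apply, Equiv.swap_apply_left, ← e] at hb
      exact hn hb
    rw [Equiv.swap_apply_def] at hj ⊢
    split_ifs at hj ⊢ <;> omega
  zero l hl := by
    have : Equiv.swap i (i + 1) l = l := Equiv.swap_apply_of_ne_of_ne (by omega) (by omega)
    simp [this, h.zero l hl]

theorem not_le_of_swap {i : ℕ} (hi : i + 1 < n)
    (hs : IsStd n (T ∘ Equiv.swap i (i + 1))) : ¬ T i ≤ T (i + 1) := by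
  intro hle
  have := hs.le_of_le (i := i + 1) (j := i) hi (by omega) (by simpa using hle)
  omega

/-- Two boxes on one diagonal are comparable. The right and the lower neighbour of the smaller one
both precede the larger one, so the two entries differ by at least three. This keeps every
denominator in the seminormal form, including those of the braid relation, away from $[0]$. -/
theorem content_ne (h : IsStd n T) {i j : ℕ} (hij : i < j) (hj : j < n) (hd : j ≤ i + 2) :
    content (T i) ≠ content (T j) := by
  intro hc
  unfold content at hc
  rcases le_total (T i).1 (T j).1 with h1 | h1
  · have hle : T i ≤ T j := ⟨h1, by omega⟩
    have hne : T i ≠ T j := fun e => by have := h.inj i j (by omega) hj e; omega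
    have h2 : (T i).1 < (T j).1 := by
      refine lt_of_le_of_ne h1 fun e => hne (Prod.ext e (by omega))
    have a1 : ((T i).1, (T i).2 + 1) < T j := Prod.mk_lt_mk.2 (Or.inl ⟨h2, by omega⟩)
    have a2 : ((T i).1 + 1, (T i).2) < T j :=
      lt_of_le_of_ne ⟨h2, by simp only; omega⟩ fun e => by
        have e1 := congrArg Prod.fst e
        have e2 := congrArg Prod.snd e
        simp only at e1 e2
        omega
    obtain ⟨l, hl, el⟩ := h.lt_of_lt hj a1
    obtain ⟨l', hl', el'⟩ := h.lt_of_lt hj a2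
    have b1 : i ≤ l := h.le_of_le (by omega) (by omega) (by rw [el]; exact ⟨le_rfl, by simp⟩)
    have b2 : i ≤ l' := h.le_of_le (by omega) (by omega) (by rw [el']; exact ⟨by simp, le_rfl⟩)
    have c1 : i ≠ l := by
      rintro rfl
      have := congrArg Prod.snd el
      simp at this
    have c2 : i ≠ l' := by
      rintro rfl
      have := congrArg Prod.fst el'
      simp at this
    have c3 : l ≠ l' := by
      rintro rfl
      have := congrArg Prod.fst (el.symm.trans el')
      simp at this
    omega
  · have hle : T j ≤ T i := ⟨h1, by omega⟩
    have := h.le_of_le hj (by omega) hle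
    omega

/-- A box strictly between the two would need an entry strictly between $i$ and $i+1$. -/
theorem adjacent (h : IsStd n T) {i : ℕ} (hi : i + 1 < n) (hle : T i ≤ T (i + 1)) :
    T (i + 1) = ((T i).1, (T i).2 + 1) ∨ T (i + 1) = ((T i).1 + 1, (T i).2) := by
  have hlt : T i < T (i + 1) := lt_of_le_of_ne hle fun e => by
    have := h.inj i (i + 1) (by omega) hi e
    omega
  have key (b : ℕ × ℕ) (h1 : T i < b) (h2 : b ≤ T (i + 1)) : b = T (i + 1) := by
    by_contra hne
    obtain ⟨l, hl, rfl⟩ := h.lt_of_lt hi (lt_of_le_of_ne h2 hne)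
    have := h.le_of_le (by omega) (by omega) h1.le
    obtain rfl : i = l := by omega
    exact lt_irrefl _ h1
  rcases Prod.lt_iff.1 hlt with ⟨h1, h2⟩ | ⟨h1, h2⟩
  · exact Or.inr (key ((T i).1 + 1, (T i).2) (Prod.lt_iff.2 (Or.inl ⟨by simp, le_rfl⟩)) ⟨Nat.succ_le_of_lt h1, h2⟩).symm
  · exact Or.inl (key ((T i).1, (T i).2 + 1) (Prod.lt_iff.2 (Or.inr ⟨le_rfl, by simp⟩)) ⟨h1, Nat.succ_le_of_lt h2⟩).symm

/-- The two boxes are incomparable: row and column differ strictly and in opposite directions, so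
the contents differ by at least two. -/
theorem content_of_not_le (h : IsStd n T) {i : ℕ} (hi : i + 1 < n) (hn : ¬ T i ≤ T (i + 1)) :
    content (T (i + 1)) - content (T i) ≠ 1 ∧ content (T (i + 1)) - content (T i) ≠ -1 := by
  have h2 : ¬ T (i + 1) ≤ T i := fun e => by
    have := h.le_of_le hi (by omega) e
    omega
  rw [Prod.le_def] at hn h2
  unfold content
  omega

/-- Agreement of contents forces agreement of standard tableaux. -/
theorem ext_content {T' : ℕ → ℕ × ℕ} (h : IsStd n T) (h' : IsStd n T')
    (hc : ∀ i, i < n → content (T i) = content (T' i)) : T = T' := by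
  -- At the first disagreement two boxes of equal content are comparable. The smaller one would
  -- already occur earlier in the other tableau, hence earlier in both.
  have key {T T' : ℕ → ℕ × ℕ} (h : IsStd n T) (h' : IsStd n T') {i : ℕ} (hi : i < n)
      (ih : ∀ j, j < i → T j = T' j) (hc : content (T i) = content (T' i)) : ¬ T i < T' i := by
    intro hlt
    obtain ⟨j, hj, e⟩ := h'.lt_of_lt hi hlt
    rw [← ih j hj] at e
    have := h.inj j i (by omega) hi e
    omega
  have main : ∀ i, i < n → T i = T' i := by
    intro i
    induction i using Nat.strong_induction_on with
    | _ i ih =>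
      intro hi
      have ih' : ∀ j, j < i → T j = T' j := fun j hj => ih j hj (by omega)
      have k1 := key h h' hi ih' (hc i hi)
      have k2 := key h' h hi (fun j hj => (ih' j hj).symm) (hc i hi).symm
      have c := hc i hi
      unfold content at c
      rcases le_total (T i).1 (T' i).1 with h1 | h1
      · by_contra hne
        exact k1 (lt_of_le_of_ne ⟨h1, by omega⟩ hne)
      · by_contra hne
        exact k2 (lt_of_le_of_ne ⟨h1, by omega⟩ (Ne.symm hne))
  funext i
  by_cases hi : i < n
  · exact main i hi
  · rw [h.zero i (by omega), h'.zero i (by omega)]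

theorem apply_zero (h : IsStd n T) : T 0 = 0 := by
  by_cases hn : 0 < n
  · obtain ⟨j, hj, e⟩ := h.lower 0 hn 0 ⟨Nat.zero_le _, Nat.zero_le _⟩
    obtain rfl : j = 0 := by omega
    exact e
  · exact h.zero 0 (by omega)

/-- The box just above has a smaller entry, so induction applies. Together with the bound on columns
this makes `Tab n` finite. -/
theorem fst_le (h : IsStd n T) (i : ℕ) : (T i).1 ≤ i := by
  induction i using Nat.strong_induction_on with
  | _ i ih =>
    by_cases hi : i < n
    · rcases Nat.eq_zero_or_pos (T i).1 with h0 | h0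
      · omega
      · obtain ⟨j, hj, e⟩ := h.lt_of_lt hi (b := ((T i).1 - 1, (T i).2))
          (Prod.lt_iff.2 (Or.inl ⟨by simp only; omega, le_rfl⟩))
        have := ih j hj
        rw [e] at this
        simp only at this
        omega
    · simp [h.zero i (by omega)]

theorem snd_le (h : IsStd n T) (i : ℕ) : (T i).2 ≤ i := by
  induction i using Nat.strong_induction_on with
  | _ i ih =>
    by_cases hi : i < n
    · rcases Nat.eq_zero_or_pos (T i).2 with h0 | h0
      · omega
      · obtain ⟨j, hj, e⟩ := h.lt_of_lt hi (b := ((T i).1, (T i).2 - 1))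
          (Prod.lt_iff.2 (Or.inr ⟨le_rfl, by simp only; omega⟩))
        have := ih j hj
        rw [e] at this
        simp only at this
        omega
    · simp [h.zero i (by omega)]

end IsStd

/-- Standard tableaux of size `n`. -/
structure Tab (n : ℕ) where
  /-- the box with a given entry -/
  val : ℕ → ℕ × ℕ
  property : IsStd n val

/-! ### Truncating, grafting and extending standard tableaux. -/

namespace Tab

variable {n m p : ℕ}

theorem ext {T T' : Tab n} (h : ∀ i, i < n → T.1 i = T'.1 i) : T = T' := by
  obtain ⟨T, hT⟩ := T
  obtain ⟨T', hT'⟩ := T'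
  congr 1
  funext i
  by_cases hi : i < n
  · exact h i hi
  · rw [hT.zero i (by omega), hT'.zero i (by omega)]

instance : Finite (Tab n) := by
  let f : Tab n → Fin n → Fin (n + 1) × Fin (n + 1) := fun T i =>
    (⟨(T.1 i).1, by have := T.2.fst_le i; have := i.2; omega⟩,
      ⟨(T.1 i).2, by have := T.2.snd_le i; have := i.2; omega⟩)
  refine Finite.of_injective f fun T T' h => ext fun i hi => ?_
  have := congrFun h ⟨i, hi⟩
  simp only [f, Prod.mk.injEq, Fin.mk.injEq] at this
  exact Prod.ext this.1 this.2

noncomputable instance : Fintype (Tab n) := Fintype.ofFinite _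

noncomputable instance : DecidableEq (Tab n) := Classical.decEq _

/-- The set of boxes of a standard tableau. -/
def shape (T : Tab n) : YoungDiagram where
  cells := (Finset.range n).image T.1
  isLowerSet := by
    intro b c hcb hb
    simp only [Finset.coe_image, Finset.coe_range, Set.mem_image, Set.mem_Iio] at hb ⊢
    obtain ⟨i, hi, rfl⟩ := hb
    obtain ⟨j, hj, e⟩ := T.2.lower i hi c hcb
    exact ⟨j, by omega, e⟩

theorem mem_shape {T : Tab n} {b : ℕ × ℕ} : b ∈ T.shape ↔ ∃ i, i < n ∧ T.1 i = b := by
  rw [← YoungDiagram.mem_cells]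
  simp [shape]

theorem apply_mem_shape (T : Tab n) {i : ℕ} (hi : i < n) : T.1 i ∈ T.shape :=
  mem_shape.2 ⟨i, hi, rfl⟩

theorem card_shape (T : Tab n) : T.shape.card = n := by
  change ((Finset.range n).image T.1).card = n
  rw [Finset.card_image_of_injOn, Finset.card_range]
  intro i hi j hj e
  simp only [Finset.coe_range, Set.mem_Iio] at hi hj
  exact T.2.inj i j hi hj e

/-- Exchange of the entries `i` and `i + 1`. -/
def swap (T : Tab n) {i : ℕ} (hi : i + 1 < n) (hn : ¬ T.1 i ≤ T.1 (i + 1)) : Tab n :=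
  ⟨T.1 ∘ Equiv.swap i (i + 1), T.2.swap hi hn⟩

theorem shape_eq_of_swap {T T' : Tab n} {i : ℕ} (hi : i + 1 < n)
    (h : T'.1 = T.1 ∘ Equiv.swap i (i + 1)) : T'.shape = T.shape := by
  have hlt (j : ℕ) (hj : j < n) : Equiv.swap i (i + 1) j < n := by
    rw [Equiv.swap_apply_def]; split_ifs <;> omega
  apply SetLike.ext
  intro b
  rw [mem_shape, mem_shape]
  constructor
  · rintro ⟨j, hj, rfl⟩
    exact ⟨_, hlt j hj, by rw [h]; rfl⟩
  · rintro ⟨j, hj, rfl⟩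
    exact ⟨_, hlt j hj, by rw [h]; simp⟩

@[simp]
theorem shape_swap (T : Tab n) {i : ℕ} (hi : i + 1 < n) (hn : ¬ T.1 i ≤ T.1 (i + 1)) :
    (T.swap hi hn).shape = T.shape :=
  shape_eq_of_swap hi rfl

/-- The tableau of the first `m` boxes. -/
def trunc (h : m ≤ n) (T : Tab n) : Tab m where
  val i := if i < m then T.1 i else 0
  property :=
    { inj := fun i j hi hj e => by
        rw [if_pos hi, if_pos hj] at e
        exact T.2.inj i j (by omega) (by omega) e
      lower := fun i hi b hb => by
        rw [if_pos hi] at hb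
        obtain ⟨j, hj, e⟩ := T.2.lower i (by omega) b hb
        exact ⟨j, hj, by rw [if_pos (by omega), e]⟩
      zero := fun i hi => if_neg (by omega) }

theorem trunc_apply (h : m ≤ n) (T : Tab n) {i : ℕ} (hi : i < m) : (T.trunc h).1 i = T.1 i :=
  if_pos hi

@[simp]
theorem trunc_self (h : n ≤ n) (T : Tab n) : T.trunc h = T :=
  ext fun _ hi => trunc_apply h T hi

@[simp]
theorem trunc_trunc (h : m ≤ n) (h' : n ≤ p) (T : Tab p) :
    (T.trunc h').trunc h = T.trunc (h.trans h') :=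
  ext fun i hi => by rw [trunc_apply _ _ hi, trunc_apply _ _ hi, trunc_apply _ _ (by omega)]

theorem shape_trunc_le (h : m ≤ n) (T : Tab n) : (T.trunc h).shape ≤ T.shape := by
  intro b hb
  obtain ⟨i, hi, rfl⟩ := mem_shape.1 hb
  rw [trunc_apply _ _ hi]
  exact T.apply_mem_shape (by omega)

/-- Replacement of the first `m` boxes by those of a tableau of the same shape. -/
def graft (h : m ≤ n) (Q : Tab m) (T : Tab n) (hs : Q.shape = (T.trunc h).shape) : Tab n where
  val i := if i < m then Q.1 i else T.1 i
  property := by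
    have key (i : ℕ) (hi : i < m) : ∃ j, j < m ∧ T.1 j = Q.1 i := by
      have := Q.apply_mem_shape hi
      rw [hs] at this
      obtain ⟨j, hj, e⟩ := mem_shape.1 this
      exact ⟨j, hj, by rw [← e, trunc_apply _ _ hj]⟩
    have key' (i : ℕ) (hi : i < m) : ∃ j, j < m ∧ Q.1 j = T.1 i := by
      have := (T.trunc h).apply_mem_shape hi
      rw [← hs] at this
      obtain ⟨j, hj, e⟩ := mem_shape.1 this
      exact ⟨j, hj, by rw [e, trunc_apply _ _ hi]⟩
    refine ⟨fun i j hi hj e => ?_, fun i hi b hb => ?_, fun i hi => ?_⟩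
    · split_ifs at e with h1 h2 h2
      · exact Q.2.inj i j h1 h2 e
      · obtain ⟨l, hl, el⟩ := key i h1
        have := T.2.inj l j (by omega) hj (el.trans e)
        omega
      · obtain ⟨l, hl, el⟩ := key j h2
        have := T.2.inj l i (by omega) hi (el.trans e.symm)
        omega
      · exact T.2.inj i j hi hj e
    · split_ifs at hb with h1
      · obtain ⟨j, hj, e⟩ := Q.2.lower i h1 b hb
        exact ⟨j, hj, by rw [if_pos (by omega), e]⟩
      · obtain ⟨j, hj, e⟩ := T.2.lower i hi b hb
        by_cases hjm : j < m
        · obtain ⟨l, hl, el⟩ := key' j hjm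
          exact ⟨l, by omega, by rw [if_pos hl, el, e]⟩
        · exact ⟨j, hj, by rw [if_neg hjm, e]⟩
    · rw [if_neg (by omega), T.2.zero i hi]

theorem graft_apply_lt (h : m ≤ n) {Q : Tab m} {T : Tab n} (hs : Q.shape = (T.trunc h).shape)
    {i : ℕ} (hi : i < m) : (graft h Q T hs).1 i = Q.1 i := if_pos hi

theorem graft_apply_ge (h : m ≤ n) {Q : Tab m} {T : Tab n} (hs : Q.shape = (T.trunc h).shape)
    {i : ℕ} (hi : m ≤ i) : (graft h Q T hs).1 i = T.1 i := if_neg (by omega)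

@[simp]
theorem trunc_graft (h : m ≤ n) {Q : Tab m} {T : Tab n} (hs : Q.shape = (T.trunc h).shape) :
    (graft h Q T hs).trunc h = Q :=
  ext fun i hi => by rw [trunc_apply _ _ hi, graft_apply_lt _ _ hi]

@[simp]
theorem graft_trunc (h : m ≤ n) (T : Tab n) : graft h (T.trunc h) T rfl = T :=
  ext fun i _ => by
    by_cases hi : i < m
    · rw [graft_apply_lt _ _ hi, trunc_apply _ _ hi]
    · rw [graft_apply_ge _ _ (by omega)]

theorem mem_shape_iff_trunc (h : m ≤ n) (T : Tab n) (b : ℕ × ℕ) :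
    b ∈ T.shape ↔ b ∈ (T.trunc h).shape ∨ ∃ i, m ≤ i ∧ i < n ∧ T.1 i = b := by
  constructor
  · intro hb
    obtain ⟨i, hi, rfl⟩ := mem_shape.1 hb
    by_cases him : i < m
    · exact Or.inl (mem_shape.2 ⟨i, him, trunc_apply _ _ him⟩)
    · exact Or.inr ⟨i, by omega, hi, rfl⟩
  · rintro (hb | ⟨i, -, hi, rfl⟩)
    · exact shape_trunc_le h T hb
    · exact T.apply_mem_shape hi

@[simp]
theorem shape_graft (h : m ≤ n) {Q : Tab m} {T : Tab n} (hs : Q.shape = (T.trunc h).shape) :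
    (graft h Q T hs).shape = T.shape := by
  apply SetLike.ext
  intro b
  rw [mem_shape_iff_trunc h, mem_shape_iff_trunc h T, trunc_graft, hs]
  apply or_congr_right
  constructor <;> rintro ⟨i, h1, h2, h3⟩
  · exact ⟨i, h1, h2, by rwa [graft_apply_ge _ _ h1] at h3⟩
  · exact ⟨i, h1, h2, by rwa [graft_apply_ge _ _ h1]⟩

/-- Addition of a box. -/
def snoc (T : Tab n) (b : ℕ × ℕ) (hb : b ∉ T.shape) (hl : ∀ c, c < b → c ∈ T.shape) :
    Tab (n + 1) where
  val i := if i = n then b else T.1 i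
  property := by
    refine ⟨fun i j hi hj e => ?_, fun i hi c hc => ?_, fun i hi => ?_⟩
    · split_ifs at e with h1 h2 h2
      · omega
      · exact absurd (mem_shape.2 ⟨j, by omega, e.symm⟩) hb
      · exact absurd (mem_shape.2 ⟨i, by omega, e⟩) hb
      · exact T.2.inj i j (by omega) (by omega) e
    · split_ifs at hc with h1
      · rcases hc.eq_or_lt with rfl | hlt
        · exact ⟨n, by omega, if_pos rfl⟩
        · obtain ⟨j, hj, e⟩ := mem_shape.1 (hl c hlt)
          exact ⟨j, by omega, by rw [if_neg (by omega), e]⟩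
      · obtain ⟨j, hj, e⟩ := T.2.lower i (by omega) c hc
        exact ⟨j, hj, by rw [if_neg (by omega), e]⟩
    · rw [if_neg (by omega), T.2.zero i (by omega)]

section snoc

variable (T : Tab n) (b : ℕ × ℕ) (hb : b ∉ T.shape) (hl : ∀ c, c < b → c ∈ T.shape)

@[simp]
theorem snoc_apply_self : (T.snoc b hb hl).1 n = b := if_pos rfl

theorem snoc_apply_lt {i : ℕ} (hi : i < n) : (T.snoc b hb hl).1 i = T.1 i := if_neg (by omega)

@[simp]
theorem trunc_snoc (h : n ≤ n + 1) : (T.snoc b hb hl).trunc h = T :=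
  ext fun i hi => by rw [trunc_apply _ _ hi, snoc_apply_lt _ _ _ _ hi]

theorem mem_shape_snoc (c : ℕ × ℕ) : c ∈ (T.snoc b hb hl).shape ↔ c ∈ T.shape ∨ c = b := by
  rw [mem_shape_iff_trunc (Nat.le_succ n), trunc_snoc]
  apply or_congr_right
  constructor
  · rintro ⟨i, h1, h2, h3⟩
    obtain rfl : i = n := by omega
    rw [← h3, snoc_apply_self]
  · rintro rfl
    exact ⟨n, le_rfl, Nat.lt_succ_self n, by simp⟩

end snoc

/-- Every tableau of shape contained in `μ` extends to a tableau of shape `μ`. -/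
theorem exists_extension {μ : YoungDiagram} (h : m ≤ p) (hp : μ.card = p) (T : Tab m)
    (hT : T.shape ≤ μ) : ∃ R : Tab p, R.trunc h = T ∧ R.shape = μ := by
  obtain ⟨d, rfl⟩ := Nat.exists_eq_add_of_le h
  induction d generalizing m with
  | zero =>
    refine ⟨T, trunc_self _ _, ?_⟩
    apply le_antisymm hT
    rw [← YoungDiagram.cells_subset_iff]
    refine (Finset.eq_of_subset_of_card_le (YoungDiagram.cells_subset_iff.2 hT) ?_).superset
    change μ.card ≤ T.shape.card
    rw [card_shape, hp]
    rfl
  | succ d ih =>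
    -- A minimal box of the complement has all smaller boxes in the shape of `T`, so it can be added
    -- next.
    have hne : (μ.cells \ T.shape.cells).Nonempty := by
      rw [← Finset.card_pos, Finset.card_sdiff_of_subset (YoungDiagram.cells_subset_iff.2 hT)]
      change 0 < μ.card - T.shape.card
      rw [card_shape, hp]
      omega
    obtain ⟨b, hb, hmin⟩ := Finset.exists_minimal hne
    rw [Finset.mem_sdiff, YoungDiagram.mem_cells, YoungDiagram.mem_cells] at hb
    have hl : ∀ c, c < b → c ∈ T.shape := by
      intro c hc
      by_contra hcT
      have hcμ : c ∈ μ := μ.isLowerSet hc.le hb.1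
      have := hmin (y := c) (by simp [hcμ, hcT]) hc.le
      exact absurd hc (not_lt_of_ge this)
    obtain ⟨R, hR, hs⟩ := ih (T.snoc b hb.2 hl) (by
      intro c hc
      rcases (mem_shape_snoc _ _ _ _ c).1 hc with h' | rfl
      · exact hT h'
      · exact hb.1) (by omega) (by omega)
    have e : m + 1 + d = m + (d + 1) := by omega
    have main : ∀ q (hq : m ≤ q), m + 1 + d = q → ∃ R : Tab q, R.trunc hq = T ∧ R.shape = μ := by
      rintro q hq rfl
      refine ⟨R, ?_, hs⟩
      rw [← trunc_trunc (Nat.le_succ m) (by omega), hR, trunc_snoc]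
    exact main _ _ e

theorem exists_shape (μ : YoungDiagram) : ∃ R : Tab μ.card, R.shape = μ := by
  obtain ⟨R, -, h⟩ := exists_extension (Nat.zero_le μ.card) rfl
    (⟨fun _ => 0, ⟨by omega, by omega, fun _ _ => rfl⟩⟩ : Tab 0) (by
      intro b hb
      obtain ⟨i, hi, -⟩ := mem_shape.1 hb
      omega)
  exact ⟨R, h⟩

/-- Moving a maximal box to a later position by exchanges. -/
theorem exists_move {P : Tab p → Tab p → Prop} (hP : Equivalence P)
    (hs : ∀ (R : Tab p) (i : ℕ) (hi : i + 1 < p) (hn : ¬ R.1 i ≤ R.1 (i + 1)), m ≤ i →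
      P R (R.swap hi hn)) {k : ℕ} (hk : k < p) (d : ℕ) (R : Tab p) (j : ℕ) (hj : j + d = k)
    (hm : m ≤ j) (hmax : ∀ i, i ≤ k → R.1 j ≤ R.1 i → i = j) :
    ∃ R' : Tab p, P R R' ∧ R'.shape = R.shape ∧ R'.1 k = R.1 j ∧
      (∀ i, i < m ∨ k < i → R'.1 i = R.1 i) := by
  induction d generalizing R j with
  | zero => exact ⟨R, hP.refl R, rfl, by rw [← hj]; rfl, fun _ _ => rfl⟩
  | succ d ih =>
    -- The box at `j` is maximal among those up to position `k`, so it may be exchanged with its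
    -- successor and stays maximal afterwards.
    have hn : ¬ R.1 j ≤ R.1 (j + 1) := fun h => by
      have := hmax (j + 1) (by omega) h
      omega
    have e1 : (R.swap (by omega) hn).1 (j + 1) = R.1 j := by simp [swap]
    obtain ⟨R', h1, h2, h3, h4⟩ := ih (R.swap (by omega) hn) (j + 1) (by omega) (by omega) (by
      intro i hi h
      rw [e1] at h
      have hb : Equiv.swap j (j + 1) i ≤ k := by
        rw [Equiv.swap_apply_def]; split_ifs <;> omega
      have := hmax _ hb h
      rw [Equiv.swap_apply_eq_iff] at this
      rw [this, Equiv.swap_apply_left])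
    refine ⟨R', hP.trans (hs R j (by omega) hn hm) h1, h2.trans (shape_swap _ _ _),
      h3.trans e1, fun i hi => ?_⟩
    rw [h4 i hi]
    simp only [swap, Function.comp_apply]
    rw [Equiv.swap_apply_of_ne_of_ne (by omega) (by omega)]

/-- Two tableaux of the same shape with the same first `m` boxes are connected by exchanges of
later boxes. -/
theorem connected {P : Tab p → Tab p → Prop} (hP : Equivalence P)
    (hs : ∀ (R : Tab p) (i : ℕ) (hi : i + 1 < p) (hn : ¬ R.1 i ≤ R.1 (i + 1)), m ≤ i →
      P R (R.swap hi hn)) {R R' : Tab p} (hsh : R.shape = R'.shape)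
    (hm : ∀ i, i < m → R.1 i = R'.1 i) : P R R' := by
  -- Here `k` is a position from which the two tableaux already agree. To lower it by one, the box
  -- that `R'` has at the last position of possible disagreement is moved there in `R`.
  have main : ∀ k R, R.shape = R'.shape → (∀ i, i < m → R.1 i = R'.1 i) →
      (∀ i, k ≤ i → R.1 i = R'.1 i) → P R R' := by
    intro k
    induction k with
    | zero =>
      intro R _ _ h
      obtain rfl : R = R' := ext fun i _ => h i (Nat.zero_le i)
      exact hP.refl _
    | succ k ih =>
      intro R hsh hm h
      by_cases hkm : m ≤ k ∧ k < p
      · obtain ⟨hkm, hkp⟩ := hkm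
        have hmem := R'.apply_mem_shape hkp
        rw [← hsh] at hmem
        obtain ⟨j, hj, e⟩ := mem_shape.1 hmem
        have hjk : j ≤ k := by
          by_contra hc
          rw [h j (by omega)] at e
          have := R'.2.inj j k hj hkp e
          omega
        have hmj : m ≤ j := by
          by_contra hc
          rw [hm j (by omega)] at e
          have := R'.2.inj j k hj hkp e
          omega
        -- Maximality holds because in `R'` a larger box can only come after position `k`, where
        -- both tableaux agree.
        obtain ⟨R₁, h1, h2, h3, h4⟩ := exists_move (m := m) hP hs hkp (k - j) R j (by omega) hmj (by
          intro i hi hle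
          have hi' := R.apply_mem_shape (show i < p by omega)
          rw [hsh] at hi'
          obtain ⟨l, hl, el⟩ := mem_shape.1 hi'
          rw [e, ← el] at hle
          have hkl := R'.2.le_of_le hkp hl hle
          rcases hkl.eq_or_lt with rfl | hlt
          · exact R.2.inj i j (by omega) hj (by rw [e, el])
          · rw [← h l hlt] at el
            have := R.2.inj l i hl (by omega) el
            omega)
        refine hP.trans h1 (ih R₁ (h2.trans hsh) (fun i hi => ?_) (fun i hi => ?_))
        · rw [h4 i (Or.inl hi), hm i hi]
        · rcases hi.eq_or_lt with rfl | hlt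
          · rw [h3, e]
          · rw [h4 i (Or.inr hlt), h i hlt]
      · refine ih R hsh hm fun i hi => ?_
        rcases hi.eq_or_lt with rfl | hlt
        · by_cases hkm' : k < m
          · exact hm k hkm'
          · rw [R.2.zero k (by omega), R'.2.zero k (by omega)]
        · exact h i hlt
  exact main p R hsh hm fun i hi => by rw [R.2.zero i hi, R'.2.zero i hi]

end Tab

/-! ### Quantum integers -/

section Quantum

variable {k : Type u} [Field k] (a : kˣ)

theorem qInt_succ (n : ℕ) : qInt a (n + 1) = a * qInt a n + (a : k) ^ (-(n : ℤ)) := by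
  unfold qInt
  rw [Finset.sum_range_succ, Finset.mul_sum]
  congr 1
  · refine Finset.sum_congr rfl fun i _ => ?_
    rw [← Units.val_mul, ← zpow_one_add]
    congr 2
    push_cast
    ring
  · rw [Units.val_zpow_eq_zpow_val]
    congr 1
    push_cast
    ring

theorem qInt_succ' (n : ℕ) : a * qInt a (n + 1) = qInt a n + (a : k) ^ ((n : ℤ) + 1) := by
  unfold qInt
  rw [Finset.sum_range_succ', mul_add, Finset.mul_sum]
  congr 1
  · refine Finset.sum_congr rfl fun i _ => ?_
    rw [← Units.val_mul, ← zpow_one_add]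
    congr 2
    push_cast
    ring
  · rw [← Units.val_mul, ← zpow_one_add, Units.val_zpow_eq_zpow_val]
    congr 1
    push_cast
    ring

/-- The quantum integer `[m]` for an integer `m`. -/
def qz (m : ℤ) : k := if 0 ≤ m then qInt a m.toNat else -qInt a (-m).toNat

@[simp]
theorem qz_zero : qz a 0 = 0 := by simp [qz, qInt]

theorem qz_natCast (n : ℕ) : qz a n = qInt a n := by simp [qz]

theorem qz_neg_natCast (n : ℕ) : qz a (-(n : ℤ)) = -qInt a n := by
  rcases Nat.eq_zero_or_pos n with rfl | h
  · simp [qInt]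
  · rw [qz, if_neg (by omega)]
    simp

theorem qz_succ (m : ℤ) : qz a (m + 1) = a * qz a m + (a : k) ^ (-m) := by
  rcases Int.eq_nat_or_neg m with ⟨n, rfl | rfl⟩
  · rw [← Nat.cast_succ, qz_natCast, qz_natCast, qInt_succ]
  · cases n with
    | zero =>
      have := qInt_succ a 0
      simp only [Nat.cast_zero, neg_zero, zero_add, qz_zero] at this ⊢
      have h1 := qz_natCast a 1
      simp only [Nat.cast_one] at h1
      rw [h1, this]
      simp [qInt]
    | succ n =>
      have e : -((n + 1 : ℕ) : ℤ) + 1 = -(n : ℤ) := by push_cast; ring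
      have := qInt_succ' a n
      rw [e, qz_neg_natCast, qz_neg_natCast, neg_neg, mul_neg, this]
      push_cast
      ring

@[simp]
theorem qz_one : qz a 1 = 1 := by
  have := qz_succ a 0
  simpa using this


/-- By `qz_succ` the difference of the two sides is multiplied by `a` when `m` increases by one, and
it vanishes at zero. This identity cannot serve as a definition of $[m]$, since $a-a^{-1}$ may be
zero. -/
theorem qz_sub_mul (m : ℤ) :
    ((a : k) - (a : k)⁻¹) * qz a m = (a : k) ^ m - (a : k) ^ (-m) := by
  have ha : (a : k) ≠ 0 := a.ne_zero
  have key (m : ℤ) : ((a : k) - (a : k)⁻¹) * qz a (m + 1) - ((a : k) ^ (m + 1) - (a : k) ^ (-(m + 1)))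
      = a * (((a : k) - (a : k)⁻¹) * qz a m - ((a : k) ^ m - (a : k) ^ (-m))) := by
    rw [qz_succ, neg_add, zpow_add₀ ha, zpow_add₀ ha, zpow_one, zpow_neg_one]
    ring
  induction m using Int.induction_on with
  | zero => simp
  | succ n ih =>
    have := key n
    rw [ih, sub_self, mul_zero] at this
    exact sub_eq_zero.1 this
  | pred n ih =>
    have := key (-n - 1)
    rw [sub_add_cancel, ih, sub_self, eq_comm, mul_eq_zero] at this
    exact sub_eq_zero.1 (this.resolve_left ha)

/-- Induction on `n` in both directions avoids a division by $a-a^{-1}$, so the case $a=1$ is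
included. -/
theorem qz_add (m n : ℤ) : qz a (m + n) = (a : k) ^ m * qz a n + (a : k) ^ (-n) * qz a m := by
  have ha : (a : k) ≠ 0 := a.ne_zero
  have key (n : ℤ) : qz a (m + (n + 1)) - ((a : k) ^ m * qz a (n + 1) + (a : k) ^ (-(n + 1)) * qz a m)
      = a * (qz a (m + n) - ((a : k) ^ m * qz a n + (a : k) ^ (-n) * qz a m)) := by
    have h := qz_sub_mul a m
    rw [← add_assoc, qz_succ, qz_succ, neg_add, neg_add, zpow_add₀ ha, zpow_add₀ ha, zpow_neg_one]
    linear_combination (a : k) ^ (-n) * h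
  induction n using Int.induction_on with
  | zero => simp
  | succ n ih =>
    have := key n
    rw [ih, sub_self, mul_zero] at this
    exact sub_eq_zero.1 this
  | pred n ih =>
    have := key (-n - 1)
    rw [sub_add_cancel, ih, sub_self, eq_comm, mul_eq_zero] at this
    exact sub_eq_zero.1 (this.resolve_left ha)

theorem qz_neg (m : ℤ) : qz a (-m) = -qz a m := by
  rcases Int.eq_nat_or_neg m with ⟨n, rfl | rfl⟩
  · rw [qz_neg_natCast, qz_natCast]
  · rw [neg_neg, qz_neg_natCast, qz_natCast, neg_neg]

variable {a}

theorem qz_ne_zero (ha : IsGeneric a) {m : ℤ} (hm : m ≠ 0) : qz a m ≠ 0 := by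
  rcases Int.eq_nat_or_neg m with ⟨n, rfl | rfl⟩
  · rw [qz_natCast]
    exact ha n (by omega)
  · rw [qz_neg_natCast, neg_ne_zero]
    exact ha n (by omega)

variable (a)

/-- The diagonal coefficient `a^m / [m]` of Young's seminormal form. -/
def diagCoeff (m : ℤ) : k := (a : k) ^ m / qz a m

@[simp]
theorem diagCoeff_one : diagCoeff a 1 = a := by simp [diagCoeff]

variable {a}

/-- The coefficients at $m$ and $-m$ are the diagonal entries of a generator on the plane spanned by
two exchanged tableaux. They add up to the trace $a-a^{-1}$, the sum of the eigenvalues $a$ and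
$-a^{-1}$. -/
theorem diagCoeff_neg (ha : IsGeneric a) {m : ℤ} (hm : m ≠ 0) :
    diagCoeff a (-m) = (a : k) - (a : k)⁻¹ - diagCoeff a m := by
  have h := qz_sub_mul a m
  have h0 := qz_ne_zero ha hm
  rw [← eq_div_iff h0] at h
  rw [h, diagCoeff, diagCoeff, qz_neg]
  ring

/-- This is the one identity behind the braid relation. It comes from
$\frac{a^m}{[m]}+\frac{a^n}{[n]}-(a-a^{-1})=\frac{[m+n]}{[m][n]}$. -/
theorem diagCoeff_mul (ha : IsGeneric a) {m n : ℤ} (hm : m ≠ 0) (hn : n ≠ 0) (h : m + n ≠ 0) :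
    diagCoeff a m * diagCoeff a n =
      diagCoeff a (m + n) * (diagCoeff a m + diagCoeff a n - ((a : k) - (a : k)⁻¹)) := by
  have h1 := qz_sub_mul a n
  have h2 := qz_add a m n
  have hm0 := qz_ne_zero ha hm
  have hn0 := qz_ne_zero ha hn
  have h0 := qz_ne_zero ha h
  have ha0 : (a : k) ≠ 0 := a.ne_zero
  have e : (a : k) ^ m * qz a n + (a : k) ^ n * qz a m - ((a : k) - (a : k)⁻¹) * (qz a m * qz a n)
      = qz a (m + n) := by
    linear_combination -qz a m * h1 - h2
  have e2 : diagCoeff a m + diagCoeff a n - ((a : k) - (a : k)⁻¹) =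
      qz a (m + n) / (qz a m * qz a n) := by
    rw [← e, diagCoeff, diagCoeff]
    field_simp
  rw [e2, diagCoeff, diagCoeff, diagCoeff, zpow_add₀ ha0]
  field_simp

/-- The off-diagonal coefficient equals $[m-1]/[m]$, so it vanishes only for boxes adjacent in a
row. -/
theorem diagCoeff_ne (ha : IsGeneric a) {m : ℤ} (hm : m ≠ 0) (hm1 : m ≠ 1) :
    (a : k) - diagCoeff a m ≠ 0 := by
  have h0 := qz_ne_zero ha hm
  have h1 := qz_ne_zero ha (sub_ne_zero.2 hm1)
  have ha0 : (a : k) ≠ 0 := a.ne_zero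
  have h := qz_add a m (-1)
  rw [qz_neg, qz_one, neg_neg, zpow_one, ← sub_eq_add_neg] at h
  have e : (a : k) - diagCoeff a m = qz a (m - 1) / qz a m := by
    rw [h, diagCoeff]
    field_simp
    ring
  rw [e]
  exact div_ne_zero h1 h0

variable (a)

/-- The eigenvalue `a^c [c]` of the Jucys–Murphy elements. -/
def jmEigen (c : ℤ) : k := (a : k) ^ c * qz a c

/-- Written this way, a difference of eigenvalues is a unit times a quantum integer, so genericity
separates contents. -/
theorem jmEigen_sub (c d : ℤ) : jmEigen a c - jmEigen a d = (a : k) ^ (c + d) * qz a (c - d) := by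
  have ha0 : (a : k) ≠ 0 := a.ne_zero
  have e : c - d = -d + c := by ring
  rw [e, qz_add, qz_neg, jmEigen, jmEigen, zpow_add₀ ha0, zpow_neg, zpow_neg]
  field_simp
  ring

variable {a}

theorem jmEigen_ne (ha : IsGeneric a) {c d : ℤ} (h : c ≠ d) : jmEigen a c ≠ jmEigen a d := by
  rw [← sub_ne_zero, jmEigen_sub]
  exact mul_ne_zero (zpow_ne_zero _ a.ne_zero) (qz_ne_zero ha (sub_ne_zero.2 h))

/-- This is the scalar identity needed to move a Jucys–Murphy element past a generator in `rho_jm`.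
-/
theorem diagCoeff_mul_jmEigen_sub (ha : IsGeneric a) {c d : ℤ} (h : c ≠ d) :
    diagCoeff a (d - c) * (jmEigen a d - jmEigen a c) =
      1 + ((a : k) - (a : k)⁻¹) * jmEigen a d := by
  have ha0 : (a : k) ≠ 0 := a.ne_zero
  have h0 := qz_ne_zero ha (sub_ne_zero.2 h.symm)
  have h1 := qz_sub_mul a d
  rw [jmEigen_sub, diagCoeff, jmEigen, mul_left_comm _ _ (qz a d), h1]
  have e : (a : k) ^ (d - c) / qz a (d - c) * ((a : k) ^ (d + c) * qz a (d - c)) =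
      (a : k) ^ d * (a : k) ^ d := by
    rw [← zpow_add₀ ha0]
    have : d + d = d - c + (d + c) := by ring
    rw [this, zpow_add₀ ha0 (d - c)]
    field_simp
  rw [e, zpow_neg]
  field_simp
  ring

end Quantum

/-! ### Young's seminormal form -/

section Seminormal

variable {k : Type u} [Field k] (a : kˣ) (n : ℕ)

variable (k) in
/-- The basis vector of `T`, which is zero if `T` is not standard. -/
noncomputable def tabVec (T : ℕ → ℕ × ℕ) : Tab n →₀ k :=
  open Classical in if h : IsStd n T then Finsupp.single ⟨T, h⟩ 1 else 0

variable {n}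

theorem tabVec_coe (T : Tab n) : tabVec k n T.1 = Finsupp.single T 1 := dif_pos T.2

theorem tabVec_of_not {T : ℕ → ℕ × ℕ} (h : ¬ IsStd n T) : tabVec k n T = 0 := dif_neg h

/-- The diagonal coefficient of `g_{i+1}` at `T`. -/
def tabCoeff (i : ℕ) (T : ℕ → ℕ × ℕ) : k := diagCoeff a (content (T (i + 1)) - content (T i))

variable (n) in
/-- The action of the generator `g_{i+1}` in Young's seminormal form. -/
noncomputable def genOp (i : ℕ) : Module.End k (Tab n →₀ k) :=
  Finsupp.linearCombination k fun T : Tab n =>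
    tabCoeff a i T.1 • tabVec k n T.1 +
      ((a : k) - tabCoeff a i T.1) • tabVec k n (T.1 ∘ Equiv.swap i (i + 1))

variable {a}

/-- The seminormal formula also holds for a nonstandard `T` if its exchange is nonstandard too, both
sides being zero. The relations can then be checked without listing which tableaux of an orbit are
standard. -/
theorem genOp_tabVec {i : ℕ} {T : ℕ → ℕ × ℕ}
    (h : IsStd n (T ∘ Equiv.swap i (i + 1)) → IsStd n T) :
    genOp a n i (tabVec k n T) = tabCoeff a i T • tabVec k n T +
      ((a : k) - tabCoeff a i T) • tabVec k n (T ∘ Equiv.swap i (i + 1)) := by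
  by_cases hT : IsStd n T
  · have : tabVec k n T = Finsupp.single ⟨T, hT⟩ 1 := dif_pos hT
    rw [this, genOp, Finsupp.linearCombination_single, one_smul, ← this]
  · rw [tabVec_of_not hT, tabVec_of_not (mt h hT)]
    simp

theorem tabCoeff_swap (ha : IsGeneric a) {i : ℕ} {T : ℕ → ℕ × ℕ} (hT : IsStd n T) (hi : i + 1 < n) :
    tabCoeff a i (T ∘ Equiv.swap i (i + 1)) = (a : k) - (a : k)⁻¹ - tabCoeff a i T := by
  have h := hT.content_ne (Nat.lt_succ_self i) hi (by omega)
  rw [tabCoeff, tabCoeff, ← diagCoeff_neg ha (sub_ne_zero.2 h.symm)]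
  simp

/-- If the exchange is not standard, the two boxes are adjacent. In a row the coefficient is $a$,
and then the exchanged vector never enters with a nonzero factor; in a column it is $-a^{-1}$ and
both sides vanish. -/
theorem genOp_tabVec_swap (ha : IsGeneric a) {i : ℕ} {T : ℕ → ℕ × ℕ} (hT : IsStd n T) (hi : i + 1 < n) :
    tabCoeff a i T = a ∨ genOp a n i (tabVec k n (T ∘ Equiv.swap i (i + 1))) =
      ((a : k) - (a : k)⁻¹ - tabCoeff a i T) • tabVec k n (T ∘ Equiv.swap i (i + 1)) +
        ((a : k)⁻¹ + tabCoeff a i T) • tabVec k n T := by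
  have e : (T ∘ Equiv.swap i (i + 1)) ∘ Equiv.swap i (i + 1) = T := by
    funext j; simp
  by_cases hs : IsStd n (T ∘ Equiv.swap i (i + 1))
  · right
    rw [genOp_tabVec fun _ => hs, tabCoeff_swap ha hT hi, e]
    congr 2
    ring
  · have hle : T i ≤ T (i + 1) := not_not.1 (mt (hT.swap hi) hs)
    rcases hT.adjacent hi hle with h | h
    · left
      have : content (T (i + 1)) - content (T i) = 1 := by
        rw [h, content, content]; push_cast; ring
      rw [tabCoeff, this, diagCoeff_one]
    · right
      have : content (T (i + 1)) - content (T i) = -1 := by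
        rw [h, content, content]; push_cast; ring
      rw [tabVec_of_not hs, tabCoeff, this, diagCoeff_neg ha one_ne_zero, diagCoeff_one]
      simp

theorem genOp_quad (ha : IsGeneric a) {i : ℕ} (hi : i + 1 < n) :
    genOp a n i * genOp a n i = ((a : k) - (a : k)⁻¹) • genOp a n i + 1 := by
  refine Finsupp.lhom_ext' fun T => LinearMap.ext_ring ?_
  have hb : (a : k) * (a : k)⁻¹ = 1 := mul_inv_cancel₀ a.ne_zero
  change genOp a n i (genOp a n i (Finsupp.single T 1)) =
    ((a : k) - (a : k)⁻¹) • genOp a n i (Finsupp.single T 1) + Finsupp.single T 1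
  rw [← tabVec_coe, genOp_tabVec fun _ => T.2, map_add, map_smul, map_smul,
    genOp_tabVec fun _ => T.2]
  rcases genOp_tabVec_swap ha T.2 hi with h | h
  · rw [h]
    match_scalars <;> first | ring1 | linear_combination hb
  · rw [h]
    match_scalars <;> first | linear_combination hb | ring1

theorem genOp_comm {i j : ℕ} (hij : i + 2 ≤ j) (hj : j + 1 < n) :
    genOp a n i * genOp a n j = genOp a n j * genOp a n i := by
  refine Finsupp.lhom_ext' fun T => LinearMap.ext_ring ?_
  change genOp a n i (genOp a n j (Finsupp.single T 1)) =
    genOp a n j (genOp a n i (Finsupp.single T 1))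
  have hT := T.2
  have s1 : Equiv.swap i (i + 1) j = j := Equiv.swap_apply_of_ne_of_ne (by omega) (by omega)
  have s2 : Equiv.swap i (i + 1) (j + 1) = j + 1 :=
    Equiv.swap_apply_of_ne_of_ne (by omega) (by omega)
  have s3 : Equiv.swap j (j + 1) i = i := Equiv.swap_apply_of_ne_of_ne (by omega) (by omega)
  have s4 : Equiv.swap j (j + 1) (i + 1) = i + 1 :=
    Equiv.swap_apply_of_ne_of_ne (by omega) (by omega)
  have ec : (T.1 ∘ Equiv.swap j (j + 1)) ∘ Equiv.swap i (i + 1) =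
      (T.1 ∘ Equiv.swap i (i + 1)) ∘ Equiv.swap j (j + 1) := by
    funext l
    simp only [Function.comp_apply]
    congr 1
    simp only [Equiv.swap_apply_def]
    split_ifs <;> omega
  have c1 : tabCoeff a i (T.1 ∘ Equiv.swap j (j + 1)) = tabCoeff a i T.1 := by
    simp [tabCoeff, s3, s4]
  have c2 : tabCoeff a j (T.1 ∘ Equiv.swap i (i + 1)) = tabCoeff a j T.1 := by
    simp [tabCoeff, s1, s2]
  -- The two pairs of positions are disjoint, so a violation in one pair survives an exchange in the
  -- other.
  have g1 : IsStd n ((T.1 ∘ Equiv.swap j (j + 1)) ∘ Equiv.swap i (i + 1)) →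
      IsStd n (T.1 ∘ Equiv.swap j (j + 1)) := fun h => hT.swap hj fun hle => by
    rw [ec] at h
    have := h.le_of_le (i := j + 1) (j := j) (by omega) (by omega) (by simpa [s1, s2] using hle)
    omega
  have g2 : IsStd n ((T.1 ∘ Equiv.swap i (i + 1)) ∘ Equiv.swap j (j + 1)) →
      IsStd n (T.1 ∘ Equiv.swap i (i + 1)) := fun h => hT.swap (by omega) fun hle => by
    rw [← ec] at h
    have := h.le_of_le (i := i + 1) (j := i) (by omega) (by omega) (by simpa [s3, s4] using hle)
    omega
  rw [← tabVec_coe, genOp_tabVec fun _ => hT, genOp_tabVec fun _ => hT, map_add, map_add,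
    map_smul, map_smul, map_smul, map_smul, genOp_tabVec fun _ => hT, genOp_tabVec fun _ => hT,
    genOp_tabVec g1, genOp_tabVec g2, c1, c2, ec]
  module

/-- The six vectors stand for the orbit of a tableau under the permutations of three consecutive
entries, and `A`, `B`, `C` are the coefficients for the pairs (first, second), (second, third) and
(first, third). Expanding both sides, every coefficient agrees up to a multiple of the identity `h`.
-/
theorem braid_of_seminormal {V : Type*} [AddCommGroup V] [Module k V] {G H : Module.End k V}
    {v vs vt vst vts w : V} {a b A B C : k} (h : A * B = C * (A + B - (a - b)))
    (hGv : G v = A • v + (a - A) • vs) (hHv : H v = B • v + (a - B) • vt)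
    (hHs : H vs = C • vs + (a - C) • vst) (hGt : G vt = C • vt + (a - C) • vts)
    (hGst : G vst = B • vst + (a - B) • w) (hHts : H vts = A • vts + (a - A) • w)
    (hGs : A = a ∨ G vs = (a - b - A) • vs + (b + A) • v)
    (hHt : B = a ∨ H vt = (a - b - B) • vt + (b + B) • v) :
    G (H (G v)) = H (G (H v)) := by
  -- The vector `vs` enters only with the factor `a - A`, so the degenerate case `A = a` of the
  -- hypothesis does no harm.
  have hGs' : (a - A) • G vs = (a - A) • ((a - b - A) • vs + (b + A) • v) := by
    rcases hGs with e | e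
    · rw [e, sub_self, zero_smul, zero_smul]
    · rw [e]
  have hHt' : (a - B) • H vt = (a - B) • ((a - b - B) • vt + (b + B) • v) := by
    rcases hHt with e | e
    · rw [e, sub_self, zero_smul, zero_smul]
    · rw [e]
  have l : G (H (G v)) = (A * B) • G v + (A * (a - B)) • G vt + C • ((a - A) • G vs) +
      ((a - A) * (a - C)) • G vst := by
    have e : H (G v) = A • (B • v + (a - B) • vt) + (a - A) • (C • vs + (a - C) • vst) := by
      rw [hGv, map_add, map_smul, map_smul, hHv, hHs]
    rw [e]
    simp only [map_add, map_smul]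
    module
  have r : H (G (H v)) = (A * B) • H v + (B * (a - A)) • H vs + C • ((a - B) • H vt) +
      ((a - B) * (a - C)) • H vts := by
    have e : G (H v) = B • (A • v + (a - A) • vs) + (a - B) • (C • vt + (a - C) • vts) := by
      rw [hHv, map_add, map_smul, map_smul, hGv, hGt]
    rw [e]
    simp only [map_add, map_smul]
    module
  rw [l, r, hGs', hHt', hGv, hHv, hGt, hHs, hGst, hHts]
  match_scalars
  · linear_combination (A - B) * h
  all_goals first | ring1 | linear_combination (a - A) * h | linear_combination -(a - B) * h

theorem genOp_braid (ha : IsGeneric a) {i : ℕ} (hi : i + 2 < n) :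
    genOp a n i * genOp a n (i + 1) * genOp a n i =
      genOp a n (i + 1) * genOp a n i * genOp a n (i + 1) := by
  refine Finsupp.lhom_ext' fun T => LinearMap.ext_ring ?_
  change genOp a n i (genOp a n (i + 1) (genOp a n i (Finsupp.single T 1))) =
    genOp a n (i + 1) (genOp a n i (genOp a n (i + 1) (Finsupp.single T 1)))
  have hT := T.2
  set s := Equiv.swap i (i + 1) with hs
  set t := Equiv.swap (i + 1) (i + 1 + 1) with ht
  have s0 : s i = i + 1 := Equiv.swap_apply_left _ _
  have s1 : s (i + 1) = i := Equiv.swap_apply_right _ _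
  have s2 : s (i + 1 + 1) = i + 1 + 1 := Equiv.swap_apply_of_ne_of_ne (by omega) (by omega)
  have t0 : t i = i := Equiv.swap_apply_of_ne_of_ne (by omega) (by omega)
  have t1 : t (i + 1) = i + 1 + 1 := Equiv.swap_apply_left _ _
  have t2 : t (i + 1 + 1) = i + 1 := Equiv.swap_apply_right _ _
  have ec : ((T.1 ∘ s) ∘ t) ∘ s = ((T.1 ∘ t) ∘ s) ∘ t := by
    have e1 : s * t * s = Equiv.swap i (i + 1 + 1) := by
      rw [hs, ht, Equiv.swap_comm i, Equiv.swap_comm (i + 1) (i + 1 + 1),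
        Equiv.swap_mul_swap_mul_swap (by omega) (by omega)]
    have e2 : t * s * t = Equiv.swap i (i + 1 + 1) := by
      rw [hs, ht, Equiv.swap_mul_swap_mul_swap (by omega) (by omega), Equiv.swap_comm]
    exact congrArg (fun f : Equiv.Perm ℕ => T.1 ∘ f) (e1.trans e2.symm)
  have n1 := hT.content_ne (i := i) (j := i + 1) (by omega) (by omega) (by omega)
  have n2 := hT.content_ne (i := i + 1) (j := i + 1 + 1) (by omega) (by omega) (by omega)
  have n3 := hT.content_ne (i := i) (j := i + 1 + 1) (by omega) (by omega) (by omega)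
  have hABC := diagCoeff_mul ha (sub_ne_zero.2 n1.symm) (sub_ne_zero.2 n2.symm)
    (by rw [add_comm, sub_add_sub_cancel]; exact sub_ne_zero.2 n3.symm)
  rw [add_comm (content _ - _), sub_add_sub_cancel] at hABC
  have c1 : tabCoeff a (i + 1) (T.1 ∘ s) =
    diagCoeff a (content (T.1 (i + 1 + 1)) - content (T.1 i)) := by simp [tabCoeff, s1, s2]
  have c2 : tabCoeff a i ((T.1 ∘ s) ∘ t) = tabCoeff a (i + 1) T.1 := by
    simp [tabCoeff, s0, s2, t0, t1]
  have c3 : tabCoeff a i (T.1 ∘ t) =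
    diagCoeff a (content (T.1 (i + 1 + 1)) - content (T.1 i)) := by simp [tabCoeff, t0, t1]
  have c4 : tabCoeff a (i + 1) ((T.1 ∘ t) ∘ s) = tabCoeff a i T.1 := by
    simp [tabCoeff, s1, s2, t0, t2]
  -- Standardness passes to the initial segments of the reduced words $sts$ and $tst$: a comparison
  -- that forbids an earlier exchange would still be violated at the end.
  have g1 : IsStd n ((T.1 ∘ s) ∘ t) → IsStd n (T.1 ∘ s) := fun h => hT.swap (by omega) fun hle => by
    have := h.le_of_le (i := i + 1 + 1) (j := i) (by omega) (by omega) (by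
      simpa [s0, s1, t0, t2] using hle)
    omega
  have g3 : IsStd n ((T.1 ∘ t) ∘ s) → IsStd n (T.1 ∘ t) := fun h => hT.swap (by omega) fun hle => by
    have := h.le_of_le (i := i + 1 + 1) (j := i) (by omega) (by omega) (by
      simpa [s0, s2, t1, t2] using hle)
    omega
  have es (U : ℕ → ℕ × ℕ) : (U ∘ s) ∘ s = U := by funext l; simp [hs]
  have et (U : ℕ → ℕ × ℕ) : (U ∘ t) ∘ t = U := by funext l; simp [ht]
  have g2 : IsStd n (((T.1 ∘ s) ∘ t) ∘ s) → IsStd n ((T.1 ∘ s) ∘ t) := fun h => by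
    rw [← es ((T.1 ∘ s) ∘ t)]
    refine h.swap (by omega) fun hle => ?_
    have := hT.le_of_le (i := i + 1 + 1) (j := i + 1) (by omega) (by omega) (by
      simpa [s0, s1, s2, t0, t1] using hle)
    omega
  have g4 : IsStd n (((T.1 ∘ t) ∘ s) ∘ t) → IsStd n ((T.1 ∘ t) ∘ s) := fun h => by
    rw [← et ((T.1 ∘ t) ∘ s)]
    refine h.swap (by omega) fun hle => ?_
    have := hT.le_of_le (i := i + 1) (j := i) (by omega) (by omega) (by
      simpa [s0, s1, s2, t0, t1, t2] using hle)
    omega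
  have e1 := genOp_tabVec (a := a) g1
  have e2 := genOp_tabVec (a := a) g2
  have e3 := genOp_tabVec (a := a) g3
  have e4 := genOp_tabVec (a := a) g4
  have e5 := genOp_tabVec (a := a) (n := n) (i := i) (T := T.1) fun _ => hT
  have e6 := genOp_tabVec (a := a) (n := n) (i := i + 1) (T := T.1) fun _ => hT
  rw [← hs] at e5 e2 e3
  rw [← ht] at e6 e1 e4
  rw [c1] at e1
  rw [c2] at e2
  rw [c3] at e3
  rw [c4] at e4
  have hA : diagCoeff a (content (T.1 (i + 1)) - content (T.1 i)) = tabCoeff a i T.1 := rfl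
  have hB : diagCoeff a (content (T.1 (i + 1 + 1)) - content (T.1 (i + 1))) =
    tabCoeff a (i + 1) T.1 := rfl
  rw [hA, hB] at hABC
  rw [← tabVec_coe]
  rw [ec] at e2
  exact braid_of_seminormal hABC e5 e6 e1 e3 e2 e4 (genOp_tabVec_swap ha hT (by omega))
    (genOp_tabVec_swap ha hT (by omega))

/-- Young's seminormal representation of `H_n`, on the sum of all irreducible representations. -/
noncomputable def rho (ha : IsGeneric a) (n : ℕ) : Hecke k a n →ₐ[k] Module.End k (Tab n →₀ k) :=
  Hecke.lift (fun i => genOp a n i.1)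
    (fun i j h => by rw [h]; exact genOp_braid ha (by have := j.2; omega))
    (fun i j h => genOp_comm h j.2)
    (fun i => by rw [genOp_quad ha i.2, Units.val_inv_eq_inv_val])

@[simp]
theorem rho_gen (ha : IsGeneric a) (i : {i : ℕ // i + 1 < n}) :
    rho ha n (Hecke.gen i) = genOp a n i.1 := by
  simp [rho]

theorem rho_gen_single (ha : IsGeneric a) (i : {i : ℕ // i + 1 < n}) (T : Tab n) :
    rho ha n (Hecke.gen i) (Finsupp.single T 1) = tabCoeff a i.1 T.1 • Finsupp.single T 1 +
      ((a : k) - tabCoeff a i.1 T.1) • tabVec k n (T.1 ∘ Equiv.swap i.1 (i.1 + 1)) := by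
  rw [rho_gen, ← tabVec_coe, genOp_tabVec fun _ => T.2]

theorem tabVec_swap (T : Tab n) {i : ℕ} (hi : i + 1 < n) :
    (T.1 i ≤ T.1 (i + 1) ∧ tabVec k n (T.1 ∘ Equiv.swap i (i + 1)) = 0) ∨
    ∃ h : ¬ T.1 i ≤ T.1 (i + 1),
      tabVec k n (T.1 ∘ Equiv.swap i (i + 1)) = Finsupp.single (T.swap hi h) 1 := by
  by_cases h : T.1 i ≤ T.1 (i + 1)
  · exact Or.inl ⟨h, tabVec_of_not fun hs => IsStd.not_le_of_swap hi hs h⟩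
  · exact Or.inr ⟨h, tabVec_coe (T.swap hi h)⟩

/-- The representation preserves shapes. -/
theorem rho_apply_eq_zero (ha : IsGeneric a) (x : Hecke k a n) {T R : Tab n}
    (h : R.shape ≠ T.shape) : rho ha n x (Finsupp.single T 1) R = 0 := by
  let W (l : YoungDiagram) : Submodule k (Tab n →₀ k) := Finsupp.supported k k {R | R.shape = l}
  have key (l : YoungDiagram) : ∀ v ∈ W l, rho ha n x v ∈ W l := by
    induction x using Hecke.induction_on with
    | algebraMap c =>
      intro v hv
      rw [AlgHom.commutes]
      exact (W l).smul_mem c hv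
    | mul x y hx hy =>
      intro v hv
      rw [map_mul]
      exact hx _ (hy v hv)
    | add x y hx hy =>
      intro v hv
      rw [map_add]
      exact add_mem (hx v hv) (hy v hv)
    | gen i =>
      intro v hv
      have hW : W l = Submodule.span k ((fun R => Finsupp.single R (1 : k)) '' {R | R.shape = l}) :=
        Finsupp.supported_eq_span_single k _
      have : W l ≤ (W l).comap (rho ha n (Hecke.gen i)) := by
        conv_lhs => rw [hW]
        rw [Submodule.span_le]
        rintro _ ⟨Q, hQ, rfl⟩
        change rho ha n (Hecke.gen i) (Finsupp.single Q 1) ∈ W l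
        rw [rho_gen_single]
        refine add_mem ((W l).smul_mem _ (Finsupp.single_mem_supported k _ hQ))
          ((W l).smul_mem _ ?_)
        rcases tabVec_swap (k := k) Q i.2 with ⟨_, e⟩ | ⟨h, e⟩ <;> rw [e]
        · exact zero_mem _
        · exact Finsupp.single_mem_supported k _ ((Q.shape_swap i.2 h).trans hQ)
      exact this hv
  have hT := key T.shape _ (Finsupp.single_mem_supported k (1 : k) (rfl : T.shape = T.shape))
  by_contra h0
  exact h ((Finsupp.mem_supported k _).1 hT (Finsupp.mem_support_iff.2 h0))

variable (k) in
/-- The linear map that replaces the first boxes of `R`. -/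
noncomputable def graftMap {m p : ℕ} (h : m ≤ p) (R : Tab p) : (Tab m →₀ k) →ₗ[k] (Tab p →₀ k) :=
  Finsupp.linearCombination k fun Q : Tab m =>
    open Classical in if hs : Q.shape = (R.trunc h).shape then Finsupp.single (Q.graft h R hs) 1
      else 0

theorem graftMap_single {m p : ℕ} (h : m ≤ p) (R : Tab p) {Q : Tab m}
    (hs : Q.shape = (R.trunc h).shape) :
    graftMap k h R (Finsupp.single Q 1) = Finsupp.single (Q.graft h R hs) 1 := by
  rw [graftMap, Finsupp.linearCombination_single, one_smul, dif_pos hs]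

theorem graftMap_single_of_ne {m p : ℕ} (h : m ≤ p) (R : Tab p) {Q : Tab m}
    (hs : Q.shape ≠ (R.trunc h).shape) : graftMap k h R (Finsupp.single Q 1) = 0 := by
  rw [graftMap, Finsupp.linearCombination_single, one_smul, dif_neg hs]

/-- The subalgebra $H_m$ only sees the first $m$ boxes. With the later boxes frozen as in `R`, the
tableaux span a copy of the representation of the truncated shape; this is the branching rule in the
seminormal basis. -/
theorem rho_shift_graftMap (ha : IsGeneric a) {m p : ℕ} (h : m ≤ p) (h' : 0 + m ≤ p) (R : Tab p)
    (x : Hecke k a m) (v : Tab m →₀ k) :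
    rho ha p (Hecke.shift 0 h' x) (graftMap k h R v) = graftMap k h R (rho ha m x v) := by
  induction x using Hecke.induction_on generalizing v with
  | algebraMap c =>
    rw [AlgHom.commutes, AlgHom.commutes, AlgHom.commutes]
    exact (map_smul (graftMap k h R) c v).symm
  | mul x y hx hy =>
    rw [map_mul, map_mul, map_mul]
    change rho ha p _ (rho ha p _ _) = _
    rw [hy, hx]
    rfl
  | add x y hx hy =>
    rw [map_add, map_add, map_add, LinearMap.add_apply, LinearMap.add_apply, hx, hy, map_add]
  | gen i =>
    obtain ⟨i, hi⟩ := i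
    have : rho ha p (Hecke.shift 0 h' (Hecke.gen ⟨i, hi⟩)) ∘ₗ graftMap k h R =
        graftMap k h R ∘ₗ rho ha m (Hecke.gen ⟨i, hi⟩) := by
      refine Finsupp.lhom_ext' fun Q => LinearMap.ext_ring ?_
      change rho ha p (Hecke.shift 0 h' (Hecke.gen ⟨i, hi⟩)) (graftMap k h R (Finsupp.single Q 1))
        = graftMap k h R (rho ha m (Hecke.gen ⟨i, hi⟩) (Finsupp.single Q 1))
      rw [Hecke.shift_gen]
      simp only [zero_add]
      by_cases hs : Q.shape = (R.trunc h).shape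
      · rw [graftMap_single h R hs, rho_gen_single, rho_gen_single, map_add, map_smul, map_smul,
          graftMap_single h R hs]
        have e1 : (Q.graft h R hs).1 i = Q.1 i := Tab.graft_apply_lt h hs (by omega)
        have e2 : (Q.graft h R hs).1 (i + 1) = Q.1 (i + 1) := Tab.graft_apply_lt h hs hi
        have ec : tabCoeff a i (Q.graft h R hs).1 = tabCoeff a i Q.1 := by
          rw [tabCoeff, tabCoeff, e1, e2]
        rw [ec]
        congr 2
        rcases tabVec_swap (k := k) Q hi with ⟨hle, e⟩ | ⟨hn, e⟩
        · rw [e, map_zero]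
          refine tabVec_of_not fun hst => IsStd.not_le_of_swap (i := i) (by omega) hst ?_
          rwa [e1, e2]
        · rw [e, graftMap_single h R ((Q.shape_swap hi hn).trans hs), ← tabVec_coe]
          congr 1
          funext j
          rw [Function.comp_apply]
          by_cases hj : j < m
          · rw [Tab.graft_apply_lt h _ hj, Tab.graft_apply_lt]
            · rfl
            · rw [Equiv.swap_apply_def]; split_ifs <;> omega
          · rw [Equiv.swap_apply_of_ne_of_ne (show j ≠ i by omega) (show j ≠ i + 1 by omega),
              Tab.graft_apply_ge h _ (by omega), Tab.graft_apply_ge h _ (by omega)]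
      · rw [graftMap_single_of_ne h R hs, rho_gen_single, map_add, map_smul, map_smul,
          graftMap_single_of_ne h R hs, map_zero, smul_zero, zero_add]
        rcases tabVec_swap (k := k) Q hi with ⟨hle, e⟩ | ⟨hn, e⟩
        · rw [e, map_zero, smul_zero]
        · rw [e, graftMap_single_of_ne h R (by rwa [Q.shape_swap hi hn]), smul_zero]
    exact DFunLike.congr_fun this v

/-- The action of `H_m ⊆ H_p` on the first boxes. -/
theorem rho_shift_single (ha : IsGeneric a) {m p : ℕ} (h : m ≤ p) (h' : 0 + m ≤ p) (R : Tab p)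
    (x : Hecke k a m) : rho ha p (Hecke.shift 0 h' x) (Finsupp.single R 1) =
      graftMap k h R (rho ha m x (Finsupp.single (R.trunc h) 1)) := by
  rw [← rho_shift_graftMap ha h h', graftMap_single h R rfl, Tab.graft_trunc]

/-! ### Jucys–Murphy elements -/

variable (k a n) in
/-- The Jucys–Murphy elements. -/
noncomputable def jm : ℕ → Hecke k a n
  | 0 => 0
  | i + 1 => if h : i + 1 < n then
      Hecke.gen ⟨i, h⟩ * jm i * Hecke.gen ⟨i, h⟩ + Hecke.gen ⟨i, h⟩ else 0

/-- Induction along $J_{i+1}=g_iJ_ig_i+g_i$. The vector $g_iT$ involves only $T$ and $sT$, on which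
$J_i$ is already known to be diagonal. -/
theorem rho_jm (ha : IsGeneric a) {i : ℕ} (hi : i < n) (T : Tab n) :
    rho ha n (jm k a n i) (Finsupp.single T 1) =
      jmEigen a (content (T.1 i)) • Finsupp.single T 1 := by
  induction i generalizing T with
  | zero =>
    rw [jm, map_zero, T.2.apply_zero]
    simp [content, jmEigen]
  | succ i ih =>
    have hc := T.2.content_ne (Nat.lt_succ_self i) hi (by omega)
    have h1 := diagCoeff_mul_jmEigen_sub ha hc
    have hb : (a : k) * (a : k)⁻¹ = 1 := mul_inv_cancel₀ a.ne_zero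
    rw [jm, dif_pos hi, map_add, map_mul, map_mul]
    change rho ha n _ (rho ha n (jm k a n i) (rho ha n (Hecke.gen ⟨i, hi⟩) (Finsupp.single T 1))) +
      rho ha n (Hecke.gen ⟨i, hi⟩) (Finsupp.single T 1) = _
    have hq := DFunLike.congr_fun (genOp_quad ha hi) (Finsupp.single T 1)
    change genOp a n i (genOp a n i (Finsupp.single T 1)) =
      ((a : k) - (a : k)⁻¹) • genOp a n i (Finsupp.single T 1) + Finsupp.single T 1 at hq
    have hg := rho_gen_single ha ⟨i, hi⟩ T
    rw [rho_gen] at hg ⊢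
    simp only at hg ⊢
    -- With $\lambda$ the eigenvalue claimed for $J_{i+1}$, this is
    -- $J_ig_iT=\lambda(g_i-(a-a^{-1}))T-T$. Applying $g_i$ and using $g_i(g_i-(a-a^{-1}))=1$ leaves
    -- $\lambda T-g_iT$.
    have hJ : rho ha n (jm k a n i) (genOp a n i (Finsupp.single T 1)) =
        jmEigen a (content (T.1 (i + 1))) • (genOp a n i (Finsupp.single T 1) -
          ((a : k) - (a : k)⁻¹) • Finsupp.single T 1) - Finsupp.single T 1 := by
      have h2 : tabCoeff a i T.1 * jmEigen a (content (T.1 i)) =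
          jmEigen a (content (T.1 (i + 1))) * (tabCoeff a i T.1 - ((a : k) - (a : k)⁻¹)) - 1 := by
        rw [tabCoeff]
        linear_combination -h1
      rw [hg, map_add, map_smul, map_smul, ih (by omega)]
      rcases tabVec_swap (k := k) T hi with ⟨_, e⟩ | ⟨hn, e⟩
      · rw [e, map_zero]
        match_scalars
        linear_combination h2
      · rw [e, ih (by omega)]
        have e' : (T.swap hi hn).1 i = T.1 (i + 1) := by simp [Tab.swap]
        rw [e']
        match_scalars
        · linear_combination h2
        · ring
    rw [hJ, map_sub, map_smul, map_sub, map_smul, hq]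
    module

end Seminormal
/-! ### The dimension of `H_n` is at most `n!` -/

section Dimension

variable {k : Type u} [Field k] {a : kˣ} {n : ℕ}

variable (k a n) in
/-- The generator `g_{i+1}` for any index, zero out of range. -/
noncomputable def natGen (i : ℕ) : Hecke k a n := if h : i + 1 < n then Hecke.gen ⟨i, h⟩ else 0

theorem natGen_of_lt {i : ℕ} (h : i + 1 < n) : natGen k a n i = Hecke.gen ⟨i, h⟩ := dif_pos h

theorem natGen_braid {i : ℕ} (h : i + 2 < n) : natGen k a n i * natGen k a n (i + 1) *
    natGen k a n i = natGen k a n (i + 1) * natGen k a n i * natGen k a n (i + 1) := by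
  rw [natGen_of_lt (by omega), natGen_of_lt (by omega)]
  exact Hecke.gen_braid _ _ rfl

theorem natGen_comm {i j : ℕ} (h : i + 2 ≤ j) (hj : j + 1 < n) :
    natGen k a n i * natGen k a n j = natGen k a n j * natGen k a n i := by
  rw [natGen_of_lt (by omega), natGen_of_lt (by omega)]
  exact Hecke.gen_comm _ _ h

theorem natGen_quad {i : ℕ} (h : i + 1 < n) : natGen k a n i * natGen k a n i =
    ((a : k) - (↑a⁻¹ : k)) • natGen k a n i + 1 := by
  rw [natGen_of_lt h]
  exact Hecke.gen_quad _

variable (k a n) in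
/-- The coset representatives `g_n g_{n-1} ⋯ g_{n-d+1}` of `H_n` in `H_{n+1}`. -/
noncomputable def cosetRep : ℕ → Hecke k a (n + 1)
  | 0 => 1
  | d + 1 => cosetRep d * natGen k a (n + 1) (n - 1 - d)

theorem natGen_mul_cosetRep {i d : ℕ} (h : i + d + 1 < n) :
    natGen k a (n + 1) i * cosetRep k a n d = cosetRep k a n d * natGen k a (n + 1) i := by
  induction d with
  | zero => rw [cosetRep, one_mul, mul_one]
  | succ d ih =>
    rw [cosetRep, ← mul_assoc, ih (by omega), mul_assoc, mul_assoc,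
      natGen_comm (i := i) (by omega) (by omega)]

/-- Inside the descending word, the braid relation turns $g_{i+1}g_i\cdot g_{i+1}$ into $g_i\cdot
g_{i+1}g_i$. The new factor on the left commutes with the letters before it. -/
theorem cosetRep_mul_natGen {i d : ℕ} (hd : d ≤ n) (h : n < i + 1 + d) (hi : i + 1 < n) :
    cosetRep k a n d * natGen k a (n + 1) (i + 1) =
      natGen k a (n + 1) i * cosetRep k a n d := by
  induction d with
  | zero => omega
  | succ d ih =>
    by_cases hc : n < i + 1 + d
    · rw [cosetRep, mul_assoc, natGen_comm (i := n - 1 - d) (by omega) (by omega), ← mul_assoc,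
        ih (by omega) hc, mul_assoc]
    · obtain ⟨e, rfl⟩ : ∃ e, d = e + 1 := ⟨d - 1, by omega⟩
      have e1 : n - 1 - e = i + 1 := by omega
      have e2 : n - 1 - (e + 1) = i := by omega
      rw [cosetRep, cosetRep, e1, e2, mul_assoc, mul_assoc, ← mul_assoc (natGen k a (n + 1) (i + 1)),
        ← natGen_braid (by omega), ← mul_assoc, ← mul_assoc, ← natGen_mul_cosetRep (by omega)]
      simp only [mul_assoc]

variable (k a n) in
/-- The linear map `(h_d) ↦ ∑ h_d w_d`. -/
noncomputable def cosetMap : (Fin (n + 1) → Hecke k a n) →ₗ[k] Hecke k a (n + 1) :=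
  ∑ d : Fin (n + 1), (LinearMap.mulRight k (cosetRep k a n d)) ∘ₗ
    (Hecke.shift 0 (by omega : 0 + n ≤ n + 1)).toLinearMap ∘ₗ LinearMap.proj d

theorem shift_mul_cosetRep_mem (x : Hecke k a n) {d : ℕ} (hd : d ≤ n) :
    Hecke.shift 0 (by omega : 0 + n ≤ n + 1) x * cosetRep k a n d ∈
      LinearMap.range (cosetMap k a n) := by
  refine ⟨Pi.single ⟨d, by omega⟩ x, ?_⟩
  rw [cosetMap, LinearMap.sum_apply, Finset.sum_eq_single ⟨d, by omega⟩]
  · simp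
  · intro e _ he
    simp [Pi.single_eq_of_ne he]
  · simp

/-- The sum of the subspaces $H_nw_d$ contains $1$ and is stable under right multiplication by
generators. A generator commutes with $w_d$ into $H_n$, lengthens $w_d$, repeats its last letter and
is reduced by the quadratic relation, or passes to the left with its index lowered. -/
theorem cosetMap_surjective : Function.Surjective (cosetMap k a n) := by
  have hgen (i : ℕ) (hi : i + 1 < n) : natGen k a (n + 1) i =
      Hecke.shift 0 (by omega : 0 + n ≤ n + 1) (Hecke.gen ⟨i, hi⟩) := by
    rw [natGen_of_lt (by omega), Hecke.shift_gen]
    simp only [zero_add]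
  have key (x : Hecke k a n) (d : ℕ) (hd : d ≤ n) (i : ℕ) (hi : i < n) :
      Hecke.shift 0 (by omega : 0 + n ≤ n + 1) x * cosetRep k a n d * natGen k a (n + 1) i ∈
        LinearMap.range (cosetMap k a n) := by
    rw [mul_assoc]
    rcases lt_trichotomy (i + d + 1) n with h | h | h
    · rw [← natGen_mul_cosetRep h, hgen i (by omega), ← mul_assoc, ← map_mul]
      exact shift_mul_cosetRep_mem _ hd
    · have : cosetRep k a n d * natGen k a (n + 1) i = cosetRep k a n (d + 1) := by
        rw [cosetRep]
        congr 2
        omega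
      rw [this]
      exact shift_mul_cosetRep_mem _ (by omega)
    · obtain ⟨e, rfl⟩ : ∃ e, d = e + 1 := ⟨d - 1, by omega⟩
      by_cases hc : i + e + 1 = n
      · have e1 : n - 1 - e = i := by omega
        have : cosetRep k a n (e + 1) * natGen k a (n + 1) i =
            ((a : k) - (↑a⁻¹ : k)) • cosetRep k a n (e + 1) + cosetRep k a n e := by
          rw [cosetRep, e1, mul_assoc, natGen_quad (by omega), mul_add, mul_smul_comm, mul_one]
        rw [this, mul_add, mul_smul_comm]
        exact add_mem (Submodule.smul_mem _ _ (shift_mul_cosetRep_mem _ hd))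
          (shift_mul_cosetRep_mem _ (by omega))
      · obtain ⟨j, rfl⟩ : ∃ j, i = j + 1 := ⟨i - 1, by omega⟩
        rw [cosetRep_mul_natGen hd (by omega) (by omega), hgen j (by omega), ← mul_assoc,
          ← map_mul]
        exact shift_mul_cosetRep_mem _ hd
  have hmul (y : Hecke k a (n + 1)) : ∀ x ∈ LinearMap.range (cosetMap k a n),
      x * y ∈ LinearMap.range (cosetMap k a n) := by
    induction y using Hecke.induction_on with
    | algebraMap c =>
      intro x hx
      rw [← Algebra.commutes, ← Algebra.smul_def]
      exact Submodule.smul_mem _ _ hx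
    | mul y z hy hz =>
      intro x hx
      rw [← mul_assoc]
      exact hz _ (hy _ hx)
    | add y z hy hz =>
      intro x hx
      rw [mul_add]
      exact add_mem (hy _ hx) (hz _ hx)
    | gen i =>
      rintro _ ⟨f, rfl⟩
      rw [cosetMap, LinearMap.sum_apply, Finset.sum_mul]
      refine sum_mem fun d _ => ?_
      have := key (f d) d (by omega) i.1 (by omega)
      rwa [natGen_of_lt i.2] at this
  intro y
  have h1 := shift_mul_cosetRep_mem (1 : Hecke k a n) (Nat.zero_le n)
  rw [map_one, one_mul, cosetRep] at h1
  have := hmul y 1 h1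
  rwa [one_mul] at this

theorem algebraMap_surjective_zero : Function.Surjective (algebraMap k (Hecke k a 0)) := by
  intro x
  induction x using Hecke.induction_on with
  | algebraMap c => exact ⟨c, rfl⟩
  | gen i => exact absurd i.2 (by omega)
  | mul x y hx hy =>
    obtain ⟨c, rfl⟩ := hx
    obtain ⟨d, rfl⟩ := hy
    exact ⟨c * d, map_mul _ _ _⟩
  | add x y hx hy =>
    obtain ⟨c, rfl⟩ := hx
    obtain ⟨d, rfl⟩ := hy
    exact ⟨c + d, map_add _ _ _⟩

variable (k a n) in
theorem finite_and_finrank_le :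
    Module.Finite k (Hecke k a n) ∧ Module.finrank k (Hecke k a n) ≤ n.factorial := by
  induction n with
  | zero =>
    have hs : Function.Surjective (Algebra.linearMap k (Hecke k a 0)) := algebraMap_surjective_zero
    refine ⟨Module.Finite.of_surjective _ hs, ?_⟩
    have := LinearMap.finrank_le_finrank_of_surjective (f := Algebra.linearMap k (Hecke k a 0)) hs
    simpa using this
  | succ n ih =>
    have := ih.1
    refine ⟨Module.Finite.of_surjective _ (cosetMap_surjective (k := k) (a := a) (n := n)), ?_⟩
    have h := LinearMap.finrank_le_finrank_of_surjective (cosetMap_surjective (k := k) (a := a) (n := n))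
    rw [Module.finrank_pi_fintype, Finset.sum_const, Finset.card_univ, Fintype.card_fin,
      smul_eq_mul] at h
    exact h.trans (Nat.mul_le_mul_left _ ih.2)

end Dimension

/-! ### Counting standard tableaux -/

section Counting

open Tab

/-- The Young diagrams with `n` boxes. -/
noncomputable def diagrams (n : ℕ) : Finset YoungDiagram :=
  open Classical in Finset.univ.image (shape : Tab n → YoungDiagram)

theorem mem_diagrams {n : ℕ} {l : YoungDiagram} : l ∈ diagrams n ↔ l.card = n := by
  classical
  rw [diagrams, Finset.mem_image]
  constructor
  · rintro ⟨T, -, rfl⟩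
    exact T.card_shape
  · rintro rfl
    obtain ⟨T, hT⟩ := exists_shape l
    exact ⟨T, Finset.mem_univ _, hT⟩

/-- The diagrams obtained by adding a box. -/
noncomputable def upSet (l : YoungDiagram) : Finset YoungDiagram :=
  @Finset.filter _ (l ≤ ·) (Classical.decPred _) (diagrams (l.card + 1))

/-- The diagrams obtained by removing a box. -/
noncomputable def downSet (m : YoungDiagram) : Finset YoungDiagram :=
  @Finset.filter _ (fun l => l ≤ m ∧ l.card + 1 = m.card) (Classical.decPred _)
    (diagrams (m.card - 1))

theorem mem_upSet {l m : YoungDiagram} : m ∈ upSet l ↔ l ≤ m ∧ m.card = l.card + 1 := by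
  classical
  rw [upSet, Finset.mem_filter, mem_diagrams, and_comm]

theorem mem_downSet {l m : YoungDiagram} : l ∈ downSet m ↔ l ≤ m ∧ m.card = l.card + 1 := by
  unfold downSet
  simp only [Finset.mem_filter, mem_diagrams]
  constructor
  · rintro ⟨-, h, h'⟩
    exact ⟨h, h'.symm⟩
  · rintro ⟨h, h'⟩
    exact ⟨by omega, h, h'.symm⟩

theorem card_le_of_le {l m : YoungDiagram} (h : l ≤ m) : l.card ≤ m.card :=
  Finset.card_le_card (YoungDiagram.cells_subset_iff.2 h)

theorem eq_of_le_of_card {l m : YoungDiagram} (h : l ≤ m) (hc : m.card ≤ l.card) : l = m :=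
  YoungDiagram.ext (Finset.eq_of_subset_of_card_le (YoungDiagram.cells_subset_iff.2 h) hc)

theorem card_sup_add_card_inf (l m : YoungDiagram) :
    (l ⊔ m).card + (l ⊓ m).card = l.card + m.card := by
  classical
  change (l ⊔ m).cells.card + (l ⊓ m).cells.card = _
  rw [YoungDiagram.cells_sup, YoungDiagram.cells_inf]
  exact Finset.card_union_add_card_inter _ _

/-- A tableau with one box more is given by its truncation and its shape. -/
theorem sum_shape_succ {n : ℕ} (F : YoungDiagram → ℕ) :
    ∑ T : Tab (n + 1), F T.shape = ∑ Q : Tab n, ∑ m ∈ upSet Q.shape, F m := by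
  classical
  rw [Finset.sum_sigma']
  refine Finset.sum_bij (fun T _ => ⟨T.trunc (Nat.le_succ n), T.shape⟩) (fun T _ => ?_)
    (fun T _ T' _ h => ?_) (fun x hx => ?_) (fun T _ => rfl)
  · simp only [Finset.mem_sigma, Finset.mem_univ, true_and, mem_upSet]
    exact ⟨T.shape_trunc_le _, by rw [card_shape, card_shape]⟩
  · simp only [Sigma.mk.injEq, heq_eq_eq] at h
    obtain ⟨h1, h2⟩ := h
    have hlt (i : ℕ) (hi : i < n) : T.1 i = T'.1 i := by
      rw [← trunc_apply (Nat.le_succ n) T hi, h1, trunc_apply _ _ hi]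
    refine Tab.ext fun i hi => ?_
    rcases (Nat.lt_succ_iff_lt_or_eq.1 hi) with h | rfl
    · exact hlt i h
    · have := T.apply_mem_shape hi
      rw [h2] at this
      obtain ⟨j, hj, e⟩ := mem_shape.1 this
      rcases (Nat.lt_succ_iff_lt_or_eq.1 hj) with h | rfl
      · rw [← hlt j h] at e
        have := T.2.inj j i hj hi e
        omega
      · exact e.symm
  · obtain ⟨Q, m⟩ := x
    simp only [Finset.mem_sigma, Finset.mem_univ, true_and, mem_upSet] at hx
    obtain ⟨R, h1, h2⟩ := exists_extension (Nat.le_succ n) (by rw [hx.2, card_shape]) Q hx.1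
    exact ⟨R, Finset.mem_univ _, by rw [h1, h2]⟩

/-- The number of standard tableaux of a given shape. -/
noncomputable def tabCount (l : YoungDiagram) : ℕ :=
  ∑ T : Tab l.card, open Classical in if T.shape = l then 1 else 0

theorem tabCount_eq {n : ℕ} {l : YoungDiagram} (h : l.card = n) :
    tabCount l = ∑ T : Tab n, open Classical in if T.shape = l then 1 else 0 := by
  subst h
  rfl

theorem sum_tab {n : ℕ} (F : YoungDiagram → ℕ) :
    ∑ T : Tab n, F T.shape = ∑ l ∈ diagrams n, tabCount l * F l := by
  classical
  rw [← Finset.sum_fiberwise_of_maps_to (s := Finset.univ) (t := diagrams n)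
    (g := shape) (fun T _ => mem_diagrams.2 T.card_shape)]
  refine Finset.sum_congr rfl fun l hl => ?_
  rw [tabCount_eq (mem_diagrams.1 hl), Finset.sum_mul, Finset.sum_filter]
  refine Finset.sum_congr rfl fun T _ => ?_
  split_ifs with h
  · rw [h, one_mul]
  · rw [zero_mul]

/-- Removing the last box of a standard tableau leaves a standard tableau of one of the smaller
shapes. -/
theorem tabCount_eq_sum_downSet {m : YoungDiagram} (hm : m.card ≠ 0) :
    tabCount m = ∑ l ∈ downSet m, tabCount l := by
  classical
  obtain ⟨n, hn⟩ := Nat.exists_eq_succ_of_ne_zero hm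
  rw [tabCount_eq hn, sum_shape_succ (fun l => if l = m then 1 else 0),
    sum_tab (fun l => ∑ m' ∈ upSet l, if m' = m then 1 else 0), downSet, Finset.sum_filter]
  rw [hn, Nat.succ_sub_one]
  refine Finset.sum_congr rfl fun l hl => ?_
  rw [mem_diagrams] at hl
  rw [Finset.sum_ite_eq']
  simp only [mem_upSet, hn, hl, mul_ite, mul_one, mul_zero]

/-- A box can be added in row $0$ and in the row below each removable box. Only the inequality is
needed. -/
theorem card_downSet_lt_card_upSet (l : YoungDiagram) :
    (downSet l).card + 1 ≤ (upSet l).card := by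
  classical
  -- The rows whose last box is removable.
  let R : Finset ℕ := (Finset.range (l.colLen 0)).filter fun i => l.rowLen (i + 1) < l.rowLen i
  have hR (i : ℕ) : i ∈ R ↔ l.rowLen (i + 1) < l.rowLen i := by
    rw [Finset.mem_filter, Finset.mem_range, and_iff_right_iff_imp, ← YoungDiagram.mem_iff_lt_colLen,
      YoungDiagram.mem_iff_lt_rowLen]
    omega
  have hdown : (downSet l).card ≤ R.card := by
    have key : ∀ κ ∈ downSet l, ∃ i ∈ R, l.cells \ κ.cells = {(i, l.rowLen i - 1)} := by
      intro κ hκ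
      obtain ⟨hle, hc⟩ := mem_downSet.1 hκ
      have h1 : (l.cells \ κ.cells).card = 1 := by
        rw [Finset.card_sdiff_of_subset (YoungDiagram.cells_subset_iff.2 hle)]
        change l.card - κ.card = 1
        omega
      obtain ⟨⟨i, j⟩, hb⟩ := Finset.card_eq_one.1 h1
      have hmem (c : ℕ × ℕ) : c ∈ l ∧ c ∉ κ ↔ c = (i, j) := by
        rw [← Finset.mem_singleton (b := c), ← hb, Finset.mem_sdiff, YoungDiagram.mem_cells,
          YoungDiagram.mem_cells]
      obtain ⟨hbl, hbκ⟩ := (hmem (i, j)).2 rfl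
      have k1 : (i, j + 1) ∉ l := fun h => by
        by_cases h' : (i, j + 1) ∈ κ
        · exact hbκ (κ.up_left_mem le_rfl (Nat.le_succ j) h')
        · have := (hmem _).1 ⟨h, h'⟩
          simp at this
      have k2 : (i + 1, j) ∉ l := fun h => by
        by_cases h' : (i + 1, j) ∈ κ
        · exact hbκ (κ.up_left_mem (Nat.le_succ i) le_rfl h')
        · have := (hmem _).1 ⟨h, h'⟩
          simp at this
      rw [YoungDiagram.mem_iff_lt_rowLen] at hbl k1 k2
      have e : l.rowLen i - 1 = j := by omega
      exact ⟨i, (hR i).2 (by omega), by rw [hb, e]⟩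
    choose! f hf hf' using key
    refine Finset.card_le_card_of_injOn f (fun κ hκ => hf κ hκ) fun κ hκ κ' hκ' h => ?_
    have e := (hf' κ hκ).trans (h ▸ (hf' κ' hκ').symm)
    apply YoungDiagram.ext
    rw [← Finset.sdiff_sdiff_eq_self (YoungDiagram.cells_subset_iff.2 (mem_downSet.1 hκ).1), e,
      Finset.sdiff_sdiff_eq_self (YoungDiagram.cells_subset_iff.2 (mem_downSet.1 hκ').1)]
  -- Row $0$ and the rows just below those in `R`; in each of them a box can be added.
  let A : Finset ℕ := insert 0 (R.image Nat.succ)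
  have hA : A.card = R.card + 1 := by
    rw [Finset.card_insert_of_notMem (by simp), Finset.card_image_of_injective _ Nat.succ_injective]
  have hup : A.card ≤ (upSet l).card := by
    have key : ∀ i ∈ A, ∃ m ∈ upSet l, m.cells = insert (i, l.rowLen i) l.cells := by
      intro i hi
      have hnot : (i, l.rowLen i) ∉ l := by rw [YoungDiagram.mem_iff_lt_rowLen]; omega
      refine ⟨⟨insert (i, l.rowLen i) l.cells, ?_⟩, ?_, rfl⟩
      · rintro b ⟨r, c⟩ hcb hb
        rw [Finset.coe_insert, Set.mem_insert_iff] at hb ⊢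
        rcases hb with rfl | hb
        · obtain ⟨h1, h2⟩ := Prod.mk_le_mk.1 hcb
          by_cases hr : r = i
          · subst hr
            rcases h2.eq_or_lt with rfl | h2
            · exact Or.inl rfl
            · exact Or.inr (YoungDiagram.mem_iff_lt_rowLen.2 h2)
          · right
            rw [Finset.mem_insert, Finset.mem_image] at hi
            rcases hi with rfl | ⟨j, hj, rfl⟩
            · omega
            · have h3 := (hR j).1 hj
              have h4 := l.rowLen_anti r j (by omega)
              exact YoungDiagram.mem_iff_lt_rowLen.2 (by simp only [Nat.succ_eq_add_one] at h2; omega)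
        · exact Or.inr (l.isLowerSet hcb hb)
      · refine mem_upSet.2 ⟨?_, ?_⟩
        · rw [← YoungDiagram.cells_subset_iff]
          exact Finset.subset_insert _ _
        · exact Finset.card_insert_of_notMem hnot
    choose! f hf hf' using key
    refine Finset.card_le_card_of_injOn f (fun i hi => hf i hi) fun i hi j hj h => ?_
    have e := (hf' i hi).symm.trans ((congrArg YoungDiagram.cells h).trans (hf' j hj))
    have : (i, l.rowLen i) ∈ insert (j, l.rowLen j) l.cells := e ▸ Finset.mem_insert_self _ _
    rw [Finset.mem_insert, YoungDiagram.mem_cells, YoungDiagram.mem_iff_lt_rowLen] at this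
    rcases this with h | h
    · exact congrArg Prod.fst h
    · omega
  omega

/-- This is the commutation of the up and down operators on Young's lattice. A diagram
$\kappa\ne\lambda$ reached by going up and then down is also reached by going down and then up,
through $\lambda\sqcap\kappa$ in place of $\lambda\sqcup\kappa$; only the terms with
$\kappa=\lambda$ differ. -/
theorem sum_upSet_downSet (f : YoungDiagram → ℕ) (l : YoungDiagram) :
    ∑ m ∈ upSet l, ∑ κ ∈ downSet m, f κ + (downSet l).card * f l =
      (upSet l).card * f l + ∑ ν ∈ downSet l, ∑ κ ∈ upSet ν, f κ := by
  classical
  have h1 : ∑ m ∈ upSet l, ∑ κ ∈ downSet m, f κ =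
      (upSet l).card * f l + ∑ m ∈ upSet l, ∑ κ ∈ (downSet m).erase l, f κ := by
    rw [← smul_eq_mul, ← Finset.sum_const, ← Finset.sum_add_distrib]
    refine Finset.sum_congr rfl fun m hm => ?_
    rw [Finset.add_sum_erase _ _ (mem_downSet.2 (mem_upSet.1 hm))]
  have h2 : ∑ ν ∈ downSet l, ∑ κ ∈ upSet ν, f κ =
      (downSet l).card * f l + ∑ ν ∈ downSet l, ∑ κ ∈ (upSet ν).erase l, f κ := by
    rw [← smul_eq_mul, ← Finset.sum_const, ← Finset.sum_add_distrib]
    refine Finset.sum_congr rfl fun m hm => ?_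
    rw [Finset.add_sum_erase _ _ (mem_upSet.2 (mem_downSet.1 hm))]
  have h3 : ∑ m ∈ upSet l, ∑ κ ∈ (downSet m).erase l, f κ =
      ∑ ν ∈ downSet l, ∑ κ ∈ (upSet ν).erase l, f κ := by
    rw [Finset.sum_sigma', Finset.sum_sigma']
    have sup_eq {m κ : YoungDiagram} (hl : l ≤ m) (hκ : κ ≤ m) (hne : κ ≠ l)
        (c1 : m.card = l.card + 1) (c2 : m.card = κ.card + 1) : l ⊔ κ = m := by
      refine eq_of_le_of_card (sup_le hl hκ) ?_
      by_contra hlt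
      have c3 := card_le_of_le (le_sup_left : l ≤ l ⊔ κ)
      have e1 := eq_of_le_of_card (le_sup_left : l ≤ l ⊔ κ) (by omega)
      have e2 := eq_of_le_of_card (le_sup_right : κ ≤ l ⊔ κ) (by omega)
      exact hne (e2.trans e1.symm)
    have inf_eq {ν κ : YoungDiagram} (hl : ν ≤ l) (hκ : ν ≤ κ) (hne : κ ≠ l)
        (c1 : l.card = ν.card + 1) (c2 : κ.card = ν.card + 1) : l ⊓ κ = ν := by
      refine (eq_of_le_of_card (le_inf hl hκ) ?_).symm
      by_contra hlt
      have c3 := card_le_of_le (inf_le_left : l ⊓ κ ≤ l)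
      have e1 := eq_of_le_of_card (inf_le_left : l ⊓ κ ≤ l) (by omega)
      have e2 := eq_of_le_of_card (inf_le_right : l ⊓ κ ≤ κ) (by omega)
      exact hne (e2.symm.trans e1)
    refine Finset.sum_bij' (fun x _ => ⟨l ⊓ x.2, x.2⟩) (fun x _ => ⟨l ⊔ x.2, x.2⟩) ?_ ?_ ?_ ?_ ?_
    · rintro ⟨m, κ⟩ hx
      simp only [Finset.mem_sigma, Finset.mem_erase, mem_upSet, mem_downSet] at hx ⊢
      obtain ⟨⟨x1, x2⟩, x3, x4, x5⟩ := hx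
      have := card_sup_add_card_inf l κ
      rw [sup_eq x1 x4 x3 x2 x5] at this
      exact ⟨⟨inf_le_left, by omega⟩, x3, inf_le_right, by omega⟩
    · rintro ⟨ν, κ⟩ hx
      simp only [Finset.mem_sigma, Finset.mem_erase, mem_upSet, mem_downSet] at hx ⊢
      obtain ⟨⟨x1, x2⟩, x3, x4, x5⟩ := hx
      have := card_sup_add_card_inf l κ
      rw [inf_eq x1 x4 x3 x2 x5] at this
      exact ⟨⟨le_sup_left, by omega⟩, x3, le_sup_right, by omega⟩
    · rintro ⟨m, κ⟩ hx
      simp only [Finset.mem_sigma, Finset.mem_erase, mem_upSet, mem_downSet] at hx ⊢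
      obtain ⟨⟨x1, x2⟩, x3, x4, x5⟩ := hx
      rw [sup_eq x1 x4 x3 x2 x5]
    · rintro ⟨ν, κ⟩ hx
      simp only [Finset.mem_sigma, Finset.mem_erase, mem_upSet, mem_downSet] at hx ⊢
      obtain ⟨⟨x1, x2⟩, x3, x4, x5⟩ := hx
      rw [inf_eq x1 x4 x3 x2 x5]
    · rintro ⟨m, κ⟩ hx
      rfl
  rw [h1, h2, h3]
  ring

/-- Branching rewrites the right-hand side as an up-down sum. Exchanging the order gains at least
one copy of `tabCount l`, and induction applied to the diagrams below `l` gives the other `l.card`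
copies. -/
theorem le_sum_upSet (l : YoungDiagram) :
    (l.card + 1) * tabCount l ≤ ∑ m ∈ upSet l, tabCount m := by
  induction hn : l.card using Nat.strong_induction_on generalizing l with
  | _ n ih =>
    subst hn
    have h1 : ∑ m ∈ upSet l, tabCount m = ∑ m ∈ upSet l, ∑ κ ∈ downSet m, tabCount κ :=
      Finset.sum_congr rfl fun m hm => tabCount_eq_sum_downSet (by
        have := (mem_upSet.1 hm).2
        omega)
    have h2 := sum_upSet_downSet tabCount l
    have h3 : l.card * tabCount l ≤ ∑ ν ∈ downSet l, ∑ κ ∈ upSet ν, tabCount κ := by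
      by_cases h0 : l.card = 0
      · rw [h0, zero_mul]
        exact Nat.zero_le _
      · rw [tabCount_eq_sum_downSet h0, Finset.mul_sum]
        refine Finset.sum_le_sum fun ν hν => ?_
        have hc := (mem_downSet.1 hν).2
        rw [hc]
        exact ih ν.card (by omega) ν rfl
    have h4 := Nat.mul_le_mul_right (tabCount l) (card_downSet_lt_card_upSet l)
    rw [h1]
    nlinarith

/-- This is one half of $\sum_\lambda f_\lambda^2=n!$, the sum over tableaux being the sum over
shapes weighted by $f_\lambda$. -/
theorem factorial_le_sum_tabCount (n : ℕ) : n.factorial ≤ ∑ T : Tab n, tabCount T.shape := by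
  induction n with
  | zero =>
    have T : Tab 0 := ⟨fun _ => 0, ⟨by omega, by omega, fun _ _ => rfl⟩⟩
    refine le_trans ?_ (Finset.single_le_sum (fun _ _ => Nat.zero_le _) (Finset.mem_univ T))
    rw [tabCount_eq T.card_shape]
    refine le_trans ?_ (Finset.single_le_sum (fun _ _ => Nat.zero_le _) (Finset.mem_univ T))
    simp
  | succ n ih =>
    rw [sum_shape_succ, Nat.factorial_succ]
    refine (Nat.mul_le_mul_left _ ih).trans ?_
    rw [Finset.mul_sum]
    refine Finset.sum_le_sum fun T _ => ?_
    have := le_sum_upSet T.shape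
    rwa [T.card_shape] at this

/-- There are at least `n!` pairs of standard tableaux of the same shape. -/
theorem factorial_le_card_pairs (n : ℕ) :
    n.factorial ≤ Nat.card {x : Tab n × Tab n // x.1.shape = x.2.shape} := by
  classical
  refine (factorial_le_sum_tabCount n).trans_eq ?_
  rw [Nat.card_eq_fintype_card, Fintype.card_subtype, Finset.card_filter, Fintype.sum_prod_type_right]
  exact Finset.sum_congr rfl fun T _ => tabCount_eq T.card_shape

end Counting
/-! ### Matrix units in `H_n` -/

section MatrixUnits

variable {k : Type u} [Field k] {a : kˣ} {n : ℕ}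

variable (k) in
/-- The matrix unit sending the basis vector of `T` to that of `S`. -/
noncomputable def matUnit (S T : Tab n) : Module.End k (Tab n →₀ k) :=
  Finsupp.lsingle S ∘ₗ Finsupp.lapply T

theorem matUnit_apply (S T : Tab n) (v : Tab n →₀ k) :
    matUnit k S T v = Finsupp.single S (v T) := rfl

theorem matUnit_mul (S T U : Tab n) : matUnit k S T * matUnit k T U = matUnit k S U := by
  refine LinearMap.ext fun v => ?_
  rw [Module.End.mul_apply, matUnit_apply, matUnit_apply, matUnit_apply, Finsupp.single_eq_same]

theorem matUnit_mul_mul (S T : Tab n) (X : Module.End k (Tab n →₀ k)) :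
    matUnit k S S * X * matUnit k T T = X (Finsupp.single T 1) S • matUnit k S T := by
  refine LinearMap.ext fun v => ?_
  rw [Module.End.mul_apply, Module.End.mul_apply, matUnit_apply, matUnit_apply,
    LinearMap.smul_apply, matUnit_apply]
  have : Finsupp.single T (v T) = v T • Finsupp.single T (1 : k) := by
    rw [Finsupp.smul_single, smul_eq_mul, mul_one]
  rw [this, map_smul, Finsupp.smul_apply, Finsupp.smul_single, smul_eq_mul, smul_eq_mul, mul_comm]

/-- Lagrange interpolation in the Jucys–Murphy elements: each `R` in `s` differs from `T` in some
content and contributes one factor that vanishes at `R` and is $1$ at `T`. -/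
theorem exists_diagonal (ha : IsGeneric a) (T : Tab n) (s : Finset (Tab n)) (hs : T ∉ s) :
    ∃ (x : Hecke k a n) (d : Tab n → k), (∀ U, rho ha n x (Finsupp.single U 1) =
      d U • Finsupp.single U 1) ∧ d T = 1 ∧ ∀ R ∈ s, d R = 0 := by
  induction s using Finset.induction_on with
  | empty => exact ⟨1, fun _ => 1, fun U => by simp, rfl, by simp⟩
  | insert R s hR ih =>
    rw [Finset.mem_insert, not_or] at hs
    obtain ⟨x, d, hx, h1, h0⟩ := ih hs.2
    obtain ⟨i, hi, hc⟩ : ∃ i, i < n ∧ content (T.1 i) ≠ content (R.1 i) := by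
      by_contra! hc
      have := T.2.ext_content R.2 hc
      exact hs.1 (Tab.ext fun i _ => congrFun this i)
    have hne := sub_ne_zero.2 (jmEigen_ne ha hc)
    refine ⟨(jmEigen a (content (T.1 i)) - jmEigen a (content (R.1 i)))⁻¹ •
      ((jm k a n i - algebraMap k _ (jmEigen a (content (R.1 i)))) * x),
      fun U => (jmEigen a (content (T.1 i)) - jmEigen a (content (R.1 i)))⁻¹ *
        ((jmEigen a (content (U.1 i)) - jmEigen a (content (R.1 i))) * d U), fun U => ?_, ?_,
      fun Q hQ => ?_⟩
    · rw [map_smul, map_mul, map_sub, AlgHom.commutes, LinearMap.smul_apply, Module.End.mul_apply,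
        hx, map_smul, LinearMap.sub_apply, rho_jm ha hi, Module.algebraMap_end_apply]
      module
    · simp only [h1, mul_one, inv_mul_cancel₀ hne]
    · rcases Finset.mem_insert.1 hQ with rfl | hQ
      · simp only [sub_self, zero_mul, mul_zero]
      · simp only [h0 Q hQ, mul_zero]

theorem matUnit_self_mem_range (ha : IsGeneric a) (T : Tab n) :
    matUnit k T T ∈ (rho ha n).range := by
  obtain ⟨x, d, hx, h1, h0⟩ := exists_diagonal ha T (Finset.univ.erase T) (by simp)
  refine ⟨x, Finsupp.lhom_ext' fun U => LinearMap.ext_ring ?_⟩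
  change rho ha n x (Finsupp.single U 1) = matUnit k T T (Finsupp.single U 1)
  rw [hx, matUnit_apply]
  by_cases h : U = T
  · subst h
    rw [h1, one_smul, Finsupp.single_eq_same]
  · rw [h0 U (by simp [h]), zero_smul, Finsupp.single_eq_of_ne (Ne.symm h), Finsupp.single_zero]

/-- A generator cut down by diagonal units on both sides leaves its off-diagonal entry, which is
invertible by `diagCoeff_ne` since the boxes are incomparable. -/
theorem matUnit_swap_mem_range (ha : IsGeneric a) (R : Tab n) {i : ℕ} (hi : i + 1 < n)
    (h : ¬ R.1 i ≤ R.1 (i + 1)) : matUnit k (R.swap hi h) R ∈ (rho ha n).range := by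
  have h1 := R.2.content_ne (Nat.lt_succ_self i) hi (by omega)
  have h2 := R.2.content_of_not_le hi h
  have hc := diagCoeff_ne ha (sub_ne_zero.2 h1.symm) h2.1
  have hne : R.swap hi h ≠ R := fun e => by
    have := congrArg (fun T : Tab n => T.1 i) e
    simp only [Tab.swap, Function.comp_apply, Equiv.swap_apply_left] at this
    have := R.2.inj _ _ hi (by omega) this
    omega
  have hcoef : rho ha n (Hecke.gen ⟨i, hi⟩) (Finsupp.single R 1) (R.swap hi h) =
      (a : k) - tabCoeff a i R.1 := by
    rw [rho_gen_single]
    change tabCoeff a i R.1 • Finsupp.single R 1 (R.swap hi h) +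
      ((a : k) - tabCoeff a i R.1) • tabVec k n (R.swap hi h).1 (R.swap hi h) = _
    rw [tabVec_coe, Finsupp.single_eq_same, Finsupp.single_eq_of_ne hne, smul_zero, zero_add,
      smul_eq_mul, mul_one]
  have key : matUnit k (R.swap hi h) R = ((a : k) - tabCoeff a i R.1)⁻¹ •
      (matUnit k (R.swap hi h) (R.swap hi h) * rho ha n (Hecke.gen ⟨i, hi⟩) * matUnit k R R) := by
    rw [matUnit_mul_mul, hcoef, smul_smul, tabCoeff, inv_mul_cancel₀ hc, one_smul]
  rw [key]
  exact Subalgebra.smul_mem _ (mul_mem (mul_mem (matUnit_self_mem_range ha _) ⟨_, rfl⟩)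
    (matUnit_self_mem_range ha _)) _

theorem Tab.swap_swap (R : Tab n) {i : ℕ} (hi : i + 1 < n) (h : ¬ R.1 i ≤ R.1 (i + 1)) :
    ∃ h' : ¬ (R.swap hi h).1 i ≤ (R.swap hi h).1 (i + 1), (R.swap hi h).swap hi h' = R := by
  have e : (R.swap hi h).1 ∘ Equiv.swap i (i + 1) = R.1 := by
    funext j
    simp [Tab.swap]
  refine ⟨IsStd.not_le_of_swap hi (by rw [e]; exact R.2), Tab.ext fun j _ => congrFun e j⟩

/-- Tableaux of one shape are connected by admissible exchanges, and matrix units multiply along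
such a chain. -/
theorem matUnit_mem_range (ha : IsGeneric a) {S T : Tab n} (h : S.shape = T.shape) :
    matUnit k S T ∈ (rho ha n).range := by
  have hP : Equivalence fun S T : Tab n =>
      matUnit k S T ∈ (rho ha n).range ∧ matUnit k T S ∈ (rho ha n).range :=
    { refl := fun T => ⟨matUnit_self_mem_range ha T, matUnit_self_mem_range ha T⟩
      symm := fun h => h.symm
      trans := fun {S T U} h h' => by
        rw [← matUnit_mul S T U, ← matUnit_mul U T S]
        exact ⟨mul_mem h.1 h'.1, mul_mem h'.2 h.2⟩ }
  refine (Tab.connected (m := 0) hP (fun R i hi hn _ => ⟨?_, matUnit_swap_mem_range ha R hi hn⟩) h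
    (by omega)).1
  obtain ⟨h', e⟩ := R.swap_swap hi hn
  have := matUnit_swap_mem_range ha (R.swap hi hn) hi h'
  rwa [e] at this

/-- The entries at pairs of equal shape map $H_n$ onto a space of dimension at least $n!$, as all
matrix units are hit. Since $\dim H_n\le n!$, this surjection is bijective. -/
theorem rho_injective (ha : IsGeneric a) : Function.Injective (rho ha n) := by
  classical
  obtain ⟨hfin, hle⟩ := finite_and_finrank_le k a n
  let f : Hecke k a n →ₗ[k] ({x : Tab n × Tab n // x.1.shape = x.2.shape} → k) :=
    LinearMap.pi fun x => Finsupp.lapply x.1.1 ∘ₗ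
      LinearMap.applyₗ (Finsupp.single x.1.2 (1 : k)) ∘ₗ (rho ha n).toLinearMap
  have hf (x) (y) : f x y = rho ha n x (Finsupp.single y.1.2 1) y.1.1 := rfl
  have hsurj : Function.Surjective f := by
    intro g
    choose e he using fun x : {x : Tab n × Tab n // x.1.shape = x.2.shape} =>
      matUnit_mem_range ha x.2
    refine ⟨∑ x, g x • e x, ?_⟩
    funext y
    rw [map_sum, Finset.sum_apply, Finset.sum_eq_single y]
    · rw [map_smul, Pi.smul_apply, hf]
      have := he y
      simp only [AlgHom.toRingHom_eq_coe, RingHom.coe_coe] at this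
      rw [this, matUnit_apply, Finsupp.single_eq_same, Finsupp.single_eq_same, smul_eq_mul, mul_one]
    · intro x _ hx
      rw [map_smul, Pi.smul_apply, hf]
      have := he x
      simp only [AlgHom.toRingHom_eq_coe, RingHom.coe_coe] at this
      rw [this, matUnit_apply]
      by_cases h2 : x.1.2 = y.1.2
      · have h1 : y.1.1 ≠ x.1.1 := fun h1 => hx (Subtype.ext (Prod.ext h1.symm h2))
        rw [Finsupp.single_eq_of_ne h1, smul_zero]
      · rw [Finsupp.single_eq_of_ne h2, Finsupp.single_zero]
        exact smul_zero _
    · simp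
  have hge := LinearMap.finrank_le_finrank_of_surjective hsurj
  have hcard := factorial_le_card_pairs n
  rw [Module.finrank_fintype_fun_eq_card, ← Nat.card_eq_fintype_card] at hge
  have heq : Module.finrank k (Hecke k a n) =
      Module.finrank k ({x : Tab n × Tab n // x.1.shape = x.2.shape} → k) := by
    rw [Module.finrank_fintype_fun_eq_card, ← Nat.card_eq_fintype_card]
    omega
  have hinj := (LinearMap.injective_iff_surjective_of_finrank_eq_finrank heq).2 hsurj
  intro x y hxy
  apply hinj
  funext z
  rw [hf, hf, hxy]

open Classical in
/-- The element of `H_n` that acts as a matrix unit in Young's seminormal representation; it is zero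
if the shapes of the two tableaux differ. -/
noncomputable def tabUnit (ha : IsGeneric a) (S T : Tab n) : Hecke k a n :=
  if h : S.shape = T.shape then Classical.choose (matUnit_mem_range ha h) else 0

theorem rho_tabUnit (ha : IsGeneric a) {S T : Tab n} (h : S.shape = T.shape) :
    rho ha n (tabUnit ha S T) = matUnit k S T := by
  rw [tabUnit, dif_pos h]
  exact Classical.choose_spec (matUnit_mem_range ha h)

theorem tabUnit_of_ne (ha : IsGeneric a) {S T : Tab n} (h : S.shape ≠ T.shape) :
    tabUnit ha S T = 0 := dif_neg h

/-- For fixed `U` the elements `tabUnit ha R U` span a left ideal in which $H_n$ acts by the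
seminormal formulas. Products in $H_n$ can thus be read off from `rho`. -/
theorem mul_tabUnit (ha : IsGeneric a) (x : Hecke k a n) {S U : Tab n} (h : S.shape = U.shape) :
    x * tabUnit ha S U = Finsupp.linearCombination k (fun R => tabUnit ha R U)
      (rho ha n x (Finsupp.single S 1)) := by
  apply rho_injective ha
  rw [map_mul, rho_tabUnit ha h]
  refine LinearMap.ext fun w => ?_
  rw [Module.End.mul_apply, matUnit_apply]
  have e1 : Finsupp.single S (w U) = w U • Finsupp.single S (1 : k) := by
    rw [Finsupp.smul_single, smul_eq_mul, mul_one]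
  rw [e1, map_smul, Finsupp.linearCombination_apply, Finsupp.sum, map_sum, LinearMap.sum_apply]
  conv_lhs => rw [← Finsupp.sum_single (rho ha n x (Finsupp.single S 1)), Finsupp.sum, Finset.smul_sum]
  refine Finset.sum_congr rfl fun R hR => ?_
  have hRS : R.shape = S.shape := by
    by_contra hne
    exact (Finsupp.mem_support_iff.1 hR) (rho_apply_eq_zero ha x hne)
  rw [map_smul, rho_tabUnit ha (hRS.trans h), LinearMap.smul_apply, matUnit_apply,
    Finsupp.smul_single, Finsupp.smul_single, smul_eq_mul, smul_eq_mul, mul_comm]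

theorem tabUnit_mul (ha : IsGeneric a) (S : Tab n) {T U : Tab n} (h : S.shape = T.shape)
    (h' : T.shape = U.shape) : tabUnit ha S T * tabUnit ha T U = tabUnit ha S U := by
  rw [mul_tabUnit ha _ h', rho_tabUnit ha h, matUnit_apply, Finsupp.single_eq_same,
    Finsupp.linearCombination_single, one_smul]

theorem tabUnit_mul_of_ne (ha : IsGeneric a) (S : Tab n) {T T' : Tab n} (h : T ≠ T') (U : Tab n) :
    tabUnit ha S T * tabUnit ha T' U = 0 := by
  by_cases h1 : S.shape = T.shape
  · by_cases h2 : T'.shape = U.shape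
    · rw [mul_tabUnit ha _ h2, rho_tabUnit ha h1, matUnit_apply, Finsupp.single_eq_of_ne h,
        Finsupp.single_zero, map_zero]
    · rw [tabUnit_of_ne ha h2, mul_zero]
  · rw [tabUnit_of_ne ha h1, zero_mul]

theorem sum_tabUnit (ha : IsGeneric a) : ∑ T : Tab n, tabUnit ha T T = 1 := by
  apply rho_injective ha
  rw [map_sum, map_one]
  refine Finsupp.lhom_ext' fun U => LinearMap.ext_ring ?_
  change (∑ T : Tab n, rho ha n (tabUnit ha T T)) (Finsupp.single U 1) = Finsupp.single U 1
  rw [LinearMap.sum_apply, Finset.sum_eq_single U]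
  · rw [rho_tabUnit ha rfl, matUnit_apply, Finsupp.single_eq_same]
  · intro T _ hT
    rw [rho_tabUnit ha rfl, matUnit_apply, Finsupp.single_eq_of_ne hT, Finsupp.single_zero]
  · simp

/-- A matrix unit of $H_m$ inside $H_p$ replaces the first $m$ boxes and leaves the later ones
alone. This is what makes `theta` compatible with composition. -/
theorem shift_tabUnit_mul (ha : IsGeneric a) {m p : ℕ} (h : m ≤ p) (h' : 0 + m ≤ p) {S : Tab m}
    {R U : Tab p} (hs : S.shape = (R.trunc h).shape) (hU : R.shape = U.shape) :
    Hecke.shift 0 h' (tabUnit ha S (R.trunc h)) * tabUnit ha R U =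
      tabUnit ha (S.graft h R hs) U := by
  rw [mul_tabUnit ha _ hU, rho_shift_single ha h, rho_tabUnit ha hs, matUnit_apply,
    Finsupp.single_eq_same, graftMap_single h R hs, Finsupp.linearCombination_single, one_smul]

/-! ### The one-row representation -/

variable (n) in
/-- The standard tableau with one row. -/
def rowTab : Tab n where
  val i := if i < n then (0, i) else 0
  property := by
    refine ⟨fun i j hi hj e => ?_, fun i hi b hb => ?_, fun i hi => if_neg (by omega)⟩
    · rw [if_pos hi, if_pos hj] at e
      exact congrArg Prod.snd e
    · rw [if_pos hi] at hb
      obtain ⟨r, c⟩ := b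
      obtain ⟨h1, h2⟩ := Prod.mk_le_mk.1 hb
      obtain rfl : r = 0 := by omega
      exact ⟨c, h2, if_pos (by omega)⟩

theorem rowTab_apply {i : ℕ} (hi : i < n) : (rowTab n).1 i = (0, i) := if_pos hi

theorem eq_rowTab {T : Tab n} (h : T.shape = (rowTab n).shape) : T = rowTab n := by
  refine Tab.ext fun i hi => ?_
  rw [rowTab_apply hi]
  induction i using Nat.strong_induction_on with
  | _ i ih =>
    have := T.apply_mem_shape hi
    rw [h] at this
    obtain ⟨j, hj, e⟩ := Tab.mem_shape.1 this
    rw [rowTab_apply hj] at e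
    -- The column of the box with entry `i` is at most `i`; a strictly smaller column is already
    -- occupied by induction.
    have hji : j ≤ i := by
      have := T.2.snd_le i
      rwa [← e] at this
    rcases hji.eq_or_lt with rfl | hlt
    · exact e.symm
    · have := T.2.inj j i hj hi ((ih j hlt hj).trans e)
      omega

theorem rho_rowTab (ha : IsGeneric a) (x : Hecke k a n) :
    rho ha n x (Finsupp.single (rowTab n) 1) =
      Hecke.triv k a n x • Finsupp.single (rowTab n) 1 := by
  induction x using Hecke.induction_on with
  | algebraMap c => rw [AlgHom.commutes, AlgHom.commutes]; rfl
  | mul x y hx hy =>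
    rw [map_mul, map_mul, Module.End.mul_apply, hy, map_smul, hx, smul_smul, mul_comm]
  | add x y hx hy => rw [map_add, map_add, LinearMap.add_apply, hx, hy, add_smul]
  | gen i =>
    obtain ⟨i, hi⟩ := i
    have h1 := rowTab_apply (show i < n by omega)
    have h2 := rowTab_apply hi
    rw [rho_gen_single, Hecke.triv_gen]
    have hc : tabCoeff a i (rowTab n).1 = a := by
      rw [tabCoeff, h1, h2, content, content]
      simp
    rw [hc, sub_self, zero_smul, add_zero]

theorem triv_tabUnit (ha : IsGeneric a) {T : Tab n} (hT : T ≠ rowTab n) :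
    Hecke.triv k a n (tabUnit ha T T) = 0 := by
  have := rho_rowTab ha (tabUnit ha T T)
  rw [rho_tabUnit ha rfl, matUnit_apply, Finsupp.single_eq_of_ne hT, Finsupp.single_zero] at this
  have := DFunLike.congr_fun this (rowTab n)
  rw [Finsupp.smul_apply, Finsupp.single_eq_same, smul_eq_mul, mul_one] at this
  exact this.symm

/-- The block of the one-row shape has size one and its only entry is the value of the character, so
the corresponding idempotent kills the kernel of the character. -/
theorem tabUnit_rowTab_mul (ha : IsGeneric a) {x : Hecke k a n} (hx : Hecke.triv k a n x = 0) :
    tabUnit ha (rowTab n) (rowTab n) * x = 0 := by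
  apply rho_injective ha
  rw [map_mul, map_zero, rho_tabUnit ha rfl]
  refine Finsupp.lhom_ext' fun U => LinearMap.ext_ring ?_
  change matUnit k _ _ (rho ha n x (Finsupp.single U 1)) = 0
  rw [matUnit_apply]
  by_cases hU : (rowTab n).shape = U.shape
  · obtain rfl := eq_rowTab hU.symm
    rw [rho_rowTab, hx, zero_smul]
    simp
  · rw [rho_apply_eq_zero ha x hU, Finsupp.single_zero]

end MatrixUnits
/-! ### The kernel of the projection to the quantum symmetric algebra -/

section Kernel

open _root_.HeckeCat.Rep

variable {k : Type u} [Field k] {a : kˣ} {n : ℕ}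

/-- The right ideal generated by a diagonal matrix unit. -/
noncomputable def tabIdeal (ha : IsGeneric a) (T : Tab n) :
    Submodule (Hecke k a n)ᵐᵒᵖ ((Rep.T k a).V n) where
  carrier := {y : Hecke k a n | tabUnit ha T T * y = y}
  add_mem' {x y} hx hy := (mul_add (tabUnit ha T T) (x : Hecke k a n) y).trans
    (congrArg₂ (fun x y : Hecke k a n => x + y) hx hy)
  zero_mem' := mul_zero (tabUnit ha T T)
  smul_mem' r y hy := (mul_assoc (tabUnit ha T T) (y : Hecke k a n) (unop r)).symm.trans
    (congrArg (fun y : Hecke k a n => y * unop r) hy)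

theorem mem_tabIdeal (ha : IsGeneric a) {T : Tab n} {y : Hecke k a n} :
    (show (Rep.T k a).V n from y) ∈ tabIdeal ha T ↔ tabUnit ha T T * y = y := Iff.rfl

/-- Every nonzero element of the ideal generates it. -/
theorem exists_mul_eq_tabUnit (ha : IsGeneric a) {T : Tab n} {y : Hecke k a n}
    (hy : tabUnit ha T T * y = y) (h0 : y ≠ 0) : ∃ z, y * z = tabUnit ha T T := by
  obtain ⟨U, hU⟩ : ∃ U, rho ha n y (Finsupp.single U 1) T ≠ 0 := by
    by_contra! hc
    apply h0
    apply rho_injective ha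
    rw [map_zero, ← hy, map_mul, rho_tabUnit ha rfl]
    refine Finsupp.lhom_ext' fun U => LinearMap.ext_ring ?_
    change matUnit k T T (rho ha n y (Finsupp.single U 1)) = 0
    rw [matUnit_apply, hc, Finsupp.single_zero]
  have hs : T.shape = U.shape := by
    by_contra hne
    exact hU (rho_apply_eq_zero ha y hne)
  -- The right factor moves the nonzero entry in row `T` and column `U` to the diagonal and
  -- normalises it.
  refine ⟨(rho ha n y (Finsupp.single U 1) T)⁻¹ • tabUnit ha U T, ?_⟩
  apply rho_injective ha
  have h1 : y * tabUnit ha U T = tabUnit ha T T * y * tabUnit ha U U * tabUnit ha U T := by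
    rw [hy, mul_assoc, tabUnit_mul ha U rfl hs.symm]
  rw [mul_smul_comm, map_smul, h1, map_mul, map_mul, map_mul, rho_tabUnit ha rfl,
    rho_tabUnit ha rfl, rho_tabUnit ha hs.symm, matUnit_mul_mul, smul_mul_assoc, matUnit_mul,
    smul_smul, inv_mul_cancel₀ hU, one_smul]

theorem tabUnit_ne_zero (ha : IsGeneric a) (T : Tab n) : tabUnit ha T T ≠ 0 := by
  intro h
  have := congrArg (fun x => rho ha n x (Finsupp.single T 1) T) h
  simp only [rho_tabUnit ha rfl, matUnit_apply, Finsupp.single_eq_same, map_zero,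
    LinearMap.zero_apply, Finsupp.zero_apply] at this
  exact one_ne_zero this

theorem isSimpleModule_tabIdeal (ha : IsGeneric a) (T : Tab n) :
    IsSimpleModule (Hecke k a n)ᵐᵒᵖ (tabIdeal ha T) := by
  rw [isSimpleModule_iff_toSpanSingleton_surjective]
  refine ⟨⟨⟨⟨(tabUnit ha T T : Hecke k a n), tabUnit_mul ha T rfl rfl⟩, 0, fun h =>
    tabUnit_ne_zero ha T (congrArg Subtype.val h)⟩⟩, ?_⟩
  have key (y w : Hecke k a n) (hy : tabUnit ha T T * y = y) (h0 : y ≠ 0)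
      (hw : tabUnit ha T T * w = w) : ∃ r, y * r = w := by
    obtain ⟨z, hz⟩ := exists_mul_eq_tabUnit ha hy h0
    exact ⟨z * w, by rw [← mul_assoc, hz, hw]⟩
  rintro ⟨y, hy⟩ h0 ⟨w, hw⟩
  obtain ⟨r, hr⟩ := key y w hy (fun h => h0 (Subtype.ext h)) hw
  exact ⟨op r, Subtype.ext hr⟩

/-- The product of two elements of `H_n`, as an element of the tensor algebra. -/
noncomputable def mulVal (y : Hecke k a n) (x : (Rep.T k a).V n) : (Rep.T k a).V n :=
  (y * (show Hecke k a n from x) : Hecke k a n)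

/-- An element of the kernel is the sum of its parts in the ideals $E_{T,T}H_n$, and its one-row
part vanishes. Conversely, a simple right ideal not contained in the kernel embeds into the one-row
representation. -/
theorem ker_proj (ha : IsGeneric a) : LinearMap.ker (app (proj k a) n) =
    sSup {N | IsSimpleNotOneRow N} := by
  apply le_antisymm
  · intro x hx
    change Hecke.triv k a n x = 0 at hx
    have hmem : ∀ T : Tab n, mulVal (tabUnit ha T T) x ∈ sSup {N | IsSimpleNotOneRow N} := by
      intro T
      by_cases hT : T = rowTab n
      · subst hT
        have : mulVal (tabUnit ha (rowTab n) (rowTab n)) x = 0 := tabUnit_rowTab_mul ha hx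
        rw [this]
        exact zero_mem _
      · refine (le_sSup (show tabIdeal ha T ∈ {N | IsSimpleNotOneRow N} from
          ⟨isSimpleModule_tabIdeal ha T, fun h => ?_⟩)) ?_
        · have hg (y : Hecke k a n) : tabUnit ha T T * y =
              Hecke.triv k a n y • tabUnit ha T T := by
            induction y using Hecke.induction_on with
            | algebraMap c =>
              rw [AlgHom.commutes, ← Algebra.commutes, ← Algebra.smul_def]
              rfl
            | gen i =>
              rw [Hecke.triv_gen]
              exact h i (tabUnit ha T T : Hecke k a n) (tabUnit_mul ha T rfl rfl)
            | mul y z hy hz => rw [← mul_assoc, hy, smul_mul_assoc, hz, smul_smul, map_mul]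
            | add y z hy hz => rw [mul_add, hy, hz, map_add, add_smul]
          have := hg (tabUnit ha T T)
          rw [triv_tabUnit ha hT, zero_smul, tabUnit_mul ha T rfl rfl] at this
          exact tabUnit_ne_zero ha T this
        · refine (mem_tabIdeal ha).2 ?_
          exact (mul_assoc (tabUnit ha T T) (tabUnit ha T T) (show Hecke k a n from x)).symm.trans
            (congrArg (fun y => y * (show Hecke k a n from x)) (tabUnit_mul ha T rfl rfl))
    have e : x = ∑ T : Tab n, mulVal (tabUnit ha T T) x := by
      refine Eq.trans ?_ (Finset.sum_mul Finset.univ (fun T : Tab n => tabUnit ha T T)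
        (show Hecke k a n from x))
      rw [sum_tabUnit]
      exact (one_mul (show Hecke k a n from x)).symm
    rw [e]
    exact sum_mem fun T _ => hmem T
  · refine sSup_le ?_
    rintro N ⟨hN, hrow⟩
    by_contra hle
    apply hrow
    have hbot : N ⊓ LinearMap.ker (app (proj k a) n) = ⊥ := by
      have hatom := isSimpleModule_iff_isAtom.1 hN
      rcases hatom.le_iff.1 (inf_le_left : N ⊓ LinearMap.ker (app (proj k a) n) ≤ N) with h | h
      · exact h
      · exact absurd (inf_eq_left.1 h) hle
    intro i x hx
    -- The element $xg_i-ax$ lies in `N` and in the kernel of the character, and these meet in zero.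
    have hmem : op (Hecke.gen i : Hecke k a n) • x - (a : k) • x ∈
        N ⊓ LinearMap.ker (app (proj k a) n) := by
      refine ⟨sub_mem (N.smul_mem _ hx) ?_, ?_⟩
      · rw [← algebraMap_smul (Hecke k a n)ᵐᵒᵖ (a : k) x]
        exact N.smul_mem _ hx
      · have key (x : Hecke k a n) :
            Hecke.triv k a n (x * Hecke.gen i - (a : k) • x) = 0 := by
          rw [map_sub, map_mul, map_smul, Hecke.triv_gen, smul_eq_mul, mul_comm, sub_self]
        exact key x
    rw [hbot, Submodule.mem_bot, sub_eq_zero] at hmem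
    exact hmem

theorem proj_surjective : Function.Surjective (app (proj k a) n) := fun c =>
  ⟨(algebraMap k (Hecke k a n) c : Hecke k a n), (Hecke.triv k a n).commutes c⟩

theorem isMonHom_proj : IsMonHom (proj k a) where
  one_hom := rfl
  mul_hom := by
    apply day_ext
    intro m n p e x y
    rw [comp_app, comp_app]
    refine (congrArg (app (proj k a) p) (mulT_tmul e x y)).trans ?_
    refine Eq.trans ?_ (congrArg (app mulS p) (tensorHom_tmul _ _ e x y)).symm
    refine Eq.trans ?_ (mulS_tmul e (Hecke.triv k a m x) (Hecke.triv k a n y)).symm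
    have key (x : Hecke k a m) (y : Hecke k a n) : Hecke.triv k a p (Hecke.shift 0 (by omega) x *
        Hecke.shift m (by omega) y) = Hecke.triv k a m x * Hecke.triv k a n y := by
      rw [map_mul, Hecke.triv_shift, Hecke.triv_shift]
    exact key x y

end Kernel

/-! ### Generic parameters -/

theorem isGeneric_one (k : Type u) [Field k] [CharZero k] : IsGeneric (1 : kˣ) := by
  intro n hn
  simp only [qInt, one_zpow, Units.val_one, Finset.sum_const, Finset.card_range, nsmul_eq_mul,
    mul_one]
  exact_mod_cast (by omega : n ≠ 0)

/-- Multiplying $[n]$ by $X^{n-1}$ gives a polynomial whose value at $1$ is $n$. -/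
theorem isGeneric_X : IsGeneric (Units.mk0 (RatFunc.X : RatFunc ℂ) RatFunc.X_ne_zero) := by
  intro n hn h
  have hX : (RatFunc.X : RatFunc ℂ) ≠ 0 := RatFunc.X_ne_zero
  have h1 : algebraMap (Polynomial ℂ) (RatFunc ℂ)
      (∑ i ∈ Finset.range n, Polynomial.X ^ (2 * (n - 1 - i))) =
      (RatFunc.X : RatFunc ℂ) ^ (n - 1) * qInt (Units.mk0 (RatFunc.X : RatFunc ℂ) hX) n := by
    rw [map_sum, qInt, Finset.mul_sum]
    refine Finset.sum_congr rfl fun i hi => ?_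
    rw [Finset.mem_range] at hi
    rw [map_pow, RatFunc.algebraMap_X, Units.val_zpow_eq_zpow_val, Units.val_mk0,
      ← zpow_natCast, ← zpow_natCast, ← zpow_add₀ hX]
    congr 1
    omega
  rw [h, mul_zero, map_eq_zero_iff _ (RatFunc.algebraMap_injective ℂ)] at h1
  have h2 := congrArg (Polynomial.eval 1) h1
  simp only [Polynomial.eval_finsetSum, Polynomial.eval_pow, Polynomial.eval_X, one_pow,
    Finset.sum_const, Finset.card_range, nsmul_eq_mul, mul_one, Polynomial.eval_zero,
    Nat.cast_eq_zero] at h2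
  omega

/-! ### Right modules over the quantum symmetric algebra -/

section RightModules

open _root_.HeckeCat.Rep MonoidalCategory
open scoped MonObj

variable {k : Type u} [Field k] {a : kˣ}

theorem algebraMap_act (X : Rep k a) {n : ℕ} (c : k) (x : X.V n) :
    op (algebraMap k (Hecke k a n) c) • x = c • x :=
  algebraMap_smul (Hecke k a n)ᵐᵒᵖ c x

/-- The right action of `r`, as a `k`-linear map. -/
noncomputable def actMap (X : Rep k a) {n : ℕ} (r : Hecke k a n) : X.V n →ₗ[k] X.V n where
  toFun x := op r • x
  map_add' _ _ := smul_add _ _ _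
  map_smul' c x := smul_comm _ c x

theorem op_mul_act (X : Rep k a) {n : ℕ} (r s : Hecke k a n) (x : X.V n) :
    op (r * s) • x = op s • op r • x := by
  rw [op_mul, mul_smul]

theorem smul_tmul {M N : Rep k a} {m n p : ℕ} (h : m + n = p) (c : k) (x : M.V m) (y : N.V n) :
    tmul h (c • x) y = c • tmul h x y := by
  rw [← algebraMap_act, act_tmul, AlgHom.commutes, algebraMap_act]

theorem tmul_smul {M N : Rep k a} {m n p : ℕ} (h : m + n = p) (c : k) (x : M.V m) (y : N.V n) :
    tmul h x (c • y) = c • tmul h x y := by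
  rw [← algebraMap_act, tmul_act, AlgHom.commutes, algebraMap_act]

variable (k a) in
/-- The basis vector of the one-row representation. -/
def QSym.one (n : ℕ) : (QSym k a).V n := (1 : k)

theorem QSym.smul_one {n : ℕ} (c : k) : c • QSym.one k a n = (show (QSym k a).V n from c) :=
  mul_one c

theorem QSym.act_one {n : ℕ} (r : Hecke k a n) :
    op r • QSym.one k a n = Hecke.triv k a n r • QSym.one k a n := rfl

theorem app_smul {M N : Rep k a} (f : M ⟶ N) {n : ℕ} (c : k) (x : M.V n) :
    app f n (c • x) = c • app f n x := LinearMap.map_smul_of_tower _ _ _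

/-- The multiplication by the basis vector of degree `p - m` of the quantum symmetric algebra. -/
noncomputable def mulOne (M : RightMod (QSym k a)) {m p : ℕ} (h : m ≤ p) : M.X.V m →ₗ[k] M.X.V p where
  toFun x := app M.act p (tmul (by omega : m + (p - m) = p) x (QSym.one k a (p - m)))
  map_add' x y := by rw [add_tmul, map_add]
  map_smul' c x := by
    rw [smul_tmul]
    exact app_smul M.act c (tmul _ x _)

/-- Each degree of $S$ is a line, so the whole action is determined by multiplication with basis
vectors. -/
theorem act_tmul_one (M : RightMod (QSym k a)) {m d p : ℕ} (h : m + d = p) (x : M.X.V m) (c : k) :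
    app M.act p (tmul (N := QSym k a) (n := d) h x c) = c • mulOne M (by omega : m ≤ p) x := by
  obtain rfl : d = p - m := by omega
  refine Eq.trans ?_ (app_smul M.act c (tmul _ x _))
  rw [← tmul_smul, QSym.smul_one]

theorem mulOne_act (M : RightMod (QSym k a)) {m p : ℕ} (h : m ≤ p) (r : Hecke k a m) (x : M.X.V m) :
    mulOne M h (op r • x) = op (Hecke.shift 0 (by omega : 0 + m ≤ p) r) • mulOne M h x := by
  change app M.act p (tmul _ _ _) = _
  rw [act_tmul, map_smul]
  rfl

/-- A generator of index at least $m$ comes from the factor $H_{p-m}$, which acts on the basis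
vector of $S_{p-m}$ through the character. -/
theorem gen_mulOne (M : RightMod (QSym k a)) {m p : ℕ} (h : m ≤ p) {i : ℕ} (hi : i + 1 < p)
    (hm : m ≤ i) (x : M.X.V m) :
    op (Hecke.gen ⟨i, hi⟩ : Hecke k a p) • mulOne M h x = (a : k) • mulOne M h x := by
  have e : (Hecke.gen ⟨i, hi⟩ : Hecke k a p) =
      Hecke.shift m (by omega : m + (p - m) ≤ p) (Hecke.gen ⟨i - m, by omega⟩) := by
    rw [Hecke.shift_gen]
    exact congrArg Hecke.gen (Subtype.ext (by simp only; omega))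
  change op _ • app M.act p (tmul _ _ _) = _ • app M.act p (tmul _ _ _)
  rw [e, ← map_smul]
  refine (congrArg _ (tmul_act _ _ x (QSym.one k a (p - m))).symm).trans ?_
  rw [QSym.act_one, Hecke.triv_gen, tmul_smul]
  exact app_smul M.act _ (tmul _ x _)

theorem mulOne_self (M : RightMod (QSym k a)) {m : ℕ} (x : M.X.V m) : mulOne M le_rfl x = x := by
  have h1 := congrArg (fun f => app f m (tmul (Nat.add_zero m) x unitOne)) M.act_one
  have h2 : app (ρ_ M.X).hom m (tmul (Nat.add_zero m) x unitOne) = x := by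
    refine (rightUnitorHom_tmul M.X (Nat.add_zero m) x unitOne).trans ?_
    rw [unitVal_one, map_one, MulOpposite.op_one, one_smul]
    rfl
  refine Eq.trans ?_ (h1.trans h2)
  change _ = app M.act m (app (M.X ◁ η[QSym k a]) m _)
  rw [whiskerLeft_tmul]
  have e : app η[QSym k a] 0 unitOne = (1 : k) := map_one (Hecke.triv k a 0)
  rw [e, act_tmul_one, one_smul]

/-- Associativity of the action, since the basis vectors of $S_{n-m}$ and $S_{p-n}$ multiply to that
of $S_{p-m}$. -/
theorem mulOne_mulOne (M : RightMod (QSym k a)) {m n p : ℕ} (h : m ≤ n) (h' : n ≤ p) (x : M.X.V m) :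
    mulOne M h' (mulOne M h x) = mulOne M (h.trans h') x := by
  have h1 := congrArg (fun f => app f p (tmul (by omega : m + (p - m) = p) x
    (tmul (by omega : (n - m) + (p - n) = p - m) (QSym.one k a (n - m)) (QSym.one k a (p - n)))))
    M.act_mul
  have e1 : app (M.X ◁ μ[QSym k a] ≫ M.act) p (tmul (by omega : m + (p - m) = p) x
    (tmul (by omega : (n - m) + (p - n) = p - m) (QSym.one k a (n - m)) (QSym.one k a (p - n)))) =
      mulOne M (h.trans h') x := by
    change app M.act p (app (M.X ◁ μ[QSym k a]) p _) = _
    rw [whiskerLeft_tmul]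
    have e : app μ[QSym k a] (p - m) (tmul (by omega : (n - m) + (p - n) = p - m)
      (QSym.one k a (n - m)) (QSym.one k a (p - n))) = (1 : k) :=
      (mulS_tmul (k := k) _ _ _).trans (one_mul (1 : k))
    rw [e, act_tmul_one, one_smul]
  refine Eq.trans ?_ (h1.symm.trans e1)
  change _ = app M.act p (app (M.act ▷ QSym k a) p (app (assocInv M.X (QSym k a) (QSym k a)) p _))
  rw [assocInv_tmul, whiskerRight_tmul]
  have e2 : app M.act (m + (n - m)) (tmul rfl x (QSym.one k a (n - m))) = mulOne M (by omega) x :=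
    (act_tmul_one M _ x 1).trans (one_smul _ _)
  rw [e2]
  refine Eq.trans ?_ ((act_tmul_one M _ _ 1).trans (one_smul _ _)).symm
  -- The associator produces the intermediate degree $m+(n-m)$, which has to be identified with $n$.
  have key {n' : ℕ} (e : n = n') : mulOne M h' (mulOne M h x) =
      mulOne M (e ▸ h') (mulOne M (e ▸ h) x) := by
    subst e
    rfl
  exact key (by omega)

/-- The action of the quantum symmetric algebra with given multiplications by the basis vectors. -/
noncomputable def actOfMulOne (X : Rep k a) (u : ∀ {m p : ℕ}, m ≤ p → X.V m →ₗ[k] X.V p)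
    (u_act : ∀ {m p : ℕ} (h : m ≤ p) (r : Hecke k a m) (x : X.V m),
      u h (op r • x) = op (Hecke.shift 0 (by omega : 0 + m ≤ p) r) • u h x)
    (gen_u : ∀ {m p : ℕ} (h : m ≤ p) {i : ℕ} (hi : i + 1 < p) (_ : m ≤ i) (x : X.V m),
      op (Hecke.gen ⟨i, hi⟩ : Hecke k a p) • u h x = (a : k) • u h x) :
    day X (QSym k a) ⟶ X :=
  dayDesc fun p =>
    { f := fun {m n} h x (c : k) => c • u (by omega : m ≤ p) x
      add_left := fun h x x' (c : k) => by rw [map_add, smul_add]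
      add_right := fun h x (c c' : k) => add_smul c c' _
      act_left := fun h r x (c : k) => by
        rw [u_act, smul_comm]
        rfl
      act_right := fun {m n} h r x (c : k) => by
        -- The condition on generators extends to all of $H_n$: the shifted algebra acts on the
        -- image through the character.
        have key (r : Hecke k a n) : op (Hecke.shift (p := p) m (by omega) r) •
            u (by omega : m ≤ p) x = Hecke.triv k a n r • u (by omega : m ≤ p) x := by
          induction r using Hecke.induction_on with
          | algebraMap c => rw [AlgHom.commutes, AlgHom.commutes, algebraMap_act]; rfl
          | gen i => rw [Hecke.shift_gen, Hecke.triv_gen, gen_u _ _ (by omega)]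
          | mul r s hr hs =>
            rw [map_mul, op_mul_act, hr, smul_comm, hs, map_mul, mul_smul]
          | add r s hr hs =>
            rw [map_add, MulOpposite.op_add, add_smul, hr, hs, map_add, add_smul]
        change (Hecke.triv k a n r * c) • _ = _
        rw [RingHom.id_apply, smul_comm, key, smul_smul, mul_comm] }

theorem actOfMulOne_tmul (X : Rep k a) (u : ∀ {m p : ℕ}, m ≤ p → X.V m →ₗ[k] X.V p)
    (u_act gen_u) {m n p : ℕ} (h : m + n = p) (x : X.V m) (c : (QSym k a).V n) :
    app (actOfMulOne X u u_act gen_u) p (tmul h x c) =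
      (show k from c) • u (by omega : m ≤ p) x :=
  dayDesc_tmul _ _ _ _

/-- A right module over the quantum symmetric algebra from the multiplications by the basis
vectors. -/
noncomputable def RightMod.ofMulOne (X : Rep k a) (u : ∀ {m p : ℕ}, m ≤ p → X.V m →ₗ[k] X.V p)
    (u_act : ∀ {m p : ℕ} (h : m ≤ p) (r : Hecke k a m) (x : X.V m),
      u h (op r • x) = op (Hecke.shift 0 (by omega : 0 + m ≤ p) r) • u h x)
    (gen_u : ∀ {m p : ℕ} (h : m ≤ p) {i : ℕ} (hi : i + 1 < p) (_ : m ≤ i) (x : X.V m),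
      op (Hecke.gen ⟨i, hi⟩ : Hecke k a p) • u h x = (a : k) • u h x)
    (u_self : ∀ {m : ℕ} (x : X.V m), u le_rfl x = x)
    (u_u : ∀ {m n p : ℕ} (h : m ≤ n) (h' : n ≤ p) (x : X.V m), u h' (u h x) = u (h.trans h') x) :
    RightMod (QSym k a) where
  X := X
  act := actOfMulOne X u u_act gen_u
  act_one := by
    apply day_ext
    intro m n p e x y
    by_cases hn : n = 0
    · subst hn
      obtain rfl : m = p := by omega
      rw [comp_app, whiskerLeft_tmul]
      refine (actOfMulOne_tmul X u _ _ _ _ _).trans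
        (Eq.trans ?_ (rightUnitorHom_tmul _ e x y).symm)
      change Hecke.triv k a 0 (unitVal y) • u _ x = op _ • x
      rw [u_self]
      generalize unitVal y = r
      induction r using Hecke.induction_on with
      | algebraMap c => rw [AlgHom.commutes, AlgHom.commutes, algebraMap_act]; rfl
      | gen i => exact absurd i.2 (by omega)
      | mul r s hr hs =>
        rw [map_mul, map_mul, op_mul_act, mul_smul, ← hr,
          smul_comm (op _) (Hecke.triv k a 0 r) x, ← hs]
      | add r s hr hs => rw [map_add, map_add, MulOpposite.op_add, add_smul, hr, hs, add_smul]
    · rw [unit_eq_zero hn y, tmul_zero, map_zero, map_zero]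
  act_mul := by
    apply day_ext₃'
    intro m n r q p e e' x y z
    rw [comp_app, comp_app, comp_app, whiskerLeft_tmul]
    refine (congrArg (fun w => app (actOfMulOne X u u_act gen_u) p (tmul e' x w))
      (mulS_tmul (k := k) e y z)).trans ?_
    refine (actOfMulOne_tmul X u _ _ _ _ _).trans ?_
    refine Eq.trans ?_ (congrArg (fun w => app (actOfMulOne X u u_act gen_u) p
      (app (actOfMulOne X u u_act gen_u ▷ QSym k a) p w)) (assocInv_tmul e e' x y z)).symm
    rw [whiskerRight_tmul, actOfMulOne_tmul, actOfMulOne_tmul]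
    have key (y z : k) : (y * z) • u (by omega : m ≤ p) x =
        z • u (by omega : m + n ≤ p) (y • u (by omega : m ≤ m + n) x) := by
      rw [map_smul, u_u, smul_smul, mul_comm]
    exact key y z

theorem RightMod.mulOne_ofMulOne (X : Rep k a) (u : ∀ {m p : ℕ}, m ≤ p → X.V m →ₗ[k] X.V p)
    (u_act gen_u u_self u_u) {m p : ℕ} (h : m ≤ p) (x : X.V m) :
    mulOne (RightMod.ofMulOne X u u_act gen_u u_self u_u) h x = u h x :=
  (actOfMulOne_tmul X u u_act gen_u _ x (QSym.one k a (p - m))).trans (one_smul k _)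

/-- Morphisms of right modules commute with the multiplications. -/
theorem mulOne_naturality {M N : RightMod (QSym k a)} (f : M ⟶ N) {m p : ℕ} (h : m ≤ p) (x : M.X.V m) :
    app f.1 p (mulOne M h x) = mulOne N h (app f.1 m x) := by
  have := congrArg (fun g => app g p (tmul (by omega : m + (p - m) = p) x (QSym.one k a (p - m)))) f.2
  refine this.trans ?_
  change app N.act p (app (f.1 ▷ QSym k a) p _) = _
  rw [whiskerRight_tmul]
  rfl

/-- Morphisms of right modules from maps that commute with the multiplications. -/
noncomputable def RightMod.homMk {M N : RightMod (QSym k a)} (f : M.X ⟶ N.X)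
    (hf : ∀ {m p : ℕ} (h : m ≤ p) (x : M.X.V m), app f p (mulOne M h x) = mulOne N h (app f m x)) :
    M ⟶ N :=
  ⟨f, by
    change M.act ≫ f = f ▷ QSym k a ≫ N.act
    apply day_ext
    intro m n p e x c
    rw [comp_app, comp_app, whiskerRight_tmul]
    refine (congrArg (app f p) (act_tmul_one M e x c)).trans ?_
    refine (app_smul f (show k from c) _).trans ?_
    rw [hf]
    exact (act_tmul_one N e _ c).symm⟩

/-- A morphism of right modules with bijective components is an isomorphism. -/
theorem RightMod.isIso_of_bijective {M N : RightMod (QSym k a)} (f : M ⟶ N)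
    (hf : ∀ n, Function.Bijective (app f.1 n)) : IsIso f := by
  let g : N.X ⟶ M.X := ofApp fun n => (LinearEquiv.ofBijective (app f.1 n) (hf n)).symm.toLinearMap
  have hfg (n : ℕ) (y : N.X.V n) : app f.1 n (app g n y) = y :=
    (LinearEquiv.ofBijective (app f.1 n) (hf n)).apply_symm_apply y
  have hgf (n : ℕ) (x : M.X.V n) : app g n (app f.1 n x) = x := (hf n).1 (hfg n _)
  refine ⟨RightMod.homMk g fun h x => ?_, Subtype.ext (hom_ext hgf), Subtype.ext (hom_ext hfg)⟩
  apply (hf _).1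
  rw [hfg, mulOne_naturality, hfg]

end RightModules

/-! ### Vectors on which late generators act by the parameter -/

namespace Tab

variable {m p : ℕ}

theorem apply_eq_of_trunc_eq (h : m ≤ p) {R R' : Tab p} (e : R.trunc h = R'.trunc h) {i : ℕ}
    (hi : i < m) : R.1 i = R'.1 i := by
  rw [← trunc_apply h R hi, e, trunc_apply h R' hi]

/-- If the boxes added after the first `m` do not form a horizontal strip, then they can be added in
an order in which two vertically adjacent boxes follow each other. -/
theorem exists_column_pair (h : m ≤ p) {R : Tab p}
    (hns : ¬ IsHorizontalStrip (R.trunc h).shape R.shape) :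
    ∃ (R' : Tab p) (i : ℕ), m ≤ i ∧ i + 1 < p ∧ R'.trunc h = R.trunc h ∧ R'.shape = R.shape ∧
      R'.1 (i + 1) = ((R'.1 i).1 + 1, (R'.1 i).2) := by
  set l := (R.trunc h).shape with hl
  set μ := R.shape with hμ
  have hle : l ≤ μ := shape_trunc_le h R
  -- Two added boxes in one column force two vertically adjacent added boxes, because the diagrams
  -- are lower sets.
  obtain ⟨i, j, h1, h2, h3⟩ : ∃ i j, (i, j) ∉ l ∧ (i + 1, j) ∈ μ ∧ (i, j) ∈ μ := by
    by_contra hcon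
    refine hns ⟨hle, ?_⟩
    have key (i i' j : ℕ) (a1 : (i, j) ∉ l) (a2 : (i', j) ∈ μ) (hlt : i < i') : False :=
      hcon ⟨i, j, a1, μ.isLowerSet (Prod.mk_le_mk.2 ⟨hlt, le_rfl⟩) a2,
        μ.isLowerSet (Prod.mk_le_mk.2 ⟨hlt.le, le_rfl⟩) a2⟩
    intro i i' j a1 a2 a3 a4
    rcases lt_trichotomy i i' with hlt | e | hlt
    · exact (key i i' j a2 a3 hlt).elim
    · exact e
    · exact (key i' i j a4 a1 hlt).elim
  have h4 : (i + 1, j) ∉ l := fun e =>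
    h1 (l.isLowerSet (Prod.mk_le_mk.2 ⟨Nat.le_succ i, le_rfl⟩) e)
  -- To the inner diagram are added the boxes of the outer one that must precede $(i+1,j)$, except
  -- the pair itself. Then $(i,j)$ and $(i+1,j)$ can be added to `κ` one after the other.
  let κ : YoungDiagram :=
    { cells := l.cells ∪ μ.cells.filter fun b => b ≤ (i + 1, j) ∧ b ≠ (i, j) ∧ b ≠ (i + 1, j)
      isLowerSet := by
        intro b c hcb hb
        simp only [Finset.coe_union, Finset.coe_filter, Set.mem_union, Finset.mem_coe,
          YoungDiagram.mem_cells, Set.mem_ofPred_eq] at hb ⊢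
        rcases hb with hb | ⟨b1, b2, b3, b4⟩
        · exact Or.inl (l.isLowerSet hcb hb)
        · refine Or.inr ⟨μ.isLowerSet hcb b1, hcb.trans b2, ?_, ?_⟩
          · rintro rfl
            have e1 : b.2 = j := le_antisymm b2.2 hcb.2
            have e2 : i ≤ b.1 := hcb.1
            have e3 : b.1 ≤ i + 1 := b2.1
            rcases Nat.lt_or_ge i b.1 with h' | h'
            · exact b4 (Prod.ext (by simp only; omega) e1)
            · exact b3 (Prod.ext (by simp only; omega) e1)
          · rintro rfl
            exact b4 (le_antisymm b2 hcb) }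
  have mem_κ (b : ℕ × ℕ) : b ∈ κ ↔ b ∈ l ∨ b ∈ μ ∧ b ≤ (i + 1, j) ∧ b ≠ (i, j) ∧ b ≠ (i + 1, j) := by
    rw [← YoungDiagram.mem_cells]
    simp [κ]
  have hlκ : l ≤ κ := fun b hb => (mem_κ b).2 (Or.inl hb)
  have card_le {x y : YoungDiagram} (hxy : x ≤ y) : x.card ≤ y.card :=
    Finset.card_le_card (YoungDiagram.cells_subset_iff.2 hxy)
  obtain ⟨T, hT, hTκ⟩ := exists_extension (μ := κ) (h := by
    rw [← card_shape (R.trunc h)]; exact card_le hlκ) rfl (R.trunc h) hlκ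
  have x1 : (i, j) ∉ T.shape := by
    rw [hTκ, mem_κ]
    tauto
  have x2 : ∀ c, c < (i, j) → c ∈ T.shape := by
    intro c hc
    rw [hTκ, mem_κ]
    refine Or.inr ⟨μ.isLowerSet hc.le h3, hc.le.trans ⟨Nat.le_succ i, le_rfl⟩, hc.ne, ?_⟩
    rintro rfl
    have : i + 1 ≤ i := hc.le.1
    omega
  set T' := T.snoc (i, j) x1 x2 with hT'
  have y1 : (i + 1, j) ∉ T'.shape := by
    rw [mem_shape_snoc, hTκ, mem_κ]
    simp [h4]
  have y2 : ∀ c, c < (i + 1, j) → c ∈ T'.shape := by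
    intro c hc
    rw [mem_shape_snoc, hTκ, mem_κ]
    by_cases e : c = (i, j)
    · exact Or.inr e
    · exact Or.inl (Or.inr ⟨μ.isLowerSet hc.le h2, hc.le, e, hc.ne⟩)
  set T'' := T'.snoc (i + 1, j) y1 y2 with hT''
  have hTμ : T''.shape ≤ μ := by
    intro b hb
    rcases (mem_shape_snoc _ _ _ _ b).1 hb with hb | rfl
    · rcases (mem_shape_snoc _ _ _ _ b).1 hb with hb | rfl
      · rw [hTκ, mem_κ] at hb
        rcases hb with hb | hb
        · exact hle hb
        · exact hb.1
      · exact h3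
    · exact h2
  have hp : κ.card + 1 + 1 ≤ p := by
    rw [← card_shape T'', ← card_shape R]
    exact card_le hTμ
  have hm : m ≤ κ.card := by
    rw [← card_shape (R.trunc h)]
    exact card_le hlκ
  obtain ⟨R', hR', hs⟩ := exists_extension hp (card_shape R) T'' hTμ
  have e0 : R'.1 κ.card = (i, j) := by
    rw [← trunc_apply hp R' (by omega), hR', hT'', snoc_apply_lt _ _ _ _ (by omega), hT',
      snoc_apply_self]
  have e1 : R'.1 (κ.card + 1) = (i + 1, j) := by
    rw [← trunc_apply hp R' (by omega), hR', hT'', snoc_apply_self]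
  refine ⟨R', κ.card, hm, by omega, ?_, hs, by rw [e0, e1]⟩
  rw [← hT, ← trunc_trunc (show m ≤ κ.card + 1 + 1 by omega) hp, hR',
    ← trunc_trunc (show m ≤ κ.card + 1 by omega) (Nat.le_succ _), hT'', trunc_snoc,
    ← trunc_trunc hm (Nat.le_succ _), hT', trunc_snoc]

end Tab

section Strip

variable {k : Type u} [Field k] {a : kˣ} {X : Rep k a} {m p : ℕ}

/-- The vector $y\,g_i\,E_{R,T}$ is computed in two ways: $yg_i=ay$, and $g_iE_{R,T}$ follows the
seminormal formula. The diagonal term is moved to the other side. -/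
theorem tabUnit_act_of_gen (ha : IsGeneric a) {y : X.V p} {i : ℕ} (hi : i + 1 < p)
    (hy : op (Hecke.gen ⟨i, hi⟩ : Hecke k a p) • y = (a : k) • y) {R T : Tab p}
    (hs : R.shape = T.shape) :
    ((a : k) - tabCoeff a i R.1) • op (tabUnit ha R T) • y =
      ((a : k) - tabCoeff a i R.1) • Finsupp.linearCombination k
        (fun Q => op (tabUnit ha Q T) • y) (tabVec k p (R.1 ∘ Equiv.swap i (i + 1))) := by
  have h := congrArg (fun r => op r • y) (mul_tabUnit ha (Hecke.gen ⟨i, hi⟩) hs)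
  simp only [op_mul_act, hy, rho_gen_single, map_add, map_smul, Finsupp.linearCombination_single,
    one_smul] at h
  rw [MulOpposite.op_add, add_smul, op_smul, op_smul, smul_assoc, smul_assoc, smul_comm] at h
  have e : op (Finsupp.linearCombination k (fun Q => tabUnit ha Q T)
      (tabVec k p (R.1 ∘ Equiv.swap i (i + 1)))) • y = Finsupp.linearCombination k
        (fun Q => op (tabUnit ha Q T) • y) (tabVec k p (R.1 ∘ Equiv.swap i (i + 1))) := by
    rcases tabVec_swap (k := k) R hi with ⟨-, h0⟩ | ⟨_, h1⟩
    · rw [h0, map_zero, map_zero, op_zero, zero_smul]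
    · rw [h1, Finsupp.linearCombination_single, Finsupp.linearCombination_single, one_smul, one_smul]
  rw [e] at h
  rw [sub_smul, h, add_sub_cancel_left]

theorem tabUnit_act_swap (ha : IsGeneric a) {y : X.V p} {i : ℕ} (hi : i + 1 < p)
    (hy : op (Hecke.gen ⟨i, hi⟩ : Hecke k a p) • y = (a : k) • y) {R T : Tab p}
    (hn : ¬ R.1 i ≤ R.1 (i + 1)) :
    op (tabUnit ha R T) • y = op (tabUnit ha (R.swap hi hn) T) • y := by
  by_cases hs : R.shape = T.shape
  · have h := tabUnit_act_of_gen ha hi hy hs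
    have e : tabVec k p (R.1 ∘ Equiv.swap i (i + 1)) = Finsupp.single (R.swap hi hn) 1 :=
      tabVec_coe (R.swap hi hn)
    rw [e, Finsupp.linearCombination_single, one_smul] at h
    exact smul_right_injective _ (diagCoeff_ne ha (sub_ne_zero.2
      (R.2.content_ne (Nat.lt_succ_self i) hi (by omega)).symm) (R.2.content_of_not_le hi hn).1) h
  · rw [tabUnit_of_ne ha hs, tabUnit_of_ne ha (by rwa [Tab.shape_swap])]

/-- The exchange is not standard, so the right side of `tabUnit_act_of_gen` is zero, and the
coefficient $a-\frac{a^{-1}}{[-1]}=a+a^{-1}=[2]$ on the left is invertible. -/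
theorem tabUnit_act_column (ha : IsGeneric a) {y : X.V p} {i : ℕ} (hi : i + 1 < p)
    (hy : op (Hecke.gen ⟨i, hi⟩ : Hecke k a p) • y = (a : k) • y) {R T : Tab p}
    (hc : R.1 (i + 1) = ((R.1 i).1 + 1, (R.1 i).2)) :
    op (tabUnit ha R T) • y = 0 := by
  by_cases hs : R.shape = T.shape
  · have h := tabUnit_act_of_gen ha hi hy hs
    rw [tabVec_of_not fun h' => IsStd.not_le_of_swap hi h' (by
      rw [hc]; exact ⟨Nat.le_succ _, le_rfl⟩), map_zero, smul_zero] at h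
    refine (smul_eq_zero.1 h).resolve_left (diagCoeff_ne ha ?_ ?_) <;>
      · rw [hc]
        simp only [content]
        push_cast
        omega
  · rw [tabUnit_of_ne ha hs, op_zero, zero_smul]

/-- Two extensions of one tableau to one shape are joined by exchanges of late entries, each of
which leaves the vector fixed. This makes `theta` independent of the chosen extension. -/
theorem tabUnit_act_eq (ha : IsGeneric a) (h : m ≤ p) {y : X.V p}
    (hy : ∀ (i : ℕ) (hi : i + 1 < p), m ≤ i →
      op (Hecke.gen ⟨i, hi⟩ : Hecke k a p) • y = (a : k) • y) {R R' : Tab p} (T : Tab p)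
    (ht : R.trunc h = R'.trunc h) (hs : R.shape = R'.shape) :
    op (tabUnit ha R T) • y = op (tabUnit ha R' T) • y :=
  Tab.connected (m := m) (P := fun R R' => op (tabUnit ha R T) • y = op (tabUnit ha R' T) • y)
    ⟨fun _ => rfl, fun h => h.symm, fun h h' => h.trans h'⟩
    (fun _ i hi hn hm => tabUnit_act_swap ha hi (hy i hi hm) hn) hs
    fun _ hi => Tab.apply_eq_of_trunc_eq h ht hi

/-- The late boxes may be reordered until two vertical neighbours are consecutive. This is the
source of the zero composites in $\mathbf{HS}$. -/
theorem tabUnit_act_eq_zero (ha : IsGeneric a) (h : m ≤ p) {y : X.V p}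
    (hy : ∀ (i : ℕ) (hi : i + 1 < p), m ≤ i →
      op (Hecke.gen ⟨i, hi⟩ : Hecke k a p) • y = (a : k) • y) {R : Tab p} (T : Tab p)
    (hns : ¬ IsHorizontalStrip (R.trunc h).shape R.shape) :
    op (tabUnit ha R T) • y = 0 := by
  obtain ⟨R', i, hm, hi, ht, hs, hc⟩ := Tab.exists_column_pair h hns
  rw [tabUnit_act_eq ha h hy T ht.symm hs.symm]
  exact tabUnit_act_column ha hi (hy i hi hm) hc

end Strip

/-! ### The maps between the tableau components of a right module -/

namespace Tab

variable {m n p : ℕ}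

theorem le_of_shape_le {R : Tab m} {T : Tab p} (h : R.shape ≤ T.shape) : m ≤ p := by
  rw [← card_shape R, ← card_shape T]
  exact Finset.card_le_card (YoungDiagram.cells_subset_iff.2 h)

theorem shape_eq_of_le {R T : Tab n} (h : R.shape ≤ T.shape) : R.shape = T.shape := by
  obtain ⟨R', h1, h2⟩ := exists_extension le_rfl (card_shape T) R h
  rw [← h2, ← h1, trunc_self]

theorem eq_of_shape_eq {R : Tab m} {T : Tab p} (h : R.shape = T.shape) : m = p :=
  le_antisymm (le_of_shape_le h.le) (le_of_shape_le h.ge)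

theorem exists_extension_of_le {R : Tab m} {T : Tab p} (h : R.shape ≤ T.shape) :
    ∃ (h : m ≤ p) (R' : Tab p), R'.trunc h = R ∧ R'.shape = T.shape :=
  ⟨le_of_shape_le h, exists_extension _ (card_shape T) R h⟩

end Tab

section Theta

open _root_.HeckeCat.Rep

variable {k : Type u} [Field k] {a : kˣ} {m n p : ℕ}

open Classical in
/-- The map between the components of a right module at two tableaux. It extends the first tableau
to one of the shape of the second tableau, which can be done in an essentially unique way. -/
noncomputable def theta (ha : IsGeneric a) (M : RightMod (QSym k a)) (R : Tab m) (T : Tab p) :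
    M.X.V m →ₗ[k] M.X.V p :=
  if h : ∃ (h : m ≤ p) (R' : Tab p), R'.trunc h = R ∧ R'.shape = T.shape then
    actMap M.X (tabUnit ha h.choose_spec.choose T) ∘ₗ mulOne M h.choose
  else 0

variable (ha : IsGeneric a) (M : RightMod (QSym k a))

theorem theta_trunc (h : m ≤ p) (R : Tab p) {T : Tab p} (hs : R.shape = T.shape) (x : M.X.V m) :
    theta ha M (R.trunc h) T x = op (tabUnit ha R T) • mulOne M h x := by
  have hex : ∃ (h' : m ≤ p) (R' : Tab p), R'.trunc h' = R.trunc h ∧ R'.shape = T.shape :=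
    ⟨h, R, rfl, hs⟩
  rw [theta, dif_pos hex]
  exact tabUnit_act_eq ha h (fun i hi hm => gen_mulOne M h hi hm x) T
    hex.choose_spec.choose_spec.1 (hex.choose_spec.choose_spec.2.trans hs.symm)

theorem theta_of_not_le {R : Tab m} {T : Tab p} (h : ¬ R.shape ≤ T.shape) : theta ha M R T = 0 := by
  rw [theta, dif_neg]
  rintro ⟨h', R', h1, h2⟩
  apply h
  rw [← h1, ← h2]
  exact Tab.shape_trunc_le h' R'

theorem theta_eq_zero {R : Tab m} {T : Tab p} (h : ¬ IsHorizontalStrip R.shape T.shape) :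
    theta ha M R T = 0 := by
  by_cases hle : R.shape ≤ T.shape
  · obtain ⟨hm, R', rfl, hs⟩ := Tab.exists_extension_of_le hle
    refine LinearMap.ext fun x => ?_
    rw [theta_trunc ha M hm R' hs]
    exact tabUnit_act_eq_zero ha hm (fun i hi hi' => gen_mulOne M hm hi hi' x) T (by rwa [hs])
  · exact theta_of_not_le ha M hle

theorem theta_same (R T : Tab n) (x : M.X.V n) : theta ha M R T x = op (tabUnit ha R T) • x := by
  by_cases hs : R.shape = T.shape
  · have := theta_trunc ha M le_rfl R hs x
    rwa [Tab.trunc_self, mulOne_self] at this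
  · rw [theta_of_not_le ha M (mt Tab.shape_eq_of_le hs), tabUnit_of_ne ha hs, op_zero, zero_smul]
    rfl

/-- Moving the first matrix unit past the second multiplication places it in $H_n\subseteq H_p$.
There it merges with the second matrix unit by grafting, and the graft is an extension of the
initial tableau. -/
theorem theta_theta {R : Tab m} {T : Tab n} {U : Tab p} (h : R.shape ≤ T.shape)
    (h' : T.shape ≤ U.shape) (x : M.X.V m) :
    theta ha M T U (theta ha M R T x) = theta ha M R U x := by
  obtain ⟨hm, R', rfl, hs⟩ := Tab.exists_extension_of_le h
  obtain ⟨hn, T', rfl, hs'⟩ := Tab.exists_extension_of_le h'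
  rw [theta_trunc ha M hm R' hs, theta_trunc ha M hn T' hs', mulOne_act, mulOne_mulOne,
    ← op_mul_act, shift_tabUnit_mul ha hn _ hs hs',
    ← theta_trunc ha M (hm.trans hn) _ ((Tab.shape_graft hn hs).trans hs'), ← Tab.trunc_trunc hm hn,
    Tab.trunc_graft]

theorem theta_mulOne (h : m ≤ p) (T : Tab p) {U : Tab n} (hs : T.shape = U.shape) (x : M.X.V m) :
    theta ha M T U (mulOne M h x) = theta ha M (T.trunc h) U x := by
  obtain rfl := Tab.eq_of_shape_eq hs
  rw [theta_trunc ha M h T hs, theta_same]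

/-- With `theta_mulOne`, this expresses the module structure in components. The formulas match the
definitions of `tabAct` and `tabMul`. -/
theorem theta_act (T : Tab n) {U : Tab p} (hs : T.shape = U.shape) (r : Hecke k a n) (x : M.X.V n) :
    theta ha M T U (op r • x) = Finsupp.linearCombination k (fun R => theta ha M R U x)
      (rho ha n r (Finsupp.single T 1)) := by
  obtain rfl := Tab.eq_of_shape_eq hs
  rw [theta_same, ← op_mul_act, mul_tabUnit ha r hs, Finsupp.linearCombination_apply,
    Finsupp.linearCombination_apply, Finsupp.sum, Finsupp.sum, Finset.op_sum, Finset.sum_smul]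
  refine Finset.sum_congr rfl fun R _ => ?_
  rw [op_smul, smul_assoc, theta_same]

theorem sum_theta (x : M.X.V n) : ∑ T : Tab n, theta ha M T T x = x := by
  simp only [theta_same]
  rw [← Finset.sum_smul, ← Finset.op_sum, sum_tabUnit, op_one, one_smul]

end Theta

/-! ### Representations of the horizontal strip category -/

section Phi

variable {k : Type u} [Field k]

open Classical in
variable (k) in
/-- The morphism `μ ∖ λ`, which is zero if this is not a horizontal strip. -/
noncomputable def HS.strip (l m : YoungDiagram) : (⟨l⟩ : HS k) ⟶ ⟨m⟩ :=
  (⟨if IsHorizontalStrip l m then 1 else 0, fun h => if_neg h⟩ : HS.Hom ⟨l⟩ ⟨m⟩)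

theorem HS.strip_self (l : YoungDiagram) : HS.strip k l l = 𝟙 _ :=
  Subtype.ext (if_pos (IsHorizontalStrip.refl l))

theorem HS.strip_eq_zero {l m : YoungDiagram} (h : ¬ IsHorizontalStrip l m) :
    HS.strip k l m = 0 :=
  Subtype.ext (if_neg h)

/-- For nested diagrams, if the outer skew shape is a horizontal strip then so are both parts;
otherwise the composite is zero by definition. -/
theorem HS.strip_comp {l m n : YoungDiagram} (h : l ≤ m) (h' : m ≤ n) :
    HS.strip k l m ≫ HS.strip k m n = HS.strip k l n := by
  apply Subtype.ext
  by_cases hs : IsHorizontalStrip l n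
  · have e1 : (HS.strip k l n).1 = 1 := if_pos hs
    have e2 : (HS.strip k l m).1 = 1 := if_pos (hs.left h h')
    have e3 : (HS.strip k m n).1 = 1 := if_pos (hs.right h h')
    refine (HS.comp_val (HS.strip k l m) (HS.strip k m n) hs).trans ?_
    rw [e1, e2, e3, one_mul]
  · exact (if_neg hs).trans (if_neg hs).symm

theorem HS.eq_smul_strip {l m : HS k} (f : l ⟶ m) : f = f.1 • HS.strip k l.shape m.shape := by
  apply Subtype.ext
  change f.1 = f.1 * (HS.strip k l.shape m.shape).1
  by_cases h : IsHorizontalStrip l.shape m.shape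
  · have e : (HS.strip k l.shape m.shape).1 = 1 := if_pos h
    rw [e, mul_one]
  · rw [f.2 h, zero_mul]

/-- The action of `μ ∖ λ` on a representation of the horizontal strip category. -/
noncomputable def phi (F : HS k ⥤ ModuleCat.{u} k) (l m : YoungDiagram) : F.obj ⟨l⟩ →ₗ[k] F.obj ⟨m⟩ :=
  (F.map (HS.strip k l m)).hom

variable (F : HS k ⥤ ModuleCat.{u} k)

theorem phi_self (l : YoungDiagram) (x : F.obj ⟨l⟩) : phi F l l x = x := by
  rw [phi, HS.strip_self, F.map_id]
  rfl

theorem phi_phi {l m n : YoungDiagram} (h : l ≤ m) (h' : m ≤ n) (x : F.obj ⟨l⟩) :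
    phi F m n (phi F l m x) = phi F l n x := by
  rw [phi, phi, phi, ← HS.strip_comp h h', F.map_comp]
  rfl

theorem phi_eq_zero [F.Additive] {l m : YoungDiagram} (h : ¬ IsHorizontalStrip l m)
    (x : F.obj ⟨l⟩) : phi F l m x = 0 := by
  rw [phi, HS.strip_eq_zero h, F.map_zero]
  rfl

theorem map_eq_smul_phi [F.Additive] [F.Linear k] {l m : HS k} (f : l ⟶ m) (x : F.obj l) :
    (F.map f).hom x = f.1 • phi F l.shape m.shape x := by
  conv_lhs => rw [HS.eq_smul_strip f, F.map_smul]
  rfl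

/-- For equal diagrams `phi` is the identification of the two values of `F`. It is used as the
transport between tableaux whose shapes are only provably equal. -/
theorem phi_phi_of_eq_left {l m n : YoungDiagram} (h : l = m) (x : F.obj ⟨l⟩) :
    phi F m n (phi F l m x) = phi F l n x := by
  subst h
  rw [phi_self]

theorem phi_phi_of_eq_right {l m n : YoungDiagram} (h : m = n) (x : F.obj ⟨l⟩) :
    phi F m n (phi F l m x) = phi F l n x := by
  subst h
  rw [phi_self]

theorem phi_naturality {F G : HS k ⥤ ModuleCat.{u} k} (η : F ⟶ G) (l m : YoungDiagram)
    (x : F.obj ⟨l⟩) : (η.app ⟨m⟩).hom (phi F l m x) = phi G l m ((η.app ⟨l⟩).hom x) :=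
  congrArg (fun f => f.hom x) (η.naturality (HS.strip k l m))

variable {n : ℕ}

theorem phi_congr (x : ∀ T : Tab n, F.obj ⟨T.shape⟩) {Q Q' : Tab n} (h : Q = Q') (l : YoungDiagram) :
    phi F Q.shape l (x Q) = phi F Q'.shape l (x Q') := by
  rw [h]

theorem phi_of_shape_ne [F.Additive] {Q R : Tab n} (h : Q.shape ≠ R.shape) (x : F.obj ⟨Q.shape⟩) :
    phi F Q.shape R.shape x = 0 :=
  phi_eq_zero F (fun hs => h (Tab.shape_eq_of_le hs.1)) x

end Phi

/-! ### The right module of a representation of the horizontal strip category -/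

section TabRep

open _root_.HeckeCat.Rep

variable {k : Type u} [Field k] {a : kˣ} {m n p : ℕ} (ha : IsGeneric a)
  (F : HS k ⥤ ModuleCat.{u} k)

/-- Families of vectors in the values of a representation at the shapes of the standard tableaux. -/
abbrev TabFam (F : HS k ⥤ ModuleCat.{u} k) (n : ℕ) : Type u := ∀ T : Tab n, F.obj ⟨T.shape⟩

/-- The transport of all components of `x` to the component of `T`. -/
noncomputable def gather (x : TabFam F n) (l : YoungDiagram) :
    (Tab n →₀ k) →ₗ[k] F.obj ⟨l⟩ :=
  Finsupp.linearCombination k fun R => phi F R.shape l (x R)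

theorem gather_single (x : TabFam F n) (l : YoungDiagram) (R : Tab n) :
    gather F x l (Finsupp.single R 1) = phi F R.shape l (x R) := by
  rw [gather, Finsupp.linearCombination_single, one_smul]

theorem gather_add (x y : TabFam F n) (l : YoungDiagram) :
    gather F (x + y) l = gather F x l + gather F y l := by
  refine Finsupp.lhom_ext' fun R => LinearMap.ext_ring ?_
  change gather F (x + y) l (Finsupp.single R 1) =
    gather F x l (Finsupp.single R 1) + gather F y l (Finsupp.single R 1)
  rw [gather_single, gather_single, gather_single, ← map_add]
  rfl

theorem gather_smul (c : k) (x : TabFam F n) (l : YoungDiagram) :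
    gather F (c • x) l = c • gather F x l := by
  refine Finsupp.lhom_ext' fun R => LinearMap.ext_ring ?_
  change gather F (c • x) l (Finsupp.single R 1) = c • gather F x l (Finsupp.single R 1)
  rw [gather_single, gather_single, ← map_smul]
  rfl

/-- Only tableaux of the shape of `R` occur in the image of its basis vector, so the first transport
is an identification. -/
theorem phi_gather (x : TabFam F n) (r : Hecke k a n) (R : Tab n)
    (T : Tab n) : phi F R.shape T.shape (gather F x R.shape (rho ha n r (Finsupp.single R 1))) =
      gather F x T.shape (rho ha n r (Finsupp.single R 1)) := by
  rw [gather, gather, Finsupp.linearCombination_apply, Finsupp.linearCombination_apply, Finsupp.sum,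
    Finsupp.sum, map_sum]
  refine Finset.sum_congr rfl fun Q hQ => ?_
  have hQR : Q.shape = R.shape := by
    by_contra hne
    exact (Finsupp.mem_support_iff.1 hQ) (rho_apply_eq_zero ha r hne)
  rw [map_smul, phi_phi_of_eq_left F hQR]

/-- The right action of `H_n` on the families of components. -/
noncomputable def tabAct (n : ℕ) :
    (Hecke k a n)ᵐᵒᵖ →ₐ[k] Module.End k (TabFam F n) :=
  AlgHom.ofLinearMap
    { toFun := fun r =>
        { toFun := fun x T => gather F x T.shape (rho ha n (unop r) (Finsupp.single T 1))
          map_add' := fun x y => by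
            funext T
            rw [gather_add]
            rfl
          map_smul' := fun c x => by
            funext T
            rw [gather_smul]
            rfl }
      map_add' := fun r s => LinearMap.ext fun x => by
        funext T
        change gather F x T.shape (rho ha n (unop (r + s)) _) =
          gather F x T.shape (rho ha n (unop r) _) + gather F x T.shape (rho ha n (unop s) _)
        rw [MulOpposite.unop_add, map_add, LinearMap.add_apply, map_add]
      map_smul' := fun c r => LinearMap.ext fun x => by
        funext T
        change gather F x T.shape (rho ha n (unop (c • r)) _) =
          c • gather F x T.shape (rho ha n (unop r) _)
        rw [unop_smul, map_smul, LinearMap.smul_apply, map_smul] }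
    (LinearMap.ext fun x => by
      funext T
      change gather F x T.shape (rho ha n (unop 1) _) = x T
      rw [unop_one, map_one, Module.End.one_apply, gather_single, phi_self])
    (fun r s => LinearMap.ext fun x => by
      funext T
      change gather F x T.shape (rho ha n (unop (r * s)) _) =
        gather F (fun R => gather F x R.shape (rho ha n (unop s) (Finsupp.single R 1))) T.shape
          (rho ha n (unop r) _)
      rw [unop_mul, map_mul, Module.End.mul_apply]
      -- A family is a row vector on which the matrices of `rho` act from the right; this is
      -- associativity of the matrix product.
      have key : (gather F x T.shape).comp (rho ha n (unop s)) =
          gather F (fun R => gather F x R.shape (rho ha n (unop s) (Finsupp.single R 1))) T.shape := by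
        refine Finsupp.lhom_ext' fun R => LinearMap.ext_ring ?_
        change gather F x T.shape (rho ha n (unop s) (Finsupp.single R 1)) =
          gather F (fun R => gather F x R.shape (rho ha n (unop s) (Finsupp.single R 1))) T.shape
            (Finsupp.single R 1)
        rw [gather_single, phi_gather]
      exact LinearMap.congr_fun key _)

theorem tabAct_apply (r : Hecke k a n) (x : TabFam F n) (T : Tab n) :
    tabAct ha F n (op r) x T = gather F x T.shape (rho ha n r (Finsupp.single T 1)) := rfl

/-- Functoriality of families. -/
noncomputable def tabFamMap {F G : HS k ⥤ ModuleCat.{u} k} (η : F ⟶ G) (n : ℕ) :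
    TabFam F n →ₗ[k] TabFam G n where
  toFun x T := (η.app ⟨T.shape⟩).hom (x T)
  map_add' x y := by
    funext T
    exact map_add (η.app ⟨T.shape⟩).hom (x T) (y T)
  map_smul' c x := by
    funext T
    exact map_smul (η.app ⟨T.shape⟩).hom c (x T)

theorem tabFamMap_act {F G : HS k ⥤ ModuleCat.{u} k} (η : F ⟶ G) (r : Hecke k a n)
    (x : TabFam F n) :
    tabFamMap η n (tabAct ha F n (op r) x) = tabAct ha G n (op r) (tabFamMap η n x) := by
  funext T
  rw [tabAct_apply]
  change (η.app ⟨T.shape⟩).hom (gather F x T.shape (rho ha n r _)) = _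
  have key : (η.app ⟨T.shape⟩).hom.comp (gather F x T.shape) =
      gather G (tabFamMap η n x) T.shape := by
    refine Finsupp.lhom_ext' fun R => LinearMap.ext_ring ?_
    change (η.app ⟨T.shape⟩).hom (gather F x T.shape (Finsupp.single R 1)) =
      gather G (tabFamMap η n x) T.shape (Finsupp.single R 1)
    rw [gather_single, gather_single, phi_naturality]
    rfl
  exact LinearMap.congr_fun key _

/-- The multiplications by the basis vectors. -/
noncomputable def tabMul (h : m ≤ p) : TabFam F m →ₗ[k] TabFam F p where
  toFun x T := phi F (T.trunc h).shape T.shape (x (T.trunc h))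
  map_add' x y := by
    funext T
    exact map_add (phi F (T.trunc h).shape T.shape) (x (T.trunc h)) (y (T.trunc h))
  map_smul' c x := by
    funext T
    exact map_smul (phi F (T.trunc h).shape T.shape) c (x (T.trunc h))

theorem tabMul_apply (h : m ≤ p) (x : TabFam F m) (T : Tab p) :
    tabMul F h x T = phi F (T.trunc h).shape T.shape (x (T.trunc h)) := rfl

theorem tabMul_self (x : TabFam F m) : tabMul F le_rfl x = x := by
  funext T
  rw [tabMul_apply]
  exact (phi_congr F x (Tab.trunc_self le_rfl T) T.shape).trans (phi_self F _ _)

theorem tabMul_tabMul (h : m ≤ n) (h' : n ≤ p) (x : TabFam F m) :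
    tabMul F h' (tabMul F h x) = tabMul F (h.trans h') x := by
  funext T
  rw [tabMul_apply, tabMul_apply, tabMul_apply,
    phi_phi F (Tab.shape_trunc_le h _) (Tab.shape_trunc_le h' _)]
  exact phi_congr F x (Tab.trunc_trunc h h' T) T.shape

variable [F.Additive]

theorem tabMul_act (h : m ≤ p) (r : Hecke k a m) (x : TabFam F m) :
    tabMul F h (tabAct ha F m (op r) x) =
      tabAct ha F p (op (Hecke.shift 0 (by omega : 0 + m ≤ p) r)) (tabMul F h x) := by
  funext T
  rw [tabMul_apply, tabAct_apply, tabAct_apply, rho_shift_single ha h]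
  have key : (phi F (T.trunc h).shape T.shape).comp (gather F x (T.trunc h).shape) =
      (gather F (tabMul F h x) T.shape).comp (graftMap k h T) := by
    refine Finsupp.lhom_ext' fun Q => LinearMap.ext_ring ?_
    change phi F (T.trunc h).shape T.shape (gather F x (T.trunc h).shape (Finsupp.single Q 1)) =
      gather F (tabMul F h x) T.shape (graftMap k h T (Finsupp.single Q 1))
    rw [gather_single]
    by_cases hs : Q.shape = (T.trunc h).shape
    · rw [graftMap_single h T hs, gather_single, tabMul_apply, phi_phi_of_eq_left F hs,
        phi_phi_of_eq_right F (Tab.shape_graft h hs)]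
      exact phi_congr F x (Tab.trunc_graft h hs).symm T.shape
    · rw [graftMap_single_of_ne h T hs, map_zero, phi_of_shape_ne F hs, map_zero]
  exact LinearMap.congr_fun key _

/-- For boxes adjacent in a row the coefficient is $a$. For boxes adjacent in a column the added
boxes are no horizontal strip and the component is zero. Otherwise the exchanged tableau has the
same truncation and shape, hence the same component up to identification, and $c+(a-c)=a$. -/
theorem gen_tabMul (h : m ≤ p) {i : ℕ} (hi : i + 1 < p) (hm : m ≤ i) (x : TabFam F m) :
    tabAct ha F p (op (Hecke.gen ⟨i, hi⟩)) (tabMul F h x) = (a : k) • tabMul F h x := by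
  funext T
  rw [tabAct_apply, rho_gen_single, map_add, map_smul, map_smul, gather_single, phi_self]
  change _ = (a : k) • tabMul F h x T
  rcases tabVec_swap (k := k) T hi with ⟨hle, h0⟩ | ⟨hn, h1⟩
  · rw [h0, map_zero, smul_zero, add_zero]
    rcases T.2.adjacent hi hle with e | e
    · have : tabCoeff a i T.1 = (a : k) := by
        rw [tabCoeff, e, ← diagCoeff_one]
        congr 1
        simp only [content]
        push_cast
        ring
      rw [this]
    · have : tabMul F h x T = 0 := by
        refine phi_eq_zero F (fun hs => ?_) _
        have notMem (j : ℕ) (hj : j < p) (hmj : m ≤ j) : T.1 j ∉ (T.trunc h).shape := by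
          intro hmem
          obtain ⟨l, hl, el⟩ := Tab.mem_shape.1 hmem
          rw [Tab.trunc_apply _ _ hl] at el
          have := T.2.inj l j (by omega) hj el
          omega
        have h1 := notMem i (by omega) hm
        have h2 := notMem (i + 1) hi (by omega)
        have h3 := T.apply_mem_shape (show i < p by omega)
        have h4 := T.apply_mem_shape hi
        rw [e] at h2 h4
        have := hs.2 (T.1 i).1 ((T.1 i).1 + 1) (T.1 i).2 h3 h1 h4 h2
        omega
      rw [this, smul_zero, smul_zero]
  · rw [h1, gather_single, tabMul_apply, tabMul_apply,
      phi_phi_of_eq_right F (Tab.shape_swap T hi hn)]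
    have e : (T.swap hi hn).trunc h = T.trunc h := by
      refine Tab.ext fun j hj => ?_
      rw [Tab.trunc_apply _ _ hj, Tab.trunc_apply _ _ hj]
      simp only [Tab.swap, Function.comp_apply]
      rw [Equiv.swap_apply_of_ne_of_ne (by omega) (by omega)]
    rw [phi_congr F x e, ← add_smul, add_sub_cancel]

/-- The presheaf of a representation of the horizontal strip category: in degree `n` it is the
product of the values at the shapes of the standard tableaux of size `n`. -/
noncomputable def tabRep : Rep k a where
  V n := TabFam F n
  modH n := Module.compHom _ (tabAct ha F n).toRingHom
  tower n := by
    let _ := Module.compHom (TabFam F n) (tabAct ha F n).toRingHom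
    refine ⟨fun c r x => ?_⟩
    change tabAct ha F n (c • r) x = c • tabAct ha F n r x
    rw [map_smul, LinearMap.smul_apply]

/-- The right module of a representation of the horizontal strip category. -/
noncomputable def tabMod : RightMod (QSym k a) :=
  RightMod.ofMulOne (tabRep ha F) (fun h => tabMul F h) (tabMul_act ha F)
    (gen_tabMul ha F) (tabMul_self F) (tabMul_tabMul F)

theorem mulOne_tabMod (h : m ≤ p) (x : (tabMod ha F).X.V m) (T : Tab p) :
    mulOne (tabMod ha F) h x T = phi F (T.trunc h).shape T.shape (x (T.trunc h)) :=
  congrFun (RightMod.mulOne_ofMulOne (tabRep ha F) (fun h => tabMul F h) (tabMul_act ha F)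
    (gen_tabMul ha F) (tabMul_self F) (tabMul_tabMul F) h x) T

/-- Functoriality of `tabMod`. -/
noncomputable def tabModMap {F G : HS k ⥤ ModuleCat.{u} k} [F.Additive] [G.Additive] (η : F ⟶ G) :
    tabMod ha F ⟶ tabMod ha G :=
  RightMod.homMk
    (ofApp fun n =>
      { toFun := tabFamMap η n
        map_add' := map_add (tabFamMap η n)
        map_smul' := fun r => tabFamMap_act ha η (unop r) })
    fun h x => by
      funext T
      rw [mulOne_tabMod]
      change (η.app ⟨T.shape⟩).hom (mulOne (tabMod ha F) h x T) = _
      rw [mulOne_tabMod, phi_naturality]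
      rfl

theorem tabModMap_apply {F G : HS k ⥤ ModuleCat.{u} k} [F.Additive] [G.Additive] (η : F ⟶ G)
    (x : (tabMod ha F).X.V n) (T : Tab n) :
    app (tabModMap ha η).1 n x T = (η.app ⟨T.shape⟩).hom (x T) := rfl

end TabRep

/-! ### The equivalence -/

section Equivalence

open _root_.HeckeCat.Rep

variable {k : Type u} [Field k] {a : kˣ} {m n p : ℕ} (ha : IsGeneric a)

instance (F : LinRep k (HS k)) : F.obj.Additive := F.property.1

instance (F : LinRep k (HS k)) : F.obj.Linear k := F.property.2

variable (a) in
/-- The functor from the representations of the horizontal strip category to the right modules over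
the quantum symmetric algebra. -/
noncomputable def toRightMod : LinRep k (HS k) ⥤ RightMod (QSym k a) where
  obj F := tabMod ha F.obj
  map η := tabModMap ha η.hom
  map_id _ := Subtype.ext (hom_ext fun _ _ => rfl)
  map_comp _ _ := Subtype.ext (hom_ext fun _ _ => rfl)

instance : (toRightMod a ha).Additive where
  map_add := Subtype.ext (hom_ext fun _ _ => rfl)

instance : (toRightMod a ha).Linear k where
  map_smul _ _ := Subtype.ext (hom_ext fun _ _ => rfl)

/-- A standard tableau of shape `l`. -/
noncomputable def stdTab (l : YoungDiagram) : Tab l.card := (Tab.exists_shape l).choose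

@[simp]
theorem shape_stdTab (l : YoungDiagram) : (stdTab l).shape = l := (Tab.exists_shape l).choose_spec

/-! ### Morphisms between the modules of representations. -/

section Full

variable {F G : HS k ⥤ ModuleCat.{u} k} [F.Additive] [G.Additive]

theorem tabUnit_act_tabMod {S T : Tab n} (hs : S.shape = T.shape) (x : (tabMod ha F).X.V n)
    (R : Tab n) : (op (tabUnit ha S T) • x) R =
      gather F x R.shape (Finsupp.single S (Finsupp.single R (1 : k) T)) := by
  have key (x : TabFam F n) : tabAct ha F n (op (tabUnit ha S T)) x R =
      gather F x R.shape (Finsupp.single S (Finsupp.single R (1 : k) T)) := by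
    rw [tabAct_apply, rho_tabUnit ha hs, matUnit_apply]
  exact key x

theorem tabUnit_act_tabMod_same {S T : Tab n} (hs : S.shape = T.shape) (x : (tabMod ha F).X.V n) :
    (op (tabUnit ha S T) • x) T = phi F S.shape T.shape (x S) := by
  rw [tabUnit_act_tabMod ha hs, Finsupp.single_eq_same]
  exact gather_single F x T.shape S

/-- The element of the module of `F` with a single component. -/
noncomputable def tabSingle (T : Tab n) (x : F.obj ⟨T.shape⟩) : (tabMod ha F).X.V n :=
  (Pi.single T x : TabFam F n)

theorem tabSingle_same (T : Tab n) (x : F.obj ⟨T.shape⟩) : tabSingle ha T x T = x :=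
  Pi.single_eq_same (M := fun T : Tab n => F.obj ⟨T.shape⟩) T x

/-- The diagonal matrix units are the projections to the components, so the components can be
recovered from the module structure. -/
theorem tabUnit_self_act (T : Tab n) (x : (tabMod ha F).X.V n) :
    op (tabUnit ha T T) • x = tabSingle ha T (x T) := by
  funext R
  rw [tabUnit_act_tabMod ha rfl]
  by_cases h : R = T
  · subst h
    rw [Finsupp.single_eq_same, tabSingle_same]
    exact (gather_single F x R.shape R).trans (phi_self F _ _)
  · rw [Finsupp.single_eq_of_ne (Ne.symm h), Finsupp.single_zero, map_zero]
    exact (Pi.single_eq_of_ne (M := fun T : Tab n => F.obj ⟨T.shape⟩) h _).symm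

variable (f : tabMod ha F ⟶ tabMod ha G)

/-- The component of a morphism at a tableau. -/
noncomputable def tabComp (T : Tab n) : F.obj ⟨T.shape⟩ →ₗ[k] G.obj ⟨T.shape⟩ where
  toFun x := app f.1 n (tabSingle ha T x) T
  map_add' x y := by
    have e : tabSingle ha T (x + y) = tabSingle ha T x + tabSingle ha T y :=
      Pi.single_add (f := fun T : Tab n => F.obj ⟨T.shape⟩) T x y
    rw [e, map_add]
    rfl
  map_smul' c x := by
    have e : tabSingle ha T (c • x) = c • tabSingle ha T x :=
      Pi.single_smul (f := fun T : Tab n => F.obj ⟨T.shape⟩) T c x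
    rw [e, app_smul]
    rfl

/-- A morphism commutes with the projections of `tabUnit_self_act`, hence acts componentwise. -/
theorem app_eq_tabComp (x : (tabMod ha F).X.V n) (T : Tab n) :
    app f.1 n x T = tabComp ha f T (x T) := by
  have h1 := congrFun (tabUnit_self_act ha T (app f.1 n x)) T
  rw [tabSingle_same, ← map_smul, tabUnit_self_act] at h1
  exact h1.symm

/-- The map between two shapes factors through an extension of `S` to the shape of `T`. The first
factor is a component of `mulOne`, the second the action of a matrix unit, and a morphism respects
both. -/
theorem tabComp_phi (S : Tab m) (T : Tab n) (x : F.obj ⟨S.shape⟩) :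
    tabComp ha f T (phi F S.shape T.shape x) = phi G S.shape T.shape (tabComp ha f S x) := by
  by_cases hle : S.shape ≤ T.shape
  · obtain ⟨h, S', rfl, hs⟩ := Tab.exists_extension_of_le hle
    have h1 : tabComp ha f S' (phi F (S'.trunc h).shape S'.shape x) =
        phi G (S'.trunc h).shape S'.shape (tabComp ha f (S'.trunc h) x) := by
      have := congrFun (mulOne_naturality f h (tabSingle ha (S'.trunc h) x)) S'
      rwa [mulOne_tabMod, app_eq_tabComp, mulOne_tabMod, app_eq_tabComp, tabSingle_same] at this
    have h2 (y : F.obj ⟨S'.shape⟩) : tabComp ha f T (phi F S'.shape T.shape y) =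
        phi G S'.shape T.shape (tabComp ha f S' y) := by
      have := congrFun (map_smul (app f.1 n) (op (tabUnit ha S' T)) (tabSingle ha S' y)) T
      rwa [tabUnit_act_tabMod_same ha hs, app_eq_tabComp, tabUnit_act_tabMod_same ha hs,
        app_eq_tabComp, tabSingle_same] at this
    rw [← phi_phi_of_eq_right F hs, h2, h1, phi_phi_of_eq_right G hs]
  · rw [phi_eq_zero F fun hs => hle hs.1, phi_eq_zero G fun hs => hle hs.1, map_zero]

/-- The natural transformation of a morphism between the modules of representations. -/
noncomputable def natTransOfHom [F.Linear k] [G.Linear k] : F ⟶ G where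
  app l := ModuleCat.ofHom ((phi G (stdTab l.shape).shape l.shape).comp
    ((tabComp ha f (stdTab l.shape)).comp (phi F l.shape (stdTab l.shape).shape)))
  naturality l m g := by
    refine ModuleCat.hom_ext (LinearMap.ext fun x => ?_)
    change phi G _ m.shape (tabComp ha f (stdTab m.shape)
      (phi F m.shape (stdTab m.shape).shape ((F.map g).hom x))) =
        (G.map g).hom (phi G _ l.shape (tabComp ha f (stdTab l.shape)
          (phi F l.shape (stdTab l.shape).shape x)))
    rw [map_eq_smul_phi F, map_eq_smul_phi G, map_smul, map_smul, map_smul]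
    congr 1
    have hl := shape_stdTab l.shape
    have hm := shape_stdTab m.shape
    rw [phi_phi_of_eq_right F hm.symm, phi_phi_of_eq_left G hl,
      ← phi_phi_of_eq_left F (m := (stdTab l.shape).shape) hl.symm, tabComp_phi,
      phi_phi_of_eq_right G hm]

theorem tabModMap_natTransOfHom [F.Linear k] [G.Linear k] :
    tabModMap ha (natTransOfHom ha f) = f := by
  refine Subtype.ext (hom_ext fun n x => ?_)
  funext T
  rw [tabModMap_apply, app_eq_tabComp]
  change phi G _ T.shape (tabComp ha f (stdTab T.shape) (phi F T.shape _ (x T))) = _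
  rw [← tabComp_phi, phi_phi_of_eq_right F (shape_stdTab T.shape), phi_self]

end Full

instance : (toRightMod a ha).Full where
  map_surjective f := ⟨ObjectProperty.homMk (natTransOfHom ha f), tabModMap_natTransOfHom ha f⟩

instance : (toRightMod a ha).Faithful where
  map_injective {F G η θ} h := by
    refine ObjectProperty.hom_ext _ (NatTrans.ext (funext fun l => ?_))
    obtain ⟨l⟩ := l
    obtain ⟨n, T, rfl⟩ : ∃ (n : ℕ) (T : Tab n), T.shape = l := ⟨_, Tab.exists_shape l⟩
    refine ModuleCat.hom_ext (LinearMap.ext fun x => ?_)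
    have h1 : tabModMap ha η.hom = tabModMap ha θ.hom := h
    have h2 := congrFun (congrArg (fun f : tabMod ha F.obj ⟶ tabMod ha G.obj =>
      app f.1 n (tabSingle ha T x)) h1) T
    rwa [tabModMap_apply, tabModMap_apply, tabSingle_same] at h2

/-! ### Recovering a module from its multiplicity spaces. -/

section EssSurj

variable (M : RightMod (QSym k a))

theorem theta_theta_of_ne {S T : Tab n} (h : S ≠ T) (R : Tab m) (U : Tab p) (x : M.X.V m) :
    theta ha M T U (theta ha M R S x) = 0 := by
  by_cases h1 : R.shape ≤ S.shape
  · by_cases h2 : T.shape ≤ U.shape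
    · rw [← theta_theta ha M h1 le_rfl, ← theta_theta ha M le_rfl h2, theta_same ha M T T,
        theta_same ha M S S, ← op_mul_act, tabUnit_mul_of_ne ha S h, op_zero, zero_smul, map_zero]
    · rw [theta_of_not_le ha M h2, LinearMap.zero_apply]
  · rw [theta_of_not_le ha M h1, LinearMap.zero_apply, map_zero]

theorem theta_theta_self (R : Tab m) (T : Tab n) (x : M.X.V m) :
    theta ha M T T (theta ha M R T x) = theta ha M R T x := by
  by_cases h : R.shape ≤ T.shape
  · exact theta_theta ha M h le_rfl x
  · rw [theta_of_not_le ha M h, LinearMap.zero_apply, map_zero]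

/-- The multiplicity space of a partition in a right module. -/
noncomputable def multSpace (l : YoungDiagram) : Submodule k (M.X.V l.card) :=
  LinearMap.eqLocus (theta ha M (stdTab l) (stdTab l)) LinearMap.id

theorem theta_mem_multSpace (R : Tab m) (l : YoungDiagram) (x : M.X.V m) :
    theta ha M R (stdTab l) x ∈ multSpace ha M l :=
  theta_theta_self ha M R (stdTab l) x

/-- The map to a multiplicity space. -/
noncomputable def toMultSpace (R : Tab m) (l : YoungDiagram) : M.X.V m →ₗ[k] multSpace ha M l :=
  (theta ha M R (stdTab l)).codRestrict _ (theta_mem_multSpace ha M R l)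

/-- The maps between the multiplicity spaces. -/
noncomputable def multMap (l m : YoungDiagram) : multSpace ha M l →ₗ[k] multSpace ha M m :=
  (toMultSpace ha M (stdTab l) m).comp (multSpace ha M l).subtype

theorem multMap_self (l : YoungDiagram) (x : multSpace ha M l) : multMap ha M l l x = x :=
  Subtype.ext x.2

theorem multMap_toMultSpace {T : Tab n} {l m : YoungDiagram} (h : T.shape ≤ l) (h' : l ≤ m)
    (x : M.X.V n) : multMap ha M l m (toMultSpace ha M T l x) = toMultSpace ha M T m x :=
  Subtype.ext (theta_theta ha M (by rwa [shape_stdTab]) (by rwa [shape_stdTab, shape_stdTab]) x)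

theorem multMap_multMap {l m n : YoungDiagram} (h : l ≤ m) (h' : m ≤ n) (x : multSpace ha M l) :
    multMap ha M m n (multMap ha M l m x) = multMap ha M l n x :=
  multMap_toMultSpace ha M (by rwa [shape_stdTab]) h' x.1

theorem multMap_eq_zero {l m : YoungDiagram} (h : ¬ IsHorizontalStrip l m) (x : multSpace ha M l) :
    multMap ha M l m x = 0 := by
  apply Subtype.ext
  change theta ha M (stdTab l) (stdTab m) x.1 = 0
  rw [theta_eq_zero ha M (by rwa [shape_stdTab, shape_stdTab]), LinearMap.zero_apply]

/-- The representation of the horizontal strip category on the multiplicity spaces. -/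
noncomputable def multRep : HS k ⥤ ModuleCat.{u} k where
  obj l := ModuleCat.of k (multSpace ha M l.shape)
  map {l m} f := ModuleCat.ofHom (f.1 • multMap ha M l.shape m.shape)
  map_id l := by
    refine ModuleCat.hom_ext (LinearMap.ext fun x => ?_)
    change (1 : k) • multMap ha M l.shape l.shape x = x
    rw [one_smul, multMap_self]
  map_comp {l m n} f g := by
    refine ModuleCat.hom_ext (LinearMap.ext fun x => ?_)
    change (HS.comp f g).1 • multMap ha M l.shape n.shape x =
      g.1 • multMap ha M m.shape n.shape (f.1 • multMap ha M l.shape m.shape x)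
    have e : (HS.comp f g).1 • multMap ha M l.shape n.shape x =
        (g.1 * f.1) • multMap ha M l.shape n.shape x := by
      by_cases hs : IsHorizontalStrip l.shape n.shape
      · rw [HS.comp_val _ _ hs]
      · rw [multMap_eq_zero ha M hs, smul_zero, smul_zero]
    rw [e, map_smul, smul_smul]
    by_cases h : IsHorizontalStrip l.shape m.shape
    · by_cases h' : IsHorizontalStrip m.shape n.shape
      · rw [multMap_multMap ha M h.1 h'.1]
      · rw [g.2 h', zero_mul, zero_smul, zero_smul]
    · rw [f.2 h, mul_zero, zero_smul, zero_smul]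

instance : (multRep ha M).Additive where
  map_add {l m f g} := by
    refine ModuleCat.hom_ext (LinearMap.ext fun x => ?_)
    exact add_smul f.1 g.1 (multMap ha M l.shape m.shape x)

instance : (multRep ha M).Linear k where
  map_smul {l m} f c := by
    refine ModuleCat.hom_ext (LinearMap.ext fun x => ?_)
    exact mul_smul c f.1 (multMap ha M l.shape m.shape x)

theorem phi_multRep (l m : YoungDiagram) (x : multSpace ha M l) :
    phi (multRep ha M) l m x = multMap ha M l m x := by
  change (HS.strip k l m).1 • multMap ha M l m x = _
  by_cases h : IsHorizontalStrip l m
  · have e : (HS.strip k l m).1 = 1 := if_pos h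
    rw [e, one_smul]
  · rw [multMap_eq_zero ha M h, smul_zero]

/-- The components of an element of a right module. -/
noncomputable def toTabFam (n : ℕ) : M.X.V n →ₗ[k] TabFam (multRep ha M) n :=
  LinearMap.pi fun T => toMultSpace ha M T T.shape

theorem phi_toTabFam (x : M.X.V n) (T : Tab n) {l : YoungDiagram} (h : T.shape ≤ l) :
    phi (multRep ha M) T.shape l (toTabFam ha M n x T) = toMultSpace ha M T l x :=
  (phi_multRep ha M _ _ _).trans (multMap_toMultSpace ha M le_rfl h x)

theorem toTabFam_act (r : Hecke k a n) (x : M.X.V n) :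
    toTabFam ha M n (op r • x) = tabAct ha (multRep ha M) n (op r) (toTabFam ha M n x) := by
  funext T
  rw [tabAct_apply]
  apply Subtype.ext
  refine (theta_act ha M T (shape_stdTab T.shape).symm r x).trans ?_
  have key : Finsupp.linearCombination k (fun R => theta ha M R (stdTab T.shape) x) =
      (multSpace ha M T.shape).subtype.comp
        (gather (multRep ha M) (toTabFam ha M n x) T.shape) := by
    refine Finsupp.lhom_ext' fun R => LinearMap.ext_ring ?_
    change Finsupp.linearCombination k (fun R => theta ha M R (stdTab T.shape) x)
      (Finsupp.single R 1) = (multSpace ha M T.shape).subtype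
        (gather (multRep ha M) (toTabFam ha M n x) T.shape (Finsupp.single R 1))
    rw [gather_single, Finsupp.linearCombination_single, one_smul]
    by_cases h : R.shape ≤ T.shape
    · rw [phi_toTabFam ha M x R h]
      rfl
    · rw [phi_eq_zero _ fun hs => h hs.1, theta_of_not_le ha M (by rwa [shape_stdTab])]
      rfl
  exact LinearMap.congr_fun key _

/-- The morphism from a right module to the module of its multiplicity spaces. -/
noncomputable def toTabMod : M ⟶ tabMod ha (multRep ha M) :=
  RightMod.homMk
    (ofApp fun n =>
      { toFun := toTabFam ha M n
        map_add' := map_add (toTabFam ha M n)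
        map_smul' := fun r => toTabFam_act ha M (unop r) })
    fun h x => by
      funext T
      rw [mulOne_tabMod]
      refine Eq.trans ?_ (phi_toTabFam ha M x (T.trunc h) (Tab.shape_trunc_le h T)).symm
      exact Subtype.ext (theta_mulOne ha M h T (shape_stdTab T.shape).symm x)

/-- By `sum_theta`, an element is the sum of its components, and the component at a tableau is
recovered from its copy at the standard choice `stdTab` of the same shape. The orthogonality of
matrix units makes every family of components occur. -/
theorem toTabFam_bijective (n : ℕ) : Function.Bijective (toTabFam ha M n) := by
  constructor
  · refine (injective_iff_map_eq_zero _).2 fun x hx => ?_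
    rw [← sum_theta ha M x]
    refine Finset.sum_eq_zero fun T _ => ?_
    have h1 : theta ha M T (stdTab T.shape) x = 0 := congrArg Subtype.val (congrFun hx T)
    rw [← theta_theta ha M (shape_stdTab T.shape).ge (shape_stdTab T.shape).le, h1, map_zero]
  · intro y
    refine ⟨∑ S : Tab n, theta ha M (stdTab S.shape) S (y S).1, ?_⟩
    funext T
    apply Subtype.ext
    change theta ha M T (stdTab T.shape) (∑ S : Tab n, theta ha M (stdTab S.shape) S (y S).1) = _
    rw [map_sum, Finset.sum_eq_single T (fun S _ hS => theta_theta_of_ne ha M hS _ _ _) (by simp),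
      theta_theta ha M (shape_stdTab T.shape).le (shape_stdTab T.shape).ge]
    exact (y T).2

instance : (toRightMod a ha).EssSurj where
  mem_essImage M := by
    have : IsIso (toTabMod ha M) := RightMod.isIso_of_bijective _ (toTabFam_bijective ha M)
    exact ⟨⟨multRep ha M, inferInstance, inferInstance⟩, ⟨(asIso (toTabMod ha M)).symm⟩⟩

end EssSurj

instance : (toRightMod a ha).IsEquivalence where

/-- The right modules over the quantum symmetric algebra are equivalent to the representations of
the horizontal strip category. -/
theorem exists_equivalence (ha : IsGeneric a) : ∃ e : RightMod (QSym k a) ≌ LinRep k (HS k),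
    e.functor.Additive ∧ e.functor.Linear k := by
  let e := (toRightMod a ha).asEquivalence
  have : e.functor.Additive := inferInstanceAs (toRightMod a ha).Additive
  have : e.functor.Linear k := inferInstanceAs ((toRightMod a ha).Linear k)
  exact ⟨e.symm, inferInstanceAs e.inverse.Additive, inferInstanceAs (e.inverse.Linear k)⟩

end Equivalence

end HeckeCat

theorem theorem1 :
    (∀ (k : Type u) [Field k] (a : kˣ), HeckeCat.IsGeneric a →
      (IsMonHom (HeckeCat.Rep.proj k a) ∧ ∀ n : ℕ,
        Function.Surjective (HeckeCat.Rep.app (HeckeCat.Rep.proj k a) n) ∧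
        LinearMap.ker (HeckeCat.Rep.app (HeckeCat.Rep.proj k a) n) =
          sSup {N | HeckeCat.Rep.IsSimpleNotOneRow N}) ∧
      ∃ e : HeckeCat.Rep.RightMod (HeckeCat.Rep.QSym k a) ≌ HeckeCat.LinRep k (HeckeCat.HS k),
        e.functor.Additive ∧ e.functor.Linear k) ∧
    HeckeCat.IsGeneric (Units.mk0 (RatFunc.X : RatFunc ℂ) RatFunc.X_ne_zero) ∧
    ∀ (k : Type u) [Field k] [CharZero k], HeckeCat.IsGeneric (1 : kˣ) :=
  ⟨fun _ _ _ ha => ⟨⟨HeckeCat.isMonHom_proj, fun _ =>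
    ⟨HeckeCat.proj_surjective, HeckeCat.ker_proj ha⟩⟩, HeckeCat.exists_equivalence ha⟩,
    HeckeCat.isGeneric_X, fun k _ _ => HeckeCat.isGeneric_one k⟩
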